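/- **Notation.** An overpartition of $n$ is a partition of $n$ in which the first occurrence of each part size may be overlined; its rank is its largest part minus its number of parts, and $\overline N(m,n)$ is the number of overpartitions of $n$ with rank $m$. For $x\in\mathbb Q$ and $z\in\mathbb H$ put $q=e^{2\pi i z}$, let $\eta$ be Dedekind's eta function, and let $$\mathcal O(x;z):=1+\sum_{n\ge 1}\sum_{m\in\mathbb Z}\overline N(m,n)\,e^{2\pi i m x}q^n,\qquad \mathcal U(x;z):=\sin(\pi x)\,\frac{\eta(z/2)}{\eta^2(z)}\sum_{n\in\mathbb Z}\frac{(1+q^n)\,q^{n^2+\frac n2}}{1-2q^n\cos(2\pi x)+q^{2n}},$$ where $q^{n/2}:=e^{\pi i n z}$. For integers $h$ and $k\ge1$ let $$\omega_{h,k}:=\exp\Big(\pi i\sum_{\mu \bmod k}\big(\big(\tfrac{\mu}{k}\big)\big)\big(\big(\tfrac{h\mu}{k}\big)\big)\Big),$$ with $((x))=x-\lfloor x\rfloor-\frac12$ for $x\notin\mathbb Z$ and $((x))=0$ for $x\in\mathbb Z$. For integers $0<a<c$ with $c$ odd let $$\Theta_{a,c}(\tau):=\sum_{n\equiv 4a+c\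 (\mathrm{mod}\ 2c)}n\,e^{2\pi i\tau n^2/(16c^2)},\qquad J\big(\tfrac ac;z\big):=-\frac{i\tan(\pi a/c)}{4c}\int_{-\bar z}^{i\infty}\frac{(-i\tau)^{-3/2}\,\Theta_{a,c}(-1/\tau)}{\sqrt{-i(\tau+z)}}\,d\tau,$$ $$\mathcal M\big(\tfrac ac;z\big):=\mathcal O\big(\tfrac ac;z\big)-J\big(\tfrac ac;z\big).$$ All roots and half-integral powers are principal, and the integral is taken along the vertical line from $-\bar z$. For $A=\left(\begin{smallmatrix}\alpha&\beta\\ \gamma&\delta\end{smallmatrix}\right)\in \mathrm{SL}_2(\mathbb Z)$ with $\gamma>0$, the *holomorphic part of $\mathcal O\big(\frac ac;\frac{\alpha z+\beta}{\gamma z+\delta}\big)$* means the (unique) holomorphic function $H$ on $\mathbb H$ such that $$\mathcal M\Big(\frac ac;\frac{\alpha z+\beta}{\gamma z+\delta}\Big)=H(z)+(-i(\gamma z+\delta))^{1/2}\int_{-\bar z}^{i\infty}\frac{g(\tau)}{\sqrt{-i(\tau+z)}}\,d\tau\qquad(z\in\mathbb H)$$ for some holomorphic $g:\mathbb H\to\mathbb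 C$ with $g(\tau)=O(e^{-\varepsilon\,\mathrm{Im}\,\tau})$ on $\mathrm{Im}\,\tau\ge 1$ for some $\varepsilon>0$. **Corollary 2.3.** Let $0<a<c$ be integers with $c$ odd, let $\left(\begin{smallmatrix}\alpha&\beta\\ \gamma&\delta\end{smallmatrix}\right)\in\Gamma_0(c)$ with $\gamma>0$, and put $\gamma_1:=\gamma/(c,\gamma)$. Then the holomorphic part of $\mathcal O\big(\frac ac;\frac{\alpha z+\beta}{\gamma z+\delta}\big)$ exists and is given as follows. 1. If $\gamma$ is even, it is $$i\,e^{2\pi i a^2\delta\gamma_1/c}\,\tan\Big(\frac{\pi a}{c}\Big)\cot\Big(\frac{\pi a\delta}{c}\Big)\frac{\omega_{\alpha,\gamma}^2}{\omega_{\alpha,\gamma/2}}\,(-i(\gamma z+\delta))^{1/2}\,\mathcal O\Big(\frac{a\delta}{c};z\Big).$$ 2. If $\gamma$ is odd and $\delta$ is even, it is $$-\sqrt2\,i\,e^{-\frac{\pi i\delta}{8\gamma}+\frac{2\pi i a^2\delta\gamma_1}{c}}\,\tan\Big(\frac{\pi a}{c}\Big)\frac{\omega_{\alpha,\gamma}^2}{\omega_{2\alpha,\gamma}}\,(-i(\gamma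 z+\delta))^{1/2}\,\mathcal U\Big(-\frac{a\delta}{c};z\Big).$$ 3. If $\gamma$ and $\delta$ are both odd, it is $$-\sqrt2\,i\,e^{-\frac{\pi i(\delta-\gamma)}{8\gamma}+\frac{2\pi i a^2(\delta-\gamma)\gamma_1}{c}}\,\tan\Big(\frac{\pi a}{c}\Big)\frac{\omega_{\alpha,\gamma}^2}{\omega_{2\alpha,\gamma}}\,(-i(\gamma z+\delta))^{1/2}\,\mathcal U\Big(-\frac{a(\delta-\gamma)}{c};z+1\Big).$$ -/

import Mathlib

open scoped MatrixGroups

namespace OverpartitionRank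

/-! ### Overpartitions and their rank -/

/-- An overpartition of `n`: a partition of `n` together with the set of those part sizes whose
first occurrence is overlined. -/
structure Overpartition (n : ℕ) where
  toPartition : n.Partition
  overlined : Finset ℕ
  overlined_subset : overlined ⊆ toPartition.parts.toFinset

/-- Dyson's rank: the largest part minus the number of parts. -/
def Overpartition.rank {n : ℕ} (P : Overpartition n) : ℤ :=
  (P.toPartition.parts.sup : ℤ) - (Multiset.card P.toPartition.parts : ℤ)

/-- The number of overpartitions of `n` with rank `m`. -/
noncomputable def rankCount (m : ℤ) (n : ℕ) : ℕ :=
  Nat.card {P : Overpartition n // P.rank = m}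

/-- The two-variable generating function
`𝒪(u; q) = 1 + ∑_{n ≥ 1} ∑_m N(m, n) u ^ m q ^ n`; the rank of an overpartition of `n ≥ 1` lies
between `-n` and `n`, so the sum over `m` is finite. -/
noncomputable def rankGen (u q : ℂ) : ℂ :=
  1 + ∑' n : ℕ+, (∑ m ∈ Finset.Icc (-(n : ℤ)) (n : ℤ), (rankCount m n : ℂ) * u ^ m) * q ^ (n : ℕ)

/-- `e(w) = exp (2 π i w)`. -/
noncomputable def e (w : ℂ) : ℂ := Complex.exp (2 * Real.pi * Complex.I * w)

/-- `𝒪(x; z)` for a rational (or real) number `x`: the function `𝒪(u; q)` at `u = e(x)`,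
`q = e(z)`. -/
noncomputable def calO (x : ℝ) (z : ℂ) : ℂ := rankGen (e x) (e z)

/-- `𝒰(x; z) = sin(π x) η(z/2) / η(z)² ·
∑_{n ∈ ℤ} (1 + q ^ n) q ^ (n² + n/2) / (1 - 2 q ^ n cos(2 π x) + q ^ (2 n))`, `q = e(z)`. -/
noncomputable def calU (x : ℝ) (z : ℂ) : ℂ :=
  (Real.sin (Real.pi * x) : ℂ) * (ModularForm.eta (z / 2) / ModularForm.eta z ^ 2) *
    ∑' n : ℤ, (1 + e (n * z)) * e (((n : ℂ) ^ 2 + n / 2) * z) /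
      (1 - 2 * e (n * z) * (Real.cos (2 * Real.pi * x) : ℂ) + e (2 * n * z))

/-! ### The multiplier `ω_{h,k}` -/

/-- The sawtooth function `((x))`. -/
noncomputable def saw (x : ℝ) : ℝ := if Int.fract x = 0 then 0 else Int.fract x - 1 / 2

/-- `ω_{h,k} = exp (π i ∑_{μ mod k} ((μ / k)) ((h μ / k)))` for `k ≥ 1`. -/
noncomputable def omega (h k : ℤ) : ℂ :=
  Complex.exp (Real.pi * Complex.I *
    ((∑ μ ∈ Finset.Ico 0 k, saw ((μ : ℝ) / k) * saw ((h : ℝ) * μ / k) : ℝ) : ℂ))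

/-! ### The completion of `𝒪(a/c; z)` for odd `c` -/

/-- `θ(α, β; τ) = ∑_{n ≡ α mod β} n exp (2 π i τ n² / (2 β))`, summed over `n = α + β m`. -/
noncomputable def theta (α β : ℤ) (τ : ℂ) : ℂ :=
  ∑' m : ℤ, ((α + β * m : ℤ) : ℂ) * e (τ * ((α + β * m : ℤ) : ℂ) ^ 2 / (2 * β))

/-- The cuspidal theta function `Θ_{a,c}(τ) = θ(4 a + c, 2 c; τ / (4 c))` for odd `c`. -/
noncomputable def Theta (a c : ℕ) (τ : ℂ) : ℂ :=
  theta (4 * a + c) (2 * c) (τ / (4 * c))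

/-- `∫_{-z̄}^{i∞} g(τ) / √(-i (τ + z)) dτ`, along the vertical path `τ = -z̄ + i t`. -/
noncomputable def periodIntegral (g : ℂ → ℂ) (z : ℂ) : ℂ :=
  ∫ t in Set.Ioi (0 : ℝ),
    g (-(starRingEnd ℂ z) + Complex.I * t) /
      (-Complex.I * ((-(starRingEnd ℂ z) + Complex.I * t) + z)) ^ (1 / 2 : ℂ) * Complex.I

/-- The non-holomorphic integral
`J(a/c; z) = -(i tan(π a / c) / (4 c)) ·
  ∫_{-z̄}^{i∞} (-i τ) ^ (-3/2) Θ_{a,c}(-1/τ) / √(-i (τ + z)) dτ`. -/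
noncomputable def J (a c : ℕ) (z : ℂ) : ℂ :=
  -(Complex.I * (Real.tan (Real.pi * a / c) : ℂ) / (4 * c)) *
    periodIntegral (fun τ => (-Complex.I * τ) ^ (-(3 / 2) : ℂ) * Theta a c (-1 / τ)) z

/-- The completed function `ℳ(a/c; z) = 𝒪(a/c; z) - J(a/c; z)`. -/
noncomputable def calM (a c : ℕ) (z : ℂ) : ℂ := calO ((a : ℝ) / c) z - J a c z

/-! ### Holomorphic parts -/

/-- The open upper half-plane, as a subset of `ℂ`. -/
def upperHalf : Set ℂ := {z : ℂ | 0 < z.im}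

/-- `z ↦ (α z + β) / (γ z + δ)`. -/
noncomputable def mobius (A : SL(2, ℤ)) (z : ℂ) : ℂ :=
  ((A 0 0 : ℂ) * z + (A 0 1 : ℂ)) / ((A 1 0 : ℂ) * z + (A 1 1 : ℂ))

/-- `(-i (γ z + δ)) ^ (1/2)` (principal branch). -/
noncomputable def autFactor (A : SL(2, ℤ)) (z : ℂ) : ℂ :=
  (-Complex.I * ((A 1 0 : ℂ) * z + (A 1 1 : ℂ))) ^ (1 / 2 : ℂ)

/-- `H` is the holomorphic part of `z ↦ F (A z)`, for a function `F` on the upper half-plane that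
transforms in weight `1/2`: `H` is holomorphic, and `F (A z) - H z` is `(-i (γ z + δ)) ^ (1/2)`
times a non-holomorphic period integral `∫_{-z̄}^{i∞} g(τ) / √(-i (τ + z)) dτ` of a holomorphic
function `g` that decays exponentially at `i∞`, as cusp forms of weight `3/2` do.

There is at most one such `H`: applying `∂/∂z̄` to the period integral gives back
`g(-z̄) / √(2 Im z)`, hence a period integral that is holomorphic in `z` is zero. -/
def IsHolomorphicPart (A : SL(2, ℤ)) (F H : ℂ → ℂ) : Prop :=
  DifferentiableOn ℂ H upperHalf ∧
    ∃ g : ℂ → ℂ, DifferentiableOn ℂ g upperHalf ∧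
      (∃ C ε : ℝ, 0 < ε ∧ ∀ τ : ℂ, 1 ≤ τ.im → ‖g τ‖ ≤ C * Real.exp (-ε * τ.im)) ∧
      ∀ z ∈ upperHalf, F (mobius A z) = H z + autFactor A z * periodIntegral g z

end OverpartitionRank

/-! The completed function is, up to an eta quotient, a lattice sum whose modularity is visible. For
`w = x + m + n z` and `y = Im z` consider the sum over `(n, m)` of a sign times `e(-n x) exp(-π |w|²
/ y) / w`, divided by `π` (`latSum`). A substitution `z ↦ A z` with `c ∣ γ` sends `w` to `w' / (γ z
+ δ)`, where `w'` runs over the same kind of lattice with `x = a / c` replaced by `a δ / c`, and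
`|w|² / y` does not change. So the sum has weight 1, with an explicit root of unity
(`latTerm_transform`, `latSum_transform`). Only the sign character can change: `(-1) ^ n` stays
`(-1) ^ n` for even `γ`, and becomes `(-1) ^ m` for even `δ`.

Poisson summation in `m` alone (`poisson_errInt`, `IsSignKernel.completion`) turns the inner sum
into `cot` for trivial sign, or `1 / sin` for the sign `(-1) ^ m`, plus a series of error functions.
Each error function is the period integral of one exponential (`signErr_mul_e`). Summing over `n` by
completing the square splits off a theta constant, so that `latSum` is an Appell sum plus theta
constant times the period integral of a unary theta series (`latSum_eq`, `latSum_cot`,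
`latSum_csc`).

The two Appell sums are `𝒪` and `𝒰` multiplied by their theta constants. For `𝒰` this is a pairing
of `n` with `-n` (`thetaQuarter_mul_calU`). For `𝒪` the rank generating function is summed over the
largest part, and the resulting basic hypergeometric series and the Appell sum are shown to satisfy
the same inhomogeneous `q`-difference equation in `u`; the homogeneous equation has no nonzero
holomorphic solution on the domain in question (`eq_zero_of_qDifference`,
`theta4_mul_hyper_eq_appell`, `theta4_mul_calO`). By inversion of a theta series, `J` is exactly the
period integral attached to the `cot` sum, whence `theta4_mul_calM`.

It remains to divide by the theta constant, which is the eta quotient `η(z)² / η(2 z)`. The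
Dedekind-sum multiplier of eta (`eta_transform`, by Euclid's algorithm and Dedekind reciprocity)
yields the factors `ω` and lowers the weight from 1 to 1/2. When `γ` and `δ` are both odd, `A` is
replaced by its product with the inverse translation, evaluated at `z + 1`, which brings back the
case of even `δ`. -/

namespace OverpartitionRank

/-! ### Evaluation of power series -/

/-- The power series `F` converges absolutely at `q`, with sum `v`. -/
def AbsEval (F : PowerSeries ℂ) (q v : ℂ) : Prop :=
  (Summable fun n => ‖PowerSeries.coeff n F * q ^ n‖) ∧
    HasSum (fun n => PowerSeries.coeff n F * q ^ n) v

lemma AbsEval.mul {F G : PowerSeries ℂ} {q v w : ℂ} (hF : AbsEval F q v) (hG : AbsEval G q w) :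
    AbsEval (F * G) q (v * w) := by
  have key : ∀ n : ℕ, ∑ kl ∈ Finset.HasAntidiagonal.antidiagonal n,
      (PowerSeries.coeff kl.1 F * q ^ kl.1) * (PowerSeries.coeff kl.2 G * q ^ kl.2) =
      PowerSeries.coeff n (F * G) * q ^ n := by
    intro n
    rw [PowerSeries.coeff_mul, Finset.sum_mul]
    refine Finset.sum_congr rfl fun p hp => ?_
    rw [← Finset.HasAntidiagonal.mem_antidiagonal.mp hp, pow_add]
    ring
  have h1 := summable_norm_sum_mul_antidiagonal_of_summable_norm hF.1 hG.1
  have h2 := tsum_mul_tsum_eq_tsum_sum_antidiagonal_of_summable_norm hF.1 hG.1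
  simp only [key] at h1 h2
  refine ⟨h1, ?_⟩
  rw [← hF.2.tsum_eq, ← hG.2.tsum_eq, h2]
  exact h1.of_norm.hasSum

lemma AbsEval.one_add (t q : ℂ) {L : ℕ} (hL : L ≠ 0) :
    AbsEval (1 + PowerSeries.C t * PowerSeries.X ^ L) q (1 + t * q ^ L) := by
  have hc : ∀ n, PowerSeries.coeff n (1 + PowerSeries.C t * PowerSeries.X ^ L) * q ^ n =
      (if n = 0 then 1 else 0) + (if n = L then t * q ^ L else 0) := by
    intro n
    rw [map_add, PowerSeries.coeff_one, PowerSeries.coeff_C_mul, PowerSeries.coeff_X_pow]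
    by_cases h0 : n = 0 <;> by_cases h1 : n = L <;> simp [h0, h1] <;> simp_all
  have hs : HasSum (fun n => PowerSeries.coeff n (1 + PowerSeries.C t * PowerSeries.X ^ L) * q ^ n)
      (1 + t * q ^ L) := by
    simp only [hc]
    exact (hasSum_ite_eq 0 _).add (hasSum_ite_eq L _)
  exact ⟨hs.summable.norm, hs⟩

/-- The coefficients of the inverse series satisfy a recursion that multiplies by `t`, hence stay
bounded by 1, and a geometric series dominates. The value is then forced by multiplicativity of
evaluation. -/
lemma AbsEval.inv_one_sub {t q : ℂ} (ht : ‖t‖ ≤ 1) (hq : ‖q‖ < 1) {L : ℕ} (hL : L ≠ 0) :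
    AbsEval (1 + PowerSeries.C (-t) * PowerSeries.X ^ L)⁻¹ q (1 - t * q ^ L)⁻¹ := by
  set D : PowerSeries ℂ := 1 + PowerSeries.C (-t) * PowerSeries.X ^ L with hD
  have hmul : D * D⁻¹ = 1 := by
    apply PowerSeries.mul_inv_cancel
    simp [hD, hL]
  have hrec : ∀ n, PowerSeries.coeff n D⁻¹ =
      (if n = 0 then 1 else 0) + (if L ≤ n then t * PowerSeries.coeff (n - L) D⁻¹ else 0) := by
    intro n
    have h := congrArg (PowerSeries.coeff n) hmul
    rw [hD, add_mul, one_mul, mul_assoc, map_add, PowerSeries.coeff_C_mul,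
      PowerSeries.coeff_X_pow_mul', PowerSeries.coeff_one, ← hD] at h
    rw [← h]
    split_ifs <;> ring
  have hb : ∀ n, ‖PowerSeries.coeff n D⁻¹‖ ≤ 1 := by
    intro n
    induction n using Nat.strong_induction_on with
    | _ n ih =>
      rw [hrec n]
      by_cases h : L ≤ n
      · have hn : n ≠ 0 := by omega
        simp only [hn, if_false, h, if_true, zero_add, norm_mul]
        exact mul_le_one₀ ht (norm_nonneg _) (ih _ (by omega))
      · simp only [h, if_false, add_zero]
        split_ifs <;> simp
  have hsum : Summable fun n => ‖PowerSeries.coeff n D⁻¹ * q ^ n‖ := by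
    refine Summable.of_nonneg_of_le (fun _ => norm_nonneg _) (fun n => ?_)
      (summable_geometric_of_lt_one (norm_nonneg q) hq)
    rw [norm_mul, norm_pow]
    exact mul_le_of_le_one_left (by positivity) (hb n)
  have hev : AbsEval D⁻¹ q (∑' n, PowerSeries.coeff n D⁻¹ * q ^ n) := ⟨hsum, hsum.of_norm.hasSum⟩
  have h1 := (AbsEval.one_add (-t) q hL).mul hev
  rw [← hD, hmul] at h1
  have h2 : HasSum (fun n => PowerSeries.coeff n (1 : PowerSeries ℂ) * q ^ n) 1 := by
    convert! hasSum_ite_eq (0 : ℕ) (1 : ℂ) using 2 with n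
    rw [PowerSeries.coeff_one]
    split_ifs with h <;> simp [h]
  have h3 := h1.2.unique h2
  have : (1 - t * q ^ L)⁻¹ = ∑' n, PowerSeries.coeff n D⁻¹ * q ^ n := by
    refine inv_eq_of_mul_eq_one_right ?_
    linear_combination h3
  rw [this]
  exact hev

/-! ### Overpartitions with bounded parts -/

/-- The generating function of overpartitions whose parts are at most `l`; `t` marks the number of
parts. -/
noncomputable def boundedGen (t : ℂ) (l : ℕ) : PowerSeries ℂ :=
  Nat.Partition.genFun fun i c => if i ≤ l then 2 * t ^ c else 0

-- A part size that occurs may or may not be overlined, whence the weight 2 and the factor `1 + 2 ∑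
-- (t X ^ (l + 1)) ^ j`, with `j ≥ 1`. The geometric recursion for this sum identifies the factor
-- with `(1 + t X ^ (l + 1)) / (1 - t X ^ (l + 1))`.
open scoped PowerSeries.WithPiTopology in
lemma boundedGen_succ (t : ℂ) (l : ℕ) :
    boundedGen t (l + 1) = boundedGen t l * ((1 + PowerSeries.C t * PowerSeries.X ^ (l + 1)) *
      (1 + PowerSeries.C (-t) * PowerSeries.X ^ (l + 1))⁻¹) := by
  let fac : ℕ → PowerSeries ℂ := fun i =>
    1 + ∑' j : ℕ, (2 * t ^ (j + 1)) • PowerSeries.X ^ ((i + 1) * (j + 1))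
  have hprod : ∀ k, boundedGen t k = ∏ i ∈ Finset.range k, fac i := by
    intro k
    refine (Nat.Partition.hasProd_genFun (R := ℂ) _).unique ?_
    have h : HasProd (fun i : ℕ =>
      (1 + ∑' j : ℕ, (if i + 1 ≤ k then 2 * t ^ (j + 1) else 0) •
        (PowerSeries.X : PowerSeries ℂ) ^ ((i + 1) * (j + 1)))) _ :=
      hasProd_prod_of_ne_finset_one (s := Finset.range k) (by
        intro i hi
        have : ¬ (i + 1 ≤ k) := by simpa using hi
        simp [this])
    convert! h using 1
    refine Finset.prod_congr rfl fun i hi => ?_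
    have : i + 1 ≤ k := by simpa using hi
    simp [this, fac]
  rw [hprod, hprod, Finset.prod_range_succ]
  congr 1
  have hS := Nat.Partition.summable_genFun_term (R := ℂ) (fun _ c => 2 * t ^ c) l
  set Y := ∑' j : ℕ, (2 * t ^ (j + 1)) • (PowerSeries.X : PowerSeries ℂ) ^ ((l + 1) * (j + 1)) with hY
  have h1 : Y = (2 * t) • PowerSeries.X ^ (l + 1) + PowerSeries.C t * PowerSeries.X ^ (l + 1) * Y := by
    conv_lhs => rw [hY, hS.tsum_eq_zero_add]
    rw [hY, ← hS.tsum_mul_left]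
    simp only [zero_add, pow_one, mul_one]
    congr 1
    refine tsum_congr fun j => ?_
    rw [PowerSeries.smul_eq_C_mul, PowerSeries.smul_eq_C_mul, pow_succ t (j + 1),
      show (l + 1) * (j + 1 + 1) = (l + 1) + (l + 1) * (j + 1) by ring, pow_add, ← mul_assoc,
      map_mul, map_mul, map_mul]
    ring
  have hc : PowerSeries.constantCoeff
      (1 + PowerSeries.C (-t) * PowerSeries.X ^ (l + 1) : PowerSeries ℂ) ≠ 0 := by simp
  rw [PowerSeries.eq_mul_inv_iff_mul_eq hc]
  change (1 + Y) * _ = _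
  rw [PowerSeries.smul_eq_C_mul, map_mul] at h1
  have h2 : (PowerSeries.C (2 : ℂ)) = 2 := map_ofNat _ 2
  rw [h2] at h1
  rw [map_neg]
  linear_combination h1

lemma boundedGen_zero (t : ℂ) : boundedGen t 0 = 1 := by
  ext n
  rw [boundedGen, Nat.Partition.coeff_genFun, PowerSeries.coeff_one]
  rcases Nat.eq_zero_or_pos n with rfl | hn
  · simp
  · rw [if_neg hn.ne']
    refine Finset.sum_eq_zero fun p _ => ?_
    have hne : p.parts ≠ 0 := by
      intro h
      have := p.parts_sum
      simp [h] at this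
      omega
    obtain ⟨i, hi⟩ := Multiset.exists_mem_of_ne_zero hne
    refine Finset.prod_eq_zero (i := i) (by simpa using hi) ?_
    have := p.parts_pos hi
    simp; omega

/-- The value of `boundedGen t l` at `q`. -/
noncomputable def boundedVal (t q : ℂ) (l : ℕ) : ℂ :=
  ∏ j ∈ Finset.range l, ((1 + t * q ^ (j + 1)) * (1 - t * q ^ (j + 1))⁻¹)

lemma absEval_boundedGen {t q : ℂ} (ht : ‖t‖ ≤ 1) (hq : ‖q‖ < 1) (l : ℕ) :
    AbsEval (boundedGen t l) q (boundedVal t q l) := by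
  induction l with
  | zero =>
    rw [boundedGen_zero, boundedVal, Finset.prod_range_zero]
    have := AbsEval.one_add 0 q one_ne_zero
    simpa using this
  | succ l ih =>
    rw [boundedGen_succ, boundedVal, Finset.prod_range_succ]
    exact ih.mul ((AbsEval.one_add t q l.succ_ne_zero).mul (AbsEval.inv_one_sub ht hq l.succ_ne_zero))

/-- The number of overlinings of a partition, weighted by `t` to the number of parts. -/
noncomputable def overWeight (t : ℂ) {n : ℕ} (p : n.Partition) : ℂ :=
  2 ^ p.parts.toFinset.card * t ^ (Multiset.card p.parts)

lemma coeff_boundedGen (t : ℂ) (l n : ℕ) : PowerSeries.coeff n (boundedGen t l) =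
    ∑ p : n.Partition, if p.parts.sup ≤ l then overWeight t p else 0 := by
  rw [boundedGen, Nat.Partition.coeff_genFun]
  refine Finset.sum_congr rfl fun p _ => ?_
  rw [Finsupp.prod, Multiset.toFinsupp_support]
  split_ifs with h
  · have h' : ∀ i ∈ p.parts.toFinset, i ≤ l := fun i hi =>
      (Multiset.le_sup (Multiset.mem_toFinset.mp hi)).trans h
    rw [overWeight, ← Multiset.toFinset_sum_count_eq, ← Finset.prod_const,
      ← Finset.prod_pow_eq_pow_sum, ← Finset.prod_mul_distrib]
    exact Finset.prod_congr rfl fun i hi => by simp [h' i hi]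
  · rw [Multiset.sup_le] at h
    push Not at h
    obtain ⟨i, hi, hl⟩ := h
    exact Finset.prod_eq_zero (i := i) (by simpa using hi) (by simp; omega)

/-- The weighted number of overpartitions of `n` with largest part `l + 1`. -/
noncomputable def largestCoeff (t : ℂ) (l n : ℕ) : ℂ :=
  ∑ p : n.Partition, if p.parts.sup = l + 1 then overWeight t p else 0

/-- Prescribing the largest part is a difference of two bounds on the parts, so the generating
function becomes a difference of two finite products. -/
lemma largestCoeff_eq (t : ℂ) (l n : ℕ) : largestCoeff t l n =
    PowerSeries.coeff n (boundedGen t (l + 1)) - PowerSeries.coeff n (boundedGen t l) := by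
  rw [coeff_boundedGen, coeff_boundedGen, largestCoeff, ← Finset.sum_sub_distrib]
  refine Finset.sum_congr rfl fun p _ => ?_
  rcases lt_trichotomy p.parts.sup (l + 1) with h | h | h
  · rw [if_neg h.ne, if_pos h.le, if_pos (by omega), sub_self]
  · rw [if_pos h, if_pos h.le, if_neg (by omega), sub_zero]
  · rw [if_neg h.ne', if_neg (by omega), if_neg (by omega), sub_self]

lemma hasSum_largestCoeff {t q : ℂ} (ht : ‖t‖ ≤ 1) (hq : ‖q‖ < 1) (l : ℕ) :
    HasSum (fun n => largestCoeff t l n * q ^ n)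
      (2 * t * q ^ (l + 1) * boundedVal t q l * (1 - t * q ^ (l + 1))⁻¹) := by
  have h := (absEval_boundedGen ht hq (l + 1)).2.sub (absEval_boundedGen ht hq l).2
  have hne : 1 - t * q ^ (l + 1) ≠ 0 := by
    intro h0
    have : ‖t * q ^ (l + 1)‖ = 1 := by rw [← sub_eq_zero.mp h0]; simp
    rw [norm_mul, norm_pow] at this
    have h1 : ‖q‖ ^ (l + 1) < 1 := pow_lt_one₀ (norm_nonneg _) hq l.succ_ne_zero
    nlinarith [norm_nonneg t, pow_nonneg (norm_nonneg q) (l + 1)]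
  convert! h using 1
  · ext n; rw [largestCoeff_eq, sub_mul]
  · rw [boundedVal, boundedVal, Finset.prod_range_succ]
    field_simp
    ring

lemma norm_overWeight_le {t : ℂ} (ht : ‖t‖ ≤ 1) {n : ℕ} (p : n.Partition) :
    ‖overWeight t p‖ ≤ ‖overWeight 1 p‖ := by
  simp only [overWeight, norm_mul, norm_pow, one_pow, mul_one]
  exact mul_le_of_le_one_right (by positivity) (pow_le_one₀ (norm_nonneg _) ht)

lemma norm_largestCoeff_le {t : ℂ} (ht : ‖t‖ ≤ 1) (l n : ℕ) :
    ‖largestCoeff t l n‖ ≤ ‖largestCoeff 1 l n‖ := by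
  have h1 : largestCoeff 1 l n =
      ((∑ p : n.Partition, if p.parts.sup = l + 1 then (2 : ℝ) ^ p.parts.toFinset.card else 0 : ℝ) : ℂ) := by
    rw [largestCoeff]
    push_cast
    exact Finset.sum_congr rfl fun p _ => by split_ifs <;> simp [overWeight]
  rw [h1, Complex.norm_real, Real.norm_of_nonneg
    (Finset.sum_nonneg fun p _ => by split_ifs <;> positivity)]
  refine (norm_sum_le _ _).trans (Finset.sum_le_sum fun p _ => ?_)
  split_ifs
  · refine (norm_overWeight_le ht p).trans (le_of_eq ?_)
    simp [overWeight]
  · simp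

lemma norm_largestCoeff_one (l n : ℕ) : ((‖largestCoeff 1 l n‖ : ℝ) : ℂ) = largestCoeff 1 l n := by
  have h1 : largestCoeff 1 l n =
      ((∑ p : n.Partition, if p.parts.sup = l + 1 then (2 : ℝ) ^ p.parts.toFinset.card else 0 : ℝ) : ℂ) := by
    rw [largestCoeff]
    push_cast
    exact Finset.sum_congr rfl fun p _ => by split_ifs <;> simp [overWeight]
  rw [h1, Complex.norm_real, Real.norm_of_nonneg
    (Finset.sum_nonneg fun p _ => by split_ifs <;> positivity)]

/-! ### The rank generating function -/

/-- An overpartition as a partition with a set of part sizes. -/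
def Overpartition.equivSigma (n : ℕ) :
    Overpartition n ≃ Σ p : n.Partition, {S : Finset ℕ // S ∈ p.parts.toFinset.powerset} where
  toFun P := ⟨P.toPartition, P.overlined, Finset.mem_powerset.mpr P.overlined_subset⟩
  invFun p := ⟨p.1, p.2.1, Finset.mem_powerset.mp p.2.2⟩
  left_inv _ := rfl
  right_inv _ := rfl

noncomputable instance (n : ℕ) : Fintype (Overpartition n) :=
  Fintype.ofEquiv _ (Overpartition.equivSigma n).symm

lemma Overpartition.rank_mem {n : ℕ} (P : Overpartition n) :
    P.rank ∈ Finset.Icc (-(n : ℤ)) (n : ℤ) := by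
  have h1 : P.toPartition.parts.sup ≤ n := Multiset.sup_le.mpr fun i hi =>
    P.toPartition.le_of_mem_parts hi
  have h2 : Multiset.card P.toPartition.parts ≤ n := by
    have := Multiset.card_nsmul_le_sum (s := P.toPartition.parts) (a := 1)
      (fun x hx => P.toPartition.parts_pos hx)
    rw [P.toPartition.parts_sum] at this
    simpa using this
  rw [Finset.mem_Icc, Overpartition.rank]
  omega

/-- The rank of an overpartition depends only on the underlying partition, so the choices of
overlined sizes contribute a power of 2, and `u ^ rank` splits into a largest-part weight and a
number-of-parts weight `u⁻¹`. -/
lemma sum_rankCount {u : ℂ} (hu : u ≠ 0) (n : ℕ) :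
    ∑ m ∈ Finset.Icc (-(n : ℤ)) (n : ℤ), (rankCount m n : ℂ) * u ^ m =
      ∑ p : n.Partition, overWeight u⁻¹ p * u ^ p.parts.sup := by
  classical
  have h1 : ∀ m : ℤ, (rankCount m n : ℂ) * u ^ m =
      ∑ P : Overpartition n, if P.rank = m then u ^ m else 0 := by
    intro m
    rw [rankCount, Nat.card_eq_fintype_card, Fintype.card_subtype, ← Finset.sum_filter,
      Finset.sum_const, nsmul_eq_mul]
  simp only [h1]
  rw [Finset.sum_comm]
  have h2 : ∀ P : Overpartition n, (∑ m ∈ Finset.Icc (-(n : ℤ)) (n : ℤ),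
      if P.rank = m then u ^ m else 0) = u ^ P.rank := by
    intro P
    rw [Finset.sum_ite_eq, if_pos P.rank_mem]
  simp only [h2]
  rw [← (Overpartition.equivSigma n).symm.sum_comp, Fintype.sum_sigma]
  refine Finset.sum_congr rfl fun p _ => ?_
  have h3 : ∀ S : {S : Finset ℕ // S ∈ p.parts.toFinset.powerset},
      u ^ ((Overpartition.equivSigma n).symm ⟨p, S⟩).rank =
        u⁻¹ ^ (Multiset.card p.parts) * u ^ p.parts.sup := by
    intro S
    change u ^ ((p.parts.sup : ℤ) - (Multiset.card p.parts : ℤ)) = _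
    rw [zpow_sub₀ hu, zpow_natCast, zpow_natCast, inv_pow]
    field_simp
  simp only [h3]
  rw [Finset.sum_const, Finset.card_univ, Fintype.card_coe, Finset.card_powerset, nsmul_eq_mul,
    overWeight]
  push_cast
  ring

lemma hasSum_largestCoeff_index {u t : ℂ} {n : ℕ} (hn : n ≠ 0) :
    HasSum (fun l => u ^ (l + 1) * largestCoeff t l n)
      (∑ p : n.Partition, overWeight t p * u ^ p.parts.sup) := by
  have h : ∀ p : n.Partition, HasSum
      (fun l => u ^ (l + 1) * if p.parts.sup = l + 1 then overWeight t p else 0)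
      (overWeight t p * u ^ p.parts.sup) := by
    intro p
    have hpos : 0 < p.parts.sup := by
      have hne : p.parts ≠ 0 := by
        intro h
        have := p.parts_sum
        simp [h] at this
        omega
      obtain ⟨i, hi⟩ := Multiset.exists_mem_of_ne_zero hne
      exact (p.parts_pos hi).trans_le (Multiset.le_sup hi)
    obtain ⟨k, hk⟩ := Nat.exists_eq_add_one_of_ne_zero hpos.ne'
    convert! hasSum_ite_eq k (overWeight t p * u ^ p.parts.sup) using 2 with l
    by_cases hl : l = k
    · rw [if_pos hl, if_pos (by omega), hk, hl, mul_comm]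
    · rw [if_neg hl, if_neg (by omega), mul_zero]
  have h2 := hasSum_sum (s := Finset.univ) fun p _ => h p
  simpa only [largestCoeff, Finset.mul_sum] using h2

lemma largestCoeff_zero (t : ℂ) (l : ℕ) : largestCoeff t l 0 = 0 := by
  refine Finset.sum_eq_zero fun p _ => ?_
  have : p.parts = 0 := by
    by_contra hne
    obtain ⟨i, hi⟩ := Multiset.exists_mem_of_ne_zero hne
    have h1 := p.parts_pos hi
    have h2 := p.le_of_mem_parts hi
    omega
  rw [this]; simp

lemma one_sub_ne_zero_of_norm_lt {x : ℂ} (hx : ‖x‖ < 1) : 1 - x ≠ 0 := by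
  intro h
  rw [← sub_eq_zero.mp h] at hx
  simp at hx

lemma boundedVal_bound {r : ℝ} (h0 : 0 ≤ r) (hr : r < 1) (l : ℕ) :
    ‖boundedVal 1 (r : ℂ) l‖ ≤ Real.exp (2 * r / (1 - r) ^ 2) := by
  have h1 : boundedVal 1 (r : ℂ) l =
      ((∏ j ∈ Finset.range l, (1 + 2 * r ^ (j + 1) / (1 - r ^ (j + 1))) : ℝ) : ℂ) := by
    rw [boundedVal]
    push_cast
    refine Finset.prod_congr rfl fun j _ => ?_
    have : (1 : ℂ) - (r : ℂ) ^ (j + 1) ≠ 0 := by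
      refine one_sub_ne_zero_of_norm_lt ?_
      rw [norm_pow, Complex.norm_real, Real.norm_of_nonneg h0]
      exact pow_lt_one₀ h0 hr j.succ_ne_zero
    field_simp
    ring
  have hpos : ∀ j : ℕ, 1 - r ≤ 1 - r ^ (j + 1) := fun j => by
    have := pow_le_of_le_one h0 hr.le (Nat.succ_ne_zero j)
    simp only [Nat.succ_eq_add_one] at this
    linarith
  have hr' : 0 < 1 - r := by linarith
  have hterm : ∀ j : ℕ, 2 * r ^ (j + 1) / (1 - r ^ (j + 1)) ≤ 2 * r / (1 - r) * r ^ j := fun j => by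
    have : 2 * r ^ (j + 1) / (1 - r ^ (j + 1)) ≤ 2 * r ^ (j + 1) / (1 - r) :=
      div_le_div_of_nonneg_left (by positivity) hr' (hpos j)
    refine this.trans (le_of_eq ?_)
    rw [pow_succ]; ring
  have hterm0 : ∀ j : ℕ, 0 ≤ 2 * r ^ (j + 1) / (1 - r ^ (j + 1)) := fun j =>
    div_nonneg (by positivity) (hr'.le.trans (hpos j))
  rw [h1, Complex.norm_real, Real.norm_of_nonneg
    (Finset.prod_nonneg fun j _ => add_nonneg zero_le_one (hterm0 j))]
  calc _ ≤ ∏ j ∈ Finset.range l, Real.exp (2 * r / (1 - r) * r ^ j) := by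
        refine Finset.prod_le_prod (fun j _ => add_nonneg zero_le_one (hterm0 j)) fun j _ => ?_
        rw [add_comm]
        exact (add_le_add_left (hterm j) 1).trans (Real.add_one_le_exp _)
    _ = Real.exp (2 * r / (1 - r) * ∑ j ∈ Finset.range l, r ^ j) := by
        rw [← Real.exp_sum, Finset.mul_sum]
    _ ≤ _ := by
        apply Real.exp_le_exp.mpr
        have hs : ∑ j ∈ Finset.range l, r ^ j ≤ (1 - r)⁻¹ := by
          rw [← tsum_geometric_of_lt_one h0 hr]
          exact (summable_geometric_of_lt_one h0 hr).sum_le_tsum _ fun _ _ => by positivity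
        calc _ ≤ 2 * r / (1 - r) * (1 - r)⁻¹ := by gcongr
          _ = _ := by field_simp

/-- Absolute convergence of the double series over size and largest part, needed to exchange the two
sums. All terms are dominated by the case `t = 1`, `q = ‖q‖`, where the coefficients are nonnegative
and the sum over the size is known in closed form; it is `O(‖q‖ ^ l)`. -/
lemma summable_largestCoeff {u t q : ℂ} (hu : ‖u‖ = 1) (ht : ‖t‖ ≤ 1) (hq : ‖q‖ < 1) :
    Summable fun x : ℕ × ℕ => u ^ (x.1 + 1) * largestCoeff t x.1 x.2 * q ^ x.2 := by
  set r := ‖q‖ with hr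
  have h0 : 0 ≤ r := norm_nonneg q
  have hrC : ‖(r : ℂ)‖ < 1 := by rwa [Complex.norm_real, Real.norm_of_nonneg h0]
  have hb : Summable fun x : ℕ × ℕ => ‖largestCoeff 1 x.1 x.2‖ * r ^ x.2 := by
    have hs : ∀ l, HasSum (fun n => ‖largestCoeff 1 l n‖ * r ^ n)
        (2 * (1 : ℂ) * (r : ℂ) ^ (l + 1) * boundedVal 1 r l * (1 - 1 * (r : ℂ) ^ (l + 1))⁻¹).re := by
      intro l
      have h := Complex.hasSum_re (hasSum_largestCoeff (t := 1) (by simp) hrC l)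
      convert! h using 2 with n
      rw [← norm_largestCoeff_one, ← Complex.ofReal_pow, ← Complex.ofReal_mul, Complex.ofReal_re]
      simp
    rw [summable_prod_of_nonneg (fun x => by positivity)]
    refine ⟨fun l => (hs l).summable, ?_⟩
    simp only [fun l => (hs l).tsum_eq]
    refine Summable.of_norm_bounded (g := fun l => 2 * r * Real.exp (2 * r / (1 - r) ^ 2) *
      (1 - r)⁻¹ * r ^ l) ((summable_geometric_of_lt_one h0 hq).mul_left _) fun l => ?_
    refine (Complex.abs_re_le_norm _).trans ?_
    rw [norm_mul, norm_mul, norm_mul, norm_pow, mul_one, Complex.norm_real, Real.norm_of_nonneg h0,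
      one_mul, norm_inv]
    have h1 := boundedVal_bound h0 hq l
    have h2 : ‖1 - (r : ℂ) ^ (l + 1)‖⁻¹ ≤ (1 - r)⁻¹ := by
      apply inv_anti₀ (by linarith)
      have h3 := norm_sub_norm_le (1 : ℂ) ((r : ℂ) ^ (l + 1))
      rw [norm_one, norm_pow, Complex.norm_real, Real.norm_of_nonneg h0] at h3
      have := pow_le_of_le_one h0 hq.le (Nat.succ_ne_zero l)
      simp only [Nat.succ_eq_add_one] at this
      linarith
    have h3 : ‖(2 : ℂ)‖ = 2 := by simp
    rw [h3]
    calc _ ≤ 2 * r ^ (l + 1) * Real.exp (2 * r / (1 - r) ^ 2) * (1 - r)⁻¹ := by gcongr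
      _ = _ := by rw [pow_succ]; ring
  refine Summable.of_norm_bounded hb fun x => ?_
  rw [norm_mul, norm_mul, norm_pow, norm_pow, hu, one_pow, one_mul]
  gcongr
  exact norm_largestCoeff_le ht _ _

lemma rankGen_eq_tsum_largestCoeff {u : ℂ} (hu : ‖u‖ = 1) (q : ℂ) :
    rankGen u q = 1 + ∑' n : ℕ, ∑' l : ℕ, u ^ (l + 1) * largestCoeff u⁻¹ l n * q ^ n := by
  have hu0 : u ≠ 0 := by intro h; simp [h] at hu
  rw [rankGen]
  congr 1
  have h0 : ∑' l : ℕ, u ^ (l + 1) * largestCoeff u⁻¹ l 0 * q ^ 0 = 0 := by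
    simp [largestCoeff_zero]
  rw [show ∑' n : ℕ, ∑' l : ℕ, u ^ (l + 1) * largestCoeff u⁻¹ l n * q ^ n =
    ∑' n : ℕ+, ∑' l : ℕ, u ^ (l + 1) * largestCoeff u⁻¹ l n * q ^ (n : ℕ) from ?_]
  · refine tsum_congr fun n => ?_
    rw [sum_rankCount hu0, tsum_mul_right, (hasSum_largestCoeff_index n.ne_zero).tsum_eq]
  · symm
    refine PNat.coe_injective.tsum_eq
      (f := fun n : ℕ => ∑' l : ℕ, u ^ (l + 1) * largestCoeff u⁻¹ l n * q ^ n) fun n hn => ?_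
    refine ⟨⟨n, Nat.pos_of_ne_zero fun h => hn ?_⟩, rfl⟩
    rw [h]; exact h0

/-- The rank generating function as a single series over the size of the largest part. -/
lemma rankGen_eq_tsum {u q : ℂ} (hu : ‖u‖ = 1) (hq : ‖q‖ < 1) :
    rankGen u q = 1 + ∑' l : ℕ, u ^ (l + 1) *
      (2 * u⁻¹ * q ^ (l + 1) * boundedVal u⁻¹ q l * (1 - u⁻¹ * q ^ (l + 1))⁻¹) := by
  have ht : ‖u⁻¹‖ ≤ 1 := by rw [norm_inv, hu, inv_one]
  have hS : Summable (Function.uncurry fun l n : ℕ => u ^ (l + 1) * largestCoeff u⁻¹ l n * q ^ n) :=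
    summable_largestCoeff hu ht hq
  rw [rankGen_eq_tsum_largestCoeff hu, hS.tsum_comm]
  congr 1
  refine tsum_congr fun l => ?_
  rw [← (hasSum_largestCoeff ht hq l).tsum_eq, ← tsum_mul_left]
  exact tsum_congr fun n => by ring

lemma differentiableOn_rankGen {u : ℂ} (hu : ‖u‖ = 1) :
    DifferentiableOn ℂ (rankGen u) (Metric.ball 0 1) := by
  have ht : ‖u⁻¹‖ ≤ 1 := by rw [norm_inv, hu, inv_one]
  intro q₀ hq₀
  obtain ⟨r, hr0, hr1⟩ := exists_between (mem_ball_zero_iff.mp hq₀)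
  have hrpos : 0 ≤ r := (norm_nonneg _).trans hr0.le
  have hrC : ‖(r : ℂ)‖ < 1 := by rwa [Complex.norm_real, Real.norm_of_nonneg hrpos]
  have hS := (summable_largestCoeff hu ht hrC)
  have hd : DifferentiableOn ℂ (fun q => 1 + ∑' n : ℕ,
      ∑' l : ℕ, u ^ (l + 1) * largestCoeff u⁻¹ l n * q ^ n) (Metric.ball 0 r) := by
    refine DifferentiableOn.const_add _ ?_
    refine Complex.differentiableOn_tsum_of_summable_norm
      (u := fun n => ‖∑' l : ℕ, u ^ (l + 1) * largestCoeff u⁻¹ l n * (r : ℂ) ^ n‖)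
      ?_ ?_ Metric.isOpen_ball ?_
    · have h1 := hS.norm.prod_symm
      refine Summable.of_nonneg_of_le (fun _ => norm_nonneg _) (fun n => ?_) h1.prod
      exact norm_tsum_le_tsum_norm (h1.prod_factor n)
    · intro n
      simp only [tsum_mul_right]
      fun_prop
    · intro n w hw
      simp only [tsum_mul_right, norm_mul, norm_pow, Complex.norm_real, Real.norm_of_nonneg hrpos]
      gcongr
      exact (mem_ball_zero_iff.mp hw).le
  have hfun : rankGen u = fun q => 1 + ∑' n : ℕ,
      ∑' l : ℕ, u ^ (l + 1) * largestCoeff u⁻¹ l n * q ^ n :=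
    funext fun q => rankGen_eq_tsum_largestCoeff hu q
  rw [hfun]
  exact (hd.differentiableAt (Metric.isOpen_ball.mem_nhds
    (mem_ball_zero_iff.mpr hr0))).differentiableWithinAt

end OverpartitionRank

/-! ### Infinite `q`-products and uniqueness for a first-order `q`-difference equation. -/

namespace OverpartitionRank

open Filter Topology Set

/-! ### Infinite products `∏ (1 - x q ^ (i + 1))` -/

/-- `(x q; q)_∞ = ∏_{i ≥ 1} (1 - x q ^ i)`. -/
noncomputable def qProd (q x : ℂ) : ℂ := ∏' i : ℕ, (1 - x * q ^ (i + 1))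

lemma summable_mul_pow_succ {q : ℂ} (hq : ‖q‖ < 1) (x : ℂ) :
    Summable fun i : ℕ => ‖-(x * q ^ (i + 1))‖ := by
  simp only [norm_neg, norm_mul, norm_pow]
  exact ((summable_nat_add_iff 1).mpr (summable_geometric_of_lt_one (norm_nonneg _) hq)).mul_left _

lemma multipliable_qProd {q : ℂ} (hq : ‖q‖ < 1) (x : ℂ) :
    Multipliable fun i : ℕ => 1 - x * q ^ (i + 1) := by
  simpa only [sub_eq_add_neg] using multipliable_one_add_of_summable (summable_mul_pow_succ hq x)

lemma qProd_succ {q : ℂ} (hq : ‖q‖ < 1) (x : ℂ) :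
    qProd q x = (1 - x * q) * qProd q (x * q) := by
  rw [qProd, tprod_eq_zero_mul' ?_]
  · simp only [zero_add, pow_one]
    congr 1
    refine tprod_congr fun i => ?_
    rw [pow_succ q (i + 1)]; ring
  · refine (multipliable_qProd hq (x * q)).congr fun i => ?_
    rw [pow_succ q (i + 1)]; ring

lemma qProd_eq_prod_mul {q : ℂ} (hq : ‖q‖ < 1) (x : ℂ) (n : ℕ) :
    qProd q x = (∏ i ∈ Finset.range n, (1 - x * q ^ (i + 1))) * qProd q (x * q ^ n) := by
  induction n with
  | zero => simp
  | succ n ih =>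
    rw [ih, qProd_succ hq (x * q ^ n), Finset.prod_range_succ, pow_succ]
    ring_nf

lemma qProd_ne_zero {q : ℂ} (hq : ‖q‖ < 1) {x : ℂ} (h : ∀ i : ℕ, 1 - x * q ^ (i + 1) ≠ 0) :
    qProd q x ≠ 0 := by
  rw [qProd]
  simp only [sub_eq_add_neg] at h ⊢
  exact tprod_one_add_ne_zero_of_summable h (summable_mul_pow_succ hq x)

lemma differentiable_qProd {q : ℂ} (hq : ‖q‖ < 1) : Differentiable ℂ (qProd q) := by
  intro x₀
  set R : ℝ := ‖x₀‖ + 1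
  have hx₀ : x₀ ∈ Metric.ball (0 : ℂ) R := by simp [R]
  have hS : Summable fun i : ℕ => R * ‖q‖ ^ (i + 1) :=
    ((summable_nat_add_iff 1).mpr (summable_geometric_of_lt_one (norm_nonneg _) hq)).mul_left _
  have h := hS.hasProdLocallyUniformlyOn_nat_one_add (K := Metric.ball (0 : ℂ) R)
    (f := fun i x => -(x * q ^ (i + 1))) Metric.isOpen_ball
    (Eventually.of_forall fun i x hx => by
      rw [norm_neg, norm_mul, norm_pow]
      gcongr
      exact (mem_ball_zero_iff.mp hx).le) (fun i => by fun_prop)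
  have hd := TendstoLocallyUniformlyOn.differentiableOn h
    (Eventually.of_forall fun s => by
      refine DifferentiableOn.fun_finsetProd fun i _ => ?_
      fun_prop) Metric.isOpen_ball
  have := hd.differentiableAt (Metric.isOpen_ball.mem_nhds hx₀)
  simp only [← sub_eq_add_neg] at this
  exact this

lemma norm_prod_one_add_le {a : ℕ → ℂ} {c r : ℝ} (hc : 0 ≤ c) (h0 : 0 ≤ r) (hr : r < 1)
    (ha : ∀ i, ‖a i‖ ≤ c * r ^ i) (n : ℕ) :
    ‖∏ i ∈ Finset.range n, (1 + a i)‖ ≤ Real.exp (c * (1 - r)⁻¹) := by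
  rw [norm_prod]
  calc ∏ i ∈ Finset.range n, ‖1 + a i‖ ≤ ∏ i ∈ Finset.range n, Real.exp (c * r ^ i) := by
        refine Finset.prod_le_prod (fun _ _ => norm_nonneg _) fun i _ => ?_
        refine (norm_add_le _ _).trans ?_
        rw [norm_one, add_comm]
        exact (add_le_add_left (ha i) 1).trans (Real.add_one_le_exp _)
    _ = Real.exp (c * ∑ i ∈ Finset.range n, r ^ i) := by rw [← Real.exp_sum, Finset.mul_sum]
    _ ≤ _ := by
        apply Real.exp_le_exp.mpr
        have hs : ∑ j ∈ Finset.range n, r ^ j ≤ (1 - r)⁻¹ := by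
          rw [← tsum_geometric_of_lt_one h0 hr]
          exact (summable_geometric_of_lt_one h0 hr).sum_le_tsum _ fun _ _ => by positivity
        gcongr

/-! ### A uniqueness principle for a `q`-difference equation -/

/-- The domain of the `q`-difference equation. -/
def qDomain (q : ℂ) : Set ℂ := {u | u ≠ 0 ∧ ‖u * q‖ < 1}

lemma mul_mem_qDomain {q u : ℂ} (hq0 : q ≠ 0) (hq : ‖q‖ < 1) (hu : u ∈ qDomain q) :
    u * q ∈ qDomain q := by
  refine ⟨mul_ne_zero hu.1 hq0, ?_⟩
  rw [norm_mul]
  exact mul_lt_one_of_nonneg_of_lt_one_left (norm_nonneg _) hu.2 hq.le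

lemma mul_pow_mem_qDomain {q u : ℂ} (hq0 : q ≠ 0) (hq : ‖q‖ < 1) (hu : u ∈ qDomain q) (n : ℕ) :
    u * q ^ n ∈ qDomain q := by
  induction n with
  | zero => simpa using hu
  | succ n ih => rw [pow_succ, ← mul_assoc]; exact mul_mem_qDomain hq0 hq ih

/-- On the punctured disc of radius 1/2 the multiplier `q u (1 - u q)` has norm at most `1 · (1/2) ·
2 = 1`. A bound on one compact fundamental annulus therefore propagates towards the origin. -/
lemma bounded_of_qDifference {q : ℂ} (hq0 : q ≠ 0) (hq : ‖q‖ < 1) {Q : ℂ → ℂ}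
    (hQ : ContinuousOn Q (qDomain q))
    (hfe : ∀ u ∈ qDomain q, Q (u * q) = q * u * (1 - u * q) * Q u) :
    ∃ M, ∀ u, u ≠ 0 → ‖u‖ < 1 / 2 → ‖Q u‖ ≤ M := by
  have hq0' : 0 < ‖q‖ := norm_pos_iff.mpr hq0
  set K : Set ℂ := Metric.closedBall 0 (1 / 2) ∩ {u | ‖q‖ * (1 / 2) ≤ ‖u‖} with hK
  have hKc : IsCompact K := (isCompact_closedBall _ _).inter_right
    (isClosed_le continuous_const continuous_norm)
  have hdom : ∀ u : ℂ, u ≠ 0 → ‖u‖ ≤ 1 / 2 → u ∈ qDomain q := fun u h0 h1 =>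
    ⟨h0, by rw [norm_mul]; nlinarith⟩
  obtain ⟨M, hM⟩ := hKc.exists_bound_of_continuousOn (hQ.mono fun u hu => hdom u (by
    rw [← norm_pos_iff]; exact lt_of_lt_of_le (by positivity) hu.2) (by simpa using hu.1))
  refine ⟨M, fun u h0 hu => ?_⟩
  have hupos : 0 < ‖u‖ := norm_pos_iff.mpr h0
  -- The exponent with `‖q‖ ^ (n + 1) < 2 ‖u‖ ≤ ‖q‖ ^ n`, so that `u / q ^ n` lies in the annulus
  -- `K`.
  obtain ⟨n, hn1, hn2⟩ := exists_nat_pow_near_of_lt_one (x := 2 * ‖u‖) (by positivity) (by linarith)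
    hq0' hq
  have hstep : ∀ v : ℂ, v ∈ K → ∀ k : ℕ, ‖Q (v * q ^ k)‖ ≤ M ∧ ‖v * q ^ k‖ ≤ 1 / 2 ∧ v * q ^ k ≠ 0 := by
    intro v hv k
    induction k with
    | zero =>
      simp only [pow_zero, mul_one]
      refine ⟨hM v hv, by simpa using hv.1, ?_⟩
      rw [← norm_pos_iff]; exact lt_of_lt_of_le (by positivity) hv.2
    | succ k ih =>
      obtain ⟨h1, h2, h3⟩ := ih
      rw [pow_succ, ← mul_assoc]
      refine ⟨?_, ?_, mul_ne_zero h3 hq0⟩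
      · rw [hfe _ (hdom _ h3 h2), norm_mul, norm_mul, norm_mul]
        have h4 : ‖1 - v * q ^ k * q‖ ≤ 2 := by
          refine (norm_sub_le _ _).trans ?_
          rw [norm_one, norm_mul]
          nlinarith
        have h5 : ‖q‖ * ‖v * q ^ k‖ * ‖1 - v * q ^ k * q‖ ≤ 1 := by
          calc ‖q‖ * ‖v * q ^ k‖ * ‖1 - v * q ^ k * q‖ ≤ 1 * (1 / 2) * 2 := by gcongr
            _ = 1 := by norm_num
        exact (mul_le_of_le_one_left (norm_nonneg _) h5).trans h1
      · rw [norm_mul]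
        nlinarith [norm_nonneg (v * q ^ k)]
  have hv : u * (q ^ n)⁻¹ ∈ K := by
    have hqn : 0 < ‖q‖ ^ n := by positivity
    refine ⟨?_, ?_⟩
    · rw [mem_closedBall_zero_iff, norm_mul, norm_inv, norm_pow, ← div_eq_mul_inv, div_le_iff₀ hqn]
      linarith
    · rw [mem_ofPred_eq, norm_mul, norm_inv, norm_pow, ← div_eq_mul_inv, le_div_iff₀ hqn]
      rw [pow_succ] at hn1
      nlinarith
  have := (hstep _ hv n).1
  rwa [inv_mul_cancel_right₀ (pow_ne_zero n hq0)] at this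

/-- Boundedness makes the singularity at 0 removable. The equation would raise the order of
vanishing at 0, because its multiplier vanishes there while `u ↦ u q` preserves orders; so the
function is zero near 0. Since the multiplier has no zero in `qDomain`, this spreads to every point
whose iterates `u q ^ n` tend to 0. -/
lemma eq_zero_of_qDifference {q : ℂ} (hq0 : q ≠ 0) (hq : ‖q‖ < 1) {Q : ℂ → ℂ}
    (hQ : DifferentiableOn ℂ Q (qDomain q))
    (hfe : ∀ u ∈ qDomain q, Q (u * q) = q * u * (1 - u * q) * Q u) {u : ℂ} (hu : u ∈ qDomain q) :
    Q u = 0 := by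
  obtain ⟨M, hM⟩ := bounded_of_qDifference hq0 hq hQ.continuousOn hfe
  have hball : Metric.ball (0 : ℂ) (1 / 2) ∈ 𝓝 (0 : ℂ) := Metric.ball_mem_nhds _ (by norm_num)
  have hsub : Metric.ball (0 : ℂ) (1 / 2) \ {0} ⊆ qDomain q := by
    rintro v ⟨hv, hv0⟩
    refine ⟨hv0, ?_⟩
    rw [mem_ball_zero_iff] at hv
    rw [norm_mul]
    nlinarith [norm_nonneg v]
  have hD := Complex.differentiableOn_update_limUnder_of_bddAbove hball (hQ.mono hsub)
    ⟨M, by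
      rintro _ ⟨v, ⟨hv, hv0⟩, rfl⟩
      exact hM v hv0 (mem_ball_zero_iff.mp hv)⟩
  set F := Function.update Q 0 (limUnder (𝓝[≠] 0) Q) with hF
  have hFQ : ∀ v, v ≠ 0 → F v = Q v := fun v hv => Function.update_of_ne hv _ _
  have han : AnalyticAt ℂ F 0 := hD.analyticAt hball
  have hzero : ∀ᶠ v in 𝓝 (0 : ℂ), F v = 0 := by
    by_contra hne
    obtain ⟨n, g, hg, hg0, hev⟩ := han.exists_eventuallyEq_pow_smul_nonzero_iff.mpr hne
    have hmulq : Tendsto (fun v : ℂ => v * q) (𝓝 0) (𝓝 0) := by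
      have : Continuous fun v : ℂ => v * q := by fun_prop
      simpa using this.tendsto 0
    have hev2 := hmulq.eventually hev
    -- With `F v = v ^ n g v` and `g 0 ≠ 0`, dividing the equation by `v ^ n` and letting `v → 0`
    -- gives `q ^ n g 0 = 0`.
    have heq : ∀ᶠ v in 𝓝[≠] (0 : ℂ), q ^ n * g (v * q) = q * v * (1 - v * q) * g v := by
      filter_upwards [hev.filter_mono nhdsWithin_le_nhds, hev2.filter_mono nhdsWithin_le_nhds,
        self_mem_nhdsWithin, mem_nhdsWithin_of_mem_nhds hball] with v h1 h2 h3 h4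
      have h3' : v ≠ 0 := h3
      rw [hFQ _ h3'] at h1
      rw [hFQ _ (mul_ne_zero h3' hq0), hfe v (hsub ⟨h4, h3⟩), h1] at h2
      simp only [sub_zero, smul_eq_mul, mul_pow] at h2
      have h5 : v ^ n ≠ 0 := pow_ne_zero _ h3'
      apply mul_left_cancel₀ h5
      linear_combination -h2
    have hl : Tendsto (fun v : ℂ => q ^ n * g (v * q)) (𝓝[≠] 0) (𝓝 (q ^ n * g 0)) :=
      ((hg.continuousAt.tendsto.comp hmulq).const_mul _).mono_left nhdsWithin_le_nhds
    have hr : Tendsto (fun v : ℂ => q * v * (1 - v * q) * g v) (𝓝[≠] 0) (𝓝 0) := by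
      have hcont : ContinuousAt (fun v : ℂ => q * v * (1 - v * q) * g v) 0 :=
        ContinuousAt.mul (by fun_prop) hg.continuousAt
      have := hcont.tendsto.mono_left (nhdsWithin_le_nhds (s := {0}ᶜ))
      simpa using this
    have := tendsto_nhds_unique_of_eventuallyEq hl hr heq
    exact mul_ne_zero (pow_ne_zero _ hq0) hg0 this
  have hiter : ∀ n : ℕ, Q (u * q ^ n) = 0 → Q u = 0 := by
    intro n
    induction n with
    | zero => simp
    | succ n ih =>
      intro h
      apply ih
      have hd := mul_pow_mem_qDomain hq0 hq hu n
      rw [pow_succ, ← mul_assoc, hfe _ hd] at h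
      refine (mul_eq_zero.mp h).resolve_left ?_
      exact mul_ne_zero (mul_ne_zero hq0 hd.1) (one_sub_ne_zero_of_norm_lt hd.2)
  have htend : Tendsto (fun n : ℕ => u * q ^ n) atTop (𝓝 0) := by
    simpa using (tendsto_pow_atTop_nhds_zero_of_norm_lt_one hq).const_mul u
  obtain ⟨n, hn⟩ := (htend.eventually hzero).exists
  rw [hFQ _ (mul_pow_mem_qDomain hq0 hq hu n).1] at hn
  exact hiter n hn

end OverpartitionRank

/-! ### The rank generating function as an Appell sum. -/

namespace OverpartitionRank

open Filter Topology Set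

/-! ### The Appell sum -/

lemma summable_pow_natAbs {r : ℝ} (h0 : 0 ≤ r) (hr : r < 1) : Summable fun n : ℤ => r ^ n.natAbs :=
  Summable.of_nat_of_neg (by simpa using summable_geometric_of_lt_one h0 hr)
    (by simpa using summable_geometric_of_lt_one h0 hr)

lemma summable_zpow_quadratic {r : ℝ} (h0 : 0 < r) (hr : r < 1) (b : ℤ) :
    Summable fun n : ℤ => r ^ (n ^ 2 + b * n) := by
  refine Summable.of_nonneg_of_le (fun n => by positivity) (fun n => ?_)
    ((summable_pow_natAbs h0.le hr).mul_left (r ^ (-(|b| + 1) ^ 2)))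
  rw [← zpow_natCast, ← zpow_add₀ h0.ne']
  apply zpow_le_zpow_right_of_le_one₀ h0 hr.le
  rw [Int.natCast_natAbs]
  have h1 : b * n ≥ -(|b| * |n|) := by rw [← abs_mul]; exact neg_abs_le _
  have h2 : n ^ 2 = |n| ^ 2 := (sq_abs n).symm
  nlinarith [abs_nonneg n, abs_nonneg b]

lemma norm_neg_one_zpow_mul (n : ℤ) (x : ℂ) : ‖(-1 : ℂ) ^ n * x‖ = ‖x‖ := by
  rw [norm_mul, norm_zpow, norm_neg, norm_one, one_zpow, one_mul]

lemma summable_theta_quadratic {q : ℂ} (hq0 : q ≠ 0) (hq : ‖q‖ < 1) (b : ℤ) :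
    Summable fun n : ℤ => (-1 : ℂ) ^ n * q ^ (n ^ 2 + b * n) := by
  refine Summable.of_norm ?_
  simp only [norm_neg_one_zpow_mul, norm_zpow]
  exact summable_zpow_quadratic (norm_pos_iff.mpr hq0) hq b

/-- `∑ (-1) ^ n q ^ (n ^ 2)`. -/
noncomputable def theta4 (q : ℂ) : ℂ := ∑' n : ℤ, (-1 : ℂ) ^ n * q ^ (n ^ 2)

lemma summable_theta4 {q : ℂ} (hq0 : q ≠ 0) (hq : ‖q‖ < 1) :
    Summable fun n : ℤ => (-1 : ℂ) ^ n * q ^ (n ^ 2) := by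
  simpa using summable_theta_quadratic hq0 hq 0

/-- The square is completed as `(n - 1)² - 1`; the shift by 1 costs a sign. -/
lemma hasSum_theta4_shift {q : ℂ} (hq0 : q ≠ 0) (hq : ‖q‖ < 1) :
    HasSum (fun n : ℤ => (-1 : ℂ) ^ n * q ^ (n ^ 2 - 2 * n)) (-theta4 q / q) := by
  have h := ((summable_theta4 hq0 hq).hasSum.mul_left (-q⁻¹))
  rw [← (Equiv.addRight (1 : ℤ)).hasSum_iff]
  convert! h using 1
  · ext n
    simp only [Function.comp, Equiv.coe_addRight]
    rw [show (n + 1) ^ 2 - 2 * (n + 1) = n ^ 2 - 1 by ring, zpow_add₀ (by norm_num),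
      zpow_sub₀ hq0]
    simp only [zpow_one]
    field_simp
  · rw [theta4]; field_simp

/-- The reflection `n ↦ 1 - n` fixes the exponent and changes the sign. -/
lemma hasSum_theta4_half_shift {q : ℂ} (hq0 : q ≠ 0) (hq : ‖q‖ < 1) :
    HasSum (fun n : ℤ => (-1 : ℂ) ^ n * q ^ (n ^ 2 - n)) 0 := by
  have hS : Summable (fun n : ℤ => (-1 : ℂ) ^ n * q ^ (n ^ 2 - n)) := by
    refine (summable_theta_quadratic hq0 hq (-1)).congr fun n => ?_
    congr 2; ring
  have h := hS.hasSum
  have h2 : HasSum (fun n : ℤ => (-1 : ℂ) ^ n * q ^ (n ^ 2 - n))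
      (-∑' n : ℤ, (-1 : ℂ) ^ n * q ^ (n ^ 2 - n)) := by
    rw [← (Equiv.subLeft (1 : ℤ)).hasSum_iff]
    convert! h.neg using 1
    ext n
    simp only [Function.comp, Equiv.subLeft_apply]
    rw [show (1 - n) ^ 2 - (1 - n) = n ^ 2 - n by ring, zpow_sub₀ (by norm_num), zpow_one,
      neg_div, ← neg_mul, one_div, ← inv_zpow]
    norm_num
  have h3 := h.unique h2
  have h4 : (∑' n : ℤ, (-1 : ℂ) ^ n * q ^ (n ^ 2 - n)) = 0 := by
    linear_combination (1 / 2 : ℂ) * h3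
  rwa [h4] at h

/-- The terms of the basic hypergeometric series, cleared of denominators. -/
noncomputable def hyperTerm (q u : ℂ) (l : ℕ) : ℂ :=
  q ^ l * (∏ j ∈ Finset.range l, (u + q ^ j)) * qProd q (q ^ l / u)

/-- `(1 - u) (q / u; q)_∞`. -/
noncomputable def polarProd (q u : ℂ) : ℂ := (1 - u) * qProd q (1 / u)

/-- `polarProd q u / (1 - u q ^ n)`, extended to the zeros of the denominator. -/
noncomputable def polarQuot (q u : ℂ) : ℤ → ℂ
  | .ofNat 0 => qProd q (1 / u)
  | .ofNat (n + 1) => (1 - u) * qProd q (1 / u) / (1 - u * q ^ (n + 1))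
  | .negSucc j => -(q ^ (j + 1) / u) * (1 - u) * (∏ i ∈ Finset.range j, (1 - q ^ (i + 1) / u)) *
      qProd q (q ^ (j + 1) / u)

/-- The terms of the Appell sum, cleared of denominators. -/
noncomputable def appellTerm (q u : ℂ) (n : ℤ) : ℂ :=
  (-1) ^ n * q ^ (n ^ 2) * (1 + u * q ^ n) * polarQuot q u n

lemma norm_mul_pow_lt_one {q u : ℂ} (hq : ‖q‖ < 1) (hu : ‖u * q‖ < 1) (n : ℕ) :
    ‖u * q ^ (n + 1)‖ < 1 := by
  rw [pow_succ', ← mul_assoc, norm_mul, norm_pow]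
  exact mul_lt_one_of_nonneg_of_lt_one_left (norm_nonneg _) hu (pow_le_one₀ (norm_nonneg _) hq.le)

/-- In `qDomain` the factor `1 - u q ^ n` can vanish only for `n ≤ 0`, at `u = q ^ (-n)`, and
`polarProd` has a zero there. The case distinction in `polarQuot` cancels this zero explicitly, so
the Appell terms are holomorphic on the whole domain. -/
lemma polarQuot_mul {q u : ℂ} (hq0 : q ≠ 0) (hq : ‖q‖ < 1) (hu : u ∈ qDomain q) (n : ℤ) :
    polarQuot q u n * (1 - u * q ^ n) = polarProd q u := by
  have hu0 := hu.1
  rcases n with (_ | n) | j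
  · simp [polarQuot, polarProd, mul_comm]
  · have := one_sub_ne_zero_of_norm_lt (norm_mul_pow_lt_one hq hu.2 n)
    simp only [polarQuot, polarProd, Int.ofNat_eq_natCast]
    rw [zpow_natCast]
    field_simp
  · simp only [polarQuot, polarProd, zpow_negSucc]
    have h := qProd_eq_prod_mul hq (1 / u) (j + 1)
    rw [Finset.prod_range_succ] at h
    simp only [one_div_mul_eq_div] at h
    rw [h]
    have h1 : -(q ^ (j + 1) / u) * (1 - u * (q ^ (j + 1))⁻¹) = 1 - q ^ (j + 1) / u := by
      field_simp
      ring
    rw [← h1]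
    ring

lemma polarQuot_shift {q u : ℂ} (hq0 : q ≠ 0) (hq : ‖q‖ < 1) (hu : u ∈ qDomain q) (n : ℤ) :
    polarQuot q (u * q) n = -((1 - u * q) / u) * polarQuot q u (n + 1) := by
  have hu0 := hu.1
  have hb : qProd q (1 / (u * q)) = (1 - 1 / u) * qProd q (1 / u) := by
    rw [qProd_succ hq]
    congr 2 <;> field_simp
  have h1 : ∀ n : ℕ, 1 - u * q ^ (n + 1) ≠ 0 := fun n =>
    one_sub_ne_zero_of_norm_lt (norm_mul_pow_lt_one hq hu.2 n)
  have h1' : 1 - u * q ≠ 0 := one_sub_ne_zero_of_norm_lt hu.2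
  rcases n with (_ | n) | (_ | j)
  · change qProd q (1 / (u * q)) = _ * ((1 - u) * qProd q (1 / u) / (1 - u * q ^ (0 + 1)))
    rw [hb, zero_add, pow_one]
    field_simp
    ring
  · change (1 - u * q) * qProd q (1 / (u * q)) / (1 - u * q * q ^ (n + 1)) =
      _ * ((1 - u) * qProd q (1 / u) / (1 - u * q ^ (n + 1 + 1)))
    have h2 := h1 (n + 1)
    rw [hb, show u * q * q ^ (n + 1) = u * q ^ (n + 1 + 1) by ring]
    field_simp
    ring
  · change -(q ^ (0 + 1) / (u * q)) * (1 - u * q) *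
      (∏ i ∈ Finset.range 0, (1 - q ^ (i + 1) / (u * q))) * qProd q (q ^ (0 + 1) / (u * q)) =
      _ * qProd q (1 / u)
    simp only [zero_add, pow_one, Finset.prod_range_zero, mul_one]
    rw [show q / (u * q) = 1 / u by field_simp]
    ring
  · change -(q ^ (j + 1 + 1) / (u * q)) * (1 - u * q) *
      (∏ i ∈ Finset.range (j + 1), (1 - q ^ (i + 1) / (u * q))) *
        qProd q (q ^ (j + 1 + 1) / (u * q)) =
      _ * (-(q ^ (j + 1) / u) * (1 - u) * (∏ i ∈ Finset.range j, (1 - q ^ (i + 1) / u)) *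
        qProd q (q ^ (j + 1) / u))
    rw [show q ^ (j + 1 + 1) / (u * q) = q ^ (j + 1) / u by rw [pow_succ q (j + 1)]; field_simp,
      Finset.prod_range_succ']
    have h3 : ∀ i : ℕ, q ^ (i + 1 + 1) / (u * q) = q ^ (i + 1) / u := fun i => by
      rw [pow_succ q (i + 1)]; field_simp
    simp only [h3, zero_add, pow_one]
    rw [show q / (u * q) = 1 / u by field_simp]
    field_simp
    ring

/-- Bounds that are uniform on annuli. -/
lemma exists_bound_terms {q : ℂ} (hq : ‖q‖ < 1) {m ρ : ℝ} (hm : 0 < m)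
    (hρ0 : 0 < ρ) (hρ : ρ < 1) : ∃ C, 0 ≤ C ∧ ∀ u : ℂ, m ≤ ‖u‖ → ‖u * q‖ ≤ ρ → ‖u‖ ≤ m⁻¹ →
      (∀ l, ‖hyperTerm q u l‖ ≤ C * ρ ^ l) ∧ ∀ n, ‖polarQuot q u n‖ ≤ C := by
  set r := ‖q‖ with hr
  have hr0 : 0 ≤ r := norm_nonneg q
  obtain ⟨B, hB⟩ := (isCompact_closedBall (0 : ℂ) m⁻¹).exists_bound_of_continuousOn
    (differentiable_qProd hq).continuous.continuousOn
  have hB0 : 0 ≤ B := (norm_nonneg _).trans (hB 0 (by simp; positivity))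
  have hx : ∀ u : ℂ, m ≤ ‖u‖ → ∀ l : ℕ, ‖qProd q (q ^ l / u)‖ ≤ B := by
    intro u hu l
    apply hB
    rw [mem_closedBall_zero_iff, norm_div, norm_pow, div_eq_mul_inv]
    exact (mul_le_of_le_one_left (by positivity) (pow_le_one₀ hr0 hq.le)).trans (inv_anti₀ hm hu)
  set E1 := Real.exp (r / ρ * (1 - r)⁻¹)
  set E2 := Real.exp (r / m * (1 - r)⁻¹)
  have hE2 : 1 ≤ E2 := Real.one_le_exp (by have : 0 < 1 - r := by linarith
                                           positivity)
  set C2 := m⁻¹ * (1 + m⁻¹) * E2 * B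
  set C3 := (1 + m⁻¹) * B / (1 - ρ)
  have h1ρ : 0 < 1 - ρ := by linarith
  refine ⟨E1 * B + B + C2 + C3, by positivity, fun u hu1 hu2 hu3 => ⟨fun l => ?_, fun n => ?_⟩⟩
  -- A factor `q` and a factor `ρ` are distributed over the product: each `u + q ^ j` becomes `(u q
  -- + q ^ (j + 1)) / ρ`, of norm at most `1 + (r / ρ) r ^ j`. The products stay bounded and `ρ ^ l`
  -- supplies the decay.
  · have h1 : hyperTerm q u l =
        (ρ : ℂ) ^ l * (∏ j ∈ Finset.range l, (1 + ((u * q) / ρ - 1 + q ^ (j + 1) / ρ))) *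
          qProd q (q ^ l / u) := by
      rw [hyperTerm, ← Finset.card_range l, ← Finset.prod_const, ← Finset.prod_const,
        Finset.card_range, ← Finset.prod_mul_distrib, ← Finset.prod_mul_distrib]
      congr 1
      refine Finset.prod_congr rfl fun j _ => ?_
      have : (ρ : ℂ) ≠ 0 := by exact_mod_cast hρ0.ne'
      field_simp
      ring
    have h2 : ‖∏ j ∈ Finset.range l, (1 + ((u * q) / ρ - 1 + q ^ (j + 1) / ρ))‖ ≤ E1 := by
      rw [norm_prod]
      have hb : ∀ j : ℕ, ‖1 + ((u * q) / ρ - 1 + q ^ (j + 1) / ρ)‖ ≤ 1 + r / ρ * r ^ j := by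
        intro j
        rw [show 1 + ((u * q) / ρ - 1 + q ^ (j + 1) / ρ) = (u * q) / ρ + q ^ (j + 1) / ρ by ring]
        refine (norm_add_le _ _).trans ?_
        rw [norm_div, norm_div, norm_pow, Complex.norm_real, Real.norm_of_nonneg hρ0.le]
        refine add_le_add ((div_le_one hρ0).mpr hu2) (le_of_eq ?_)
        rw [pow_succ]; ring
      refine (Finset.prod_le_prod (fun _ _ => norm_nonneg _) fun j _ => hb j).trans ?_
      have := norm_prod_one_add_le (a := fun j => ((r / ρ * r ^ j : ℝ) : ℂ)) (c := r / ρ) (r := r)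
        (by positivity) hr0 hq (fun i => by
          rw [Complex.norm_real, Real.norm_of_nonneg (by positivity)]) l
      refine le_trans (le_of_eq ?_) this
      have h3 : ∏ i ∈ Finset.range l, (1 + ((r / ρ * r ^ i : ℝ) : ℂ)) =
          ((∏ i ∈ Finset.range l, (1 + r / ρ * r ^ i) : ℝ) : ℂ) := by push_cast; rfl
      rw [h3, Complex.norm_real, Real.norm_of_nonneg (Finset.prod_nonneg fun _ _ => by positivity)]
    rw [h1, norm_mul, norm_mul, norm_pow, Complex.norm_real, Real.norm_of_nonneg hρ0.le]
    calc _ ≤ ρ ^ l * E1 * B := by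
          gcongr
          exact hx u hu1 l
      _ = E1 * B * ρ ^ l := by ring
      _ ≤ _ := by
        gcongr
        have : 0 ≤ B + C2 + C3 := by positivity
        linarith
  · have hx0 := hx u hu1 0
    rw [pow_zero] at hx0
    have h1u : ‖1 - u‖ ≤ 1 + m⁻¹ := by
      refine (norm_sub_le _ _).trans ?_
      rw [norm_one]; linarith
    have hp1 : 0 ≤ E1 * B := by positivity
    have hp2 : 0 ≤ C2 := by positivity
    have hp3 : 0 ≤ C3 := by positivity
    rcases n with (_ | n) | j
    · change ‖qProd q (1 / u)‖ ≤ _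
      linarith
    · change ‖(1 - u) * qProd q (1 / u) / (1 - u * q ^ (n + 1))‖ ≤ _
      have hd : 1 - ρ ≤ ‖1 - u * q ^ (n + 1)‖ := by
        have h3 := norm_sub_norm_le (1 : ℂ) (u * q ^ (n + 1))
        have h4 : ‖u * q ^ (n + 1)‖ ≤ ρ := by
          rw [pow_succ', ← mul_assoc, norm_mul, norm_pow]
          exact (mul_le_of_le_one_right (norm_nonneg _) (pow_le_one₀ hr0 hq.le)).trans hu2
        rw [norm_one] at h3
        linarith
      rw [norm_div, norm_mul]
      have : ‖1 - u‖ * ‖qProd q (1 / u)‖ / ‖1 - u * q ^ (n + 1)‖ ≤ C3 := by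
        simp only [C3]; gcongr
      linarith
    · change ‖-(q ^ (j + 1) / u) * (1 - u) * (∏ i ∈ Finset.range j, (1 - q ^ (i + 1) / u)) *
        qProd q (q ^ (j + 1) / u)‖ ≤ _
      have h3 : ‖∏ i ∈ Finset.range j, (1 - q ^ (i + 1) / u)‖ ≤ E2 := by
        simp only [sub_eq_add_neg]
        refine norm_prod_one_add_le (by positivity) hr0 hq (fun i => ?_) j
        rw [norm_neg, norm_div, norm_pow, pow_succ]
        calc r ^ i * r / ‖u‖ ≤ r ^ i * r / m := by gcongr
          _ = _ := by ring
      have h4 : ‖-(q ^ (j + 1) / u)‖ ≤ m⁻¹ := by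
        rw [norm_neg, norm_div, norm_pow, div_eq_mul_inv]
        exact (mul_le_of_le_one_left (by positivity) (pow_le_one₀ hr0 hq.le)).trans (inv_anti₀ hm hu1)
      rw [norm_mul, norm_mul, norm_mul]
      have : ‖-(q ^ (j + 1) / u)‖ * ‖1 - u‖ * ‖∏ i ∈ Finset.range j, (1 - q ^ (i + 1) / u)‖ *
          ‖qProd q (q ^ (j + 1) / u)‖ ≤ C2 := by
        simp only [C2]
        gcongr
        exact hx u hu1 (j + 1)
      linarith

/-- An annulus around a point of the domain on which the bounds hold. -/
lemma exists_annulus {q u₀ : ℂ} (hu₀ : u₀ ∈ qDomain q) : ∃ m ρ : ℝ, 0 < m ∧ 0 < ρ ∧ ρ < 1 ∧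
    ∃ U : Set ℂ, IsOpen U ∧ u₀ ∈ U ∧ U ⊆ qDomain q ∧
      ∀ u ∈ U, m ≤ ‖u‖ ∧ ‖u * q‖ ≤ ρ ∧ ‖u‖ ≤ m⁻¹ := by
  obtain ⟨ρ, hρ1, hρ2⟩ := exists_between hu₀.2
  have h0 : 0 < ‖u₀‖ := norm_pos_iff.mpr hu₀.1
  obtain ⟨m, hm0, hm1⟩ := exists_between (lt_min h0 (inv_pos.mpr h0))
  have hm1' := lt_min_iff.mp hm1
  refine ⟨m, ρ, hm0, (norm_nonneg _).trans_lt hρ1, hρ2, {u | m < ‖u‖} ∩ {u | ‖u * q‖ < ρ} ∩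
    {u | ‖u‖ < m⁻¹}, ((isOpen_lt continuous_const continuous_norm).inter
      (isOpen_lt (f := fun u : ℂ => ‖u * q‖) (by fun_prop) continuous_const)).inter
      (isOpen_lt continuous_norm continuous_const), ⟨⟨hm1'.1, hρ1⟩, ?_⟩, ?_, ?_⟩
  · exact (lt_inv_comm₀ hm0 h0).mp hm1'.2
  · rintro u ⟨⟨h1, h2⟩, -⟩
    exact ⟨norm_pos_iff.mp (hm0.trans h1), lt_trans h2 hρ2⟩
  · rintro u ⟨⟨h1, h2⟩, h3⟩
    exact ⟨le_of_lt h1, le_of_lt h2, le_of_lt h3⟩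

lemma norm_appellTerm_le {q u : ℂ} (hq0 : q ≠ 0) {C m : ℝ} (hC : ‖u‖ ≤ m⁻¹) {n : ℤ}
    (hn : ‖polarQuot q u n‖ ≤ C) : ‖appellTerm q u n‖ ≤
      (‖q‖ ^ (n ^ 2 + 0 * n) + m⁻¹ * ‖q‖ ^ (n ^ 2 + 1 * n)) * C := by
  have hq0' : ‖q‖ ≠ 0 := norm_ne_zero_iff.mpr hq0
  rw [appellTerm, mul_assoc, mul_assoc, norm_neg_one_zpow_mul, ← mul_assoc, norm_mul, norm_mul,
    norm_zpow]
  have h1 : ‖1 + u * q ^ n‖ ≤ 1 + m⁻¹ * ‖q‖ ^ n := by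
    refine (norm_add_le _ _).trans ?_
    rw [norm_one, norm_mul, norm_zpow]
    gcongr
  calc _ ≤ ‖q‖ ^ (n ^ 2) * (1 + m⁻¹ * ‖q‖ ^ n) * C :=
        mul_le_mul (mul_le_mul_of_nonneg_left h1 (by positivity)) hn (norm_nonneg _)
          (mul_nonneg (by positivity) ((norm_nonneg _).trans h1))
    _ = _ := by rw [zpow_add₀ hq0', zpow_add₀ hq0', zero_mul, zpow_zero, one_mul]; ring

lemma summable_appellBound {q : ℂ} (hq0 : q ≠ 0) (hq : ‖q‖ < 1) (C m : ℝ) : Summable fun n : ℤ =>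
    (‖q‖ ^ (n ^ 2 + 0 * n) + m⁻¹ * ‖q‖ ^ (n ^ 2 + 1 * n)) * C :=
  ((summable_zpow_quadratic (norm_pos_iff.mpr hq0) hq 0).add
    ((summable_zpow_quadratic (norm_pos_iff.mpr hq0) hq 1).mul_left _)).mul_right _

lemma summable_hyperTerm {q u : ℂ} (hq : ‖q‖ < 1) (hu : u ∈ qDomain q) :
    Summable (hyperTerm q u) := by
  obtain ⟨m, ρ, hm, hρ0, hρ, U, -, hU, -, hb⟩ := exists_annulus hu
  obtain ⟨C, hC, h⟩ := exists_bound_terms hq hm hρ0 hρ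
  obtain ⟨h1, h2, h3⟩ := hb u hU
  exact Summable.of_norm_bounded ((summable_geometric_of_lt_one hρ0.le hρ).mul_left C) (h u h1 h2 h3).1

lemma summable_appellTerm {q u : ℂ} (hq0 : q ≠ 0) (hq : ‖q‖ < 1) (hu : u ∈ qDomain q) :
    Summable (appellTerm q u) := by
  obtain ⟨m, ρ, hm, hρ0, hρ, U, -, hU, -, hb⟩ := exists_annulus hu
  obtain ⟨C, hC, h⟩ := exists_bound_terms hq hm hρ0 hρ
  obtain ⟨h1, h2, h3⟩ := hb u hU
  exact Summable.of_norm_bounded (summable_appellBound hq0 hq C m) fun n =>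
    norm_appellTerm_le hq0 h3 ((h u h1 h2 h3).2 n)

lemma differentiableOn_qProd_div {q : ℂ} (hq : ‖q‖ < 1) (x : ℂ) :
    DifferentiableOn ℂ (fun u => qProd q (x / u)) (qDomain q) :=
  (differentiable_qProd hq).comp_differentiableOn
    ((differentiableOn_const x).div differentiableOn_id fun _ hu => hu.1)

lemma differentiableOn_polarQuot {q : ℂ} (hq : ‖q‖ < 1) (n : ℤ) :
    DifferentiableOn ℂ (fun u => polarQuot q u n) (qDomain q) := by
  have hinv : DifferentiableOn ℂ (fun u : ℂ => u⁻¹) (qDomain q) :=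
    differentiableOn_id.inv fun _ hu => hu.1
  rcases n with (_ | n) | j
  · exact differentiableOn_qProd_div hq 1
  · refine DifferentiableOn.div (DifferentiableOn.mul (by fun_prop) (differentiableOn_qProd_div hq 1))
      (by fun_prop) fun u hu => one_sub_ne_zero_of_norm_lt (norm_mul_pow_lt_one hq hu.2 n)
  · refine DifferentiableOn.mul (DifferentiableOn.mul (DifferentiableOn.mul ?_ (by fun_prop)) ?_)
      (differentiableOn_qProd_div hq _)
    · simp only [div_eq_mul_inv]
      exact (hinv.const_mul _).fun_neg
    · refine DifferentiableOn.fun_finsetProd fun i _ => ?_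
      simp only [div_eq_mul_inv]
      exact (hinv.const_mul _).const_sub _

lemma differentiableOn_tsum_hyperTerm {q : ℂ} (hq : ‖q‖ < 1) :
    DifferentiableOn ℂ (fun u => ∑' l, hyperTerm q u l) (qDomain q) := by
  intro u₀ hu₀
  obtain ⟨m, ρ, hm, hρ0, hρ, U, hUo, hU, hUs, hb⟩ := exists_annulus hu₀
  obtain ⟨C, hC, h⟩ := exists_bound_terms hq hm hρ0 hρ
  have := Complex.differentiableOn_tsum_of_summable_norm (F := fun l u => hyperTerm q u l)
    ((summable_geometric_of_lt_one hρ0.le hρ).mul_left C)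
    (fun l => DifferentiableOn.mul (by fun_prop) ((differentiableOn_qProd_div hq _).mono hUs)) hUo
    (fun l u hu => by
      obtain ⟨h1, h2, h3⟩ := hb u hu
      exact (h u h1 h2 h3).1 l)
  exact (this.differentiableAt (hUo.mem_nhds hU)).differentiableWithinAt

lemma differentiableOn_tsum_appellTerm {q : ℂ} (hq0 : q ≠ 0) (hq : ‖q‖ < 1) :
    DifferentiableOn ℂ (fun u => ∑' n, appellTerm q u n) (qDomain q) := by
  intro u₀ hu₀
  obtain ⟨m, ρ, hm, hρ0, hρ, U, hUo, hU, hUs, hb⟩ := exists_annulus hu₀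
  obtain ⟨C, hC, h⟩ := exists_bound_terms hq hm hρ0 hρ
  have := Complex.differentiableOn_tsum_of_summable_norm (F := fun n u => appellTerm q u n)
    (summable_appellBound hq0 hq C m)
    (fun n => DifferentiableOn.mul (by fun_prop) ((differentiableOn_polarQuot hq n).mono hUs)) hUo
    (fun n u hu => by
      obtain ⟨h1, h2, h3⟩ := hb u hu
      exact norm_appellTerm_le hq0 h3 ((h u h1 h2 h3).2 n))
  exact (this.differentiableAt (hUo.mem_nhds hU)).differentiableWithinAt

/-- Let `X` be the sum of the terms and `Y` the same sum weighted by `q ^ l`. The ratio of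
consecutive terms gives one linear relation between `X` and `Y`, and re-indexing expresses the value
at `u q` through `Y`. Eliminating `Y` gives the equation. -/
lemma tsum_hyperTerm_shift {q u : ℂ} (hq0 : q ≠ 0) (hq : ‖q‖ < 1) (hu : u ∈ qDomain q) :
    ∑' l, hyperTerm q (u * q) l =
      q * u * (1 - u * q) * ∑' l, hyperTerm q u l + (1 - u * q) * (1 - 1 / u) * qProd q (1 / u) := by
  have hu0 := hu.1
  set b := qProd q (1 / u) with hb
  have hS := summable_hyperTerm hq hu
  have hSq := summable_hyperTerm hq (mul_mem_qDomain hq0 hq hu)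
  have hY : Summable fun l => hyperTerm q u l * q ^ l := by
    refine Summable.of_norm_bounded hS.norm fun l => ?_
    rw [norm_mul, norm_pow]
    exact mul_le_of_le_one_right (norm_nonneg _) (pow_le_one₀ (norm_nonneg _) hq.le)
  have hrec : ∀ l, hyperTerm q u (l + 1) - 1 / u * (hyperTerm q u (l + 1) * q ^ (l + 1)) =
      q * u * hyperTerm q u l + q * (hyperTerm q u l * q ^ l) := by
    intro l
    have h1 : qProd q (q ^ l / u) = (1 - q ^ (l + 1) / u) * qProd q (q ^ (l + 1) / u) := by
      rw [qProd_succ hq, div_mul_eq_mul_div, ← pow_succ]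
    simp only [hyperTerm]
    rw [h1, Finset.prod_range_succ]
    field_simp
    ring
  have h0 : hyperTerm q u 0 = b := by simp [hyperTerm, hb]
  have hX := hS.tsum_eq_zero_add
  have hY1 := hY.tsum_eq_zero_add
  have hsum : (∑' l, hyperTerm q u (l + 1)) - 1 / u * ∑' l, hyperTerm q u (l + 1) * q ^ (l + 1) =
      q * u * ∑' l, hyperTerm q u l + q * ∑' l, hyperTerm q u l * q ^ l := by
    rw [← tsum_mul_left, ← tsum_mul_left, ← tsum_mul_left,
      ← ((summable_nat_add_iff 1).mpr hS).tsum_sub (((summable_nat_add_iff 1).mpr hY).mul_left _),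
      ← (hS.mul_left _).tsum_add (hY.mul_left _)]
    exact tsum_congr hrec
  have hq' : ∑' l, hyperTerm q (u * q) l =
      (1 - 1 / u) * b + q * (u * q + 1) * ∑' l, hyperTerm q u l * q ^ l := by
    rw [hSq.tsum_eq_zero_add, ← tsum_mul_left]
    congr 1
    · simp only [hyperTerm, pow_zero, Finset.prod_range_zero, one_mul]
      rw [qProd_succ hq, hb]
      congr 2 <;> field_simp
    · refine tsum_congr fun l => ?_
      simp only [hyperTerm]
      rw [Finset.prod_range_succ', pow_zero, show q ^ (l + 1) / (u * q) = q ^ l / u by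
        rw [pow_succ]; field_simp]
      have : ∏ j ∈ Finset.range l, (u * q + q ^ (j + 1)) =
          q ^ l * ∏ j ∈ Finset.range l, (u + q ^ j) := by
        conv_rhs => rw [← Finset.card_range l, ← Finset.prod_const, Finset.card_range,
          ← Finset.prod_mul_distrib]
        exact Finset.prod_congr rfl fun j _ => by ring
      rw [this]; ring
  rw [h0] at hX hY1
  simp only [pow_zero, mul_one] at hY1
  rw [hq']
  set X := ∑' l, hyperTerm q u l
  set Y := ∑' l, hyperTerm q u l * q ^ l
  rw [eq_sub_of_add_eq' hX.symm, eq_sub_of_add_eq' hY1.symm] at hsum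
  field_simp at hsum ⊢
  linear_combination (-q * u) * hsum

/-- The substitution `u ↦ u q` shifts the summation index by 1, which changes `q ^ (n²)` to `q ^ ((n
- 1)²)`. The discrepancy is divisible by `1 - u q ^ n`, so it loses its denominator and becomes a
combination of theta series. -/
lemma tsum_appellTerm_shift {q u : ℂ} (hq0 : q ≠ 0) (hq : ‖q‖ < 1) (hu : u ∈ qDomain q) :
    ∑' n, appellTerm q (u * q) n = q * u * (1 - u * q) * ∑' n, appellTerm q u n +
      (1 - u * q) / u * polarProd q u * theta4 q * (q * u ^ 2 - 1) := by
  have hu0 := hu.1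
  have hS := summable_appellTerm hq0 hq hu
  have hth : HasSum (fun n : ℤ => (-1 : ℂ) ^ n * q ^ (n ^ 2 - 2 * n) * (1 + u * q ^ n) ^ 2)
      (-theta4 q / q + 2 * u * 0 + u ^ 2 * theta4 q) := by
    have h := ((hasSum_theta4_shift hq0 hq).add ((hasSum_theta4_half_shift hq0 hq).mul_left (2 * u))).add
      ((summable_theta4 hq0 hq).hasSum.mul_left (u ^ 2))
    convert! h using 2 with n
    rw [show n ^ 2 - n = (n ^ 2 - 2 * n) + n by ring, zpow_add₀ hq0,
      show q ^ (n ^ 2) = q ^ (n ^ 2 - 2 * n) * q ^ n * q ^ n by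
        rw [← zpow_add₀ hq0, ← zpow_add₀ hq0]; congr 1; ring]
    ring
  set g : ℤ → ℂ := fun n => (-1) ^ n * q ^ ((n - 1) ^ 2) * (1 + u * q ^ n) * polarQuot q u n with hg
  have h1 : ∀ n, appellTerm q (u * q) n = (1 - u * q) / u * g (n + 1) := by
    intro n
    rw [appellTerm, polarQuot_shift hq0 hq hu]
    simp only [hg]
    rw [zpow_add₀ (by norm_num : (-1 : ℂ) ≠ 0), zpow_one, add_sub_cancel_right, zpow_add₀ hq0, zpow_one]
    ring
  -- Split `1 = u² q ^ (2 n) + (1 - u q ^ n) (1 + u q ^ n)`: the first summand restores `q ^ (n²)`,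
  -- and in the second `1 - u q ^ n` cancels against `polarQuot`.
  have h2 : ∀ n, g n = q * u ^ 2 * appellTerm q u n + q * polarProd q u *
      ((-1 : ℂ) ^ n * q ^ (n ^ 2 - 2 * n) * (1 + u * q ^ n) ^ 2) := by
    intro n
    simp only [hg, appellTerm]
    rw [← polarQuot_mul hq0 hq hu n, show (n - 1) ^ 2 = (n ^ 2 - 2 * n) + 1 by ring, zpow_add₀ hq0,
      zpow_one, show q ^ (n ^ 2) = q ^ (n ^ 2 - 2 * n) * q ^ n * q ^ n by
        rw [← zpow_add₀ hq0, ← zpow_add₀ hq0]; congr 1; ring]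
    ring
  have h3 : ∑' n, g n = q * u ^ 2 * ∑' n, appellTerm q u n + q * polarProd q u *
      (-theta4 q / q + 2 * u * 0 + u ^ 2 * theta4 q) := by
    simp only [h2]
    exact ((hS.hasSum.mul_left _).add (hth.mul_left _)).tsum_eq
  simp only [h1]
  rw [tsum_mul_left]
  have h4 : ∑' n : ℤ, g (n + 1) = ∑' n, g n := (Equiv.addRight (1 : ℤ)).tsum_eq g
  rw [h4, h3]
  field_simp
  ring

/-- The basic hypergeometric series is an Appell sum. -/
lemma theta4_mul_hyper_eq_appell {q u : ℂ} (hq0 : q ≠ 0) (hq : ‖q‖ < 1) (hu : u ∈ qDomain q) :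
    theta4 q * (2 * ∑' l, hyperTerm q u l - polarProd q u) = ∑' n, appellTerm q u n := by
  rw [← sub_eq_zero]
  -- The inhomogeneous terms of the two shift equations agree once `polarProd` is subtracted, so the
  -- difference of the two sides solves the homogeneous equation.
  refine eq_zero_of_qDifference (Q := fun u => theta4 q * (2 * ∑' l, hyperTerm q u l -
    polarProd q u) - ∑' n, appellTerm q u n) hq0 hq ?_ (fun v hv => ?_) hu
  · refine DifferentiableOn.sub (DifferentiableOn.const_mul (DifferentiableOn.sub
      ((differentiableOn_tsum_hyperTerm hq).const_mul _) ?_) _) (differentiableOn_tsum_appellTerm hq0 hq)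
    exact DifferentiableOn.mul (by fun_prop) (differentiableOn_qProd_div hq 1)
  · have hv0 := hv.1
    have hp : polarProd q (v * q) = (1 - v * q) * ((1 - 1 / v) * qProd q (1 / v)) := by
      rw [polarProd, qProd_succ hq (1 / (v * q))]
      congr 3 <;> field_simp
    rw [tsum_hyperTerm_shift hq0 hq hv, tsum_appellTerm_shift hq0 hq hv, hp]
    simp only [polarProd]
    field_simp
    ring

/-- At `u = 1` the series telescopes: the partial sums are finite products times a tail `qProd q (q
^ N)` that tends to 1. -/
lemma tsum_hyperTerm_one {q : ℂ} (hq : ‖q‖ < 1) :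
    ∑' l, hyperTerm q 1 l = qProd q (-1) := by
  have hpart : ∀ N : ℕ, ∑ l ∈ Finset.range (N + 1), hyperTerm q 1 l =
      (∏ i ∈ Finset.range N, (1 - (-1) * q ^ (i + 1))) * qProd q (q ^ N) := by
    intro N
    induction N with
    | zero => simp [hyperTerm]
    | succ N ih =>
      rw [Finset.sum_range_succ, ih, hyperTerm, Finset.prod_range_succ', Finset.prod_range_succ,
        qProd_succ hq (q ^ N)]
      simp only [pow_zero, div_one, sub_neg_eq_add, one_mul, neg_mul]
      rw [← pow_succ]
      ring
  have hmem : (1 : ℂ) ∈ qDomain q := ⟨one_ne_zero, by simpa using hq⟩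
  have h1 := ((summable_hyperTerm hq hmem).hasSum.tendsto_sum_nat).comp (tendsto_add_atTop_nat 1)
  have h2 : Tendsto (fun N : ℕ => (∏ i ∈ Finset.range N, (1 - (-1) * q ^ (i + 1))) *
      qProd q (q ^ N)) atTop (𝓝 (qProd q (-1) * qProd q 0)) := by
    refine (multipliable_qProd hq (-1)).hasProd.tendsto_prod_nat.mul ?_
    exact ((differentiable_qProd hq).continuous.tendsto 0).comp
      (tendsto_pow_atTop_nhds_zero_of_norm_lt_one hq)
  have h3 : qProd q 0 = 1 := by simp [qProd]
  rw [h3, mul_one] at h2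
  exact tendsto_nhds_unique h1 (h2.congr fun N => (hpart N).symm)

/-- Gauss's product for `∑ (-1) ^ n q ^ (n ^ 2)`. -/
lemma theta4_mul_qProd {q : ℂ} (hq0 : q ≠ 0) (hq : ‖q‖ < 1) :
    theta4 q * qProd q (-1) = qProd q 1 := by
  have hmem : (1 : ℂ) ∈ qDomain q := ⟨one_ne_zero, by simpa using hq⟩
  -- At `u = 1` the factor `1 - u` removes `polarProd` and every Appell term except `n = 0`, so the
  -- identity degenerates to a product formula.
  have h := theta4_mul_hyper_eq_appell hq0 hq hmem
  rw [tsum_hyperTerm_one hq, tsum_eq_single 0] at h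
  · have h2 : appellTerm q 1 0 = 2 * qProd q 1 := by
      change (-1) ^ (0 : ℤ) * q ^ ((0 : ℤ) ^ 2) * (1 + 1 * q ^ (0 : ℤ)) * qProd q (1 / 1) = _
      norm_num
    rw [h2] at h
    simp only [polarProd, sub_self, zero_mul, sub_zero] at h
    linear_combination (1 / 2 : ℂ) * h
  · rintro ((_ | n) | j) hn
    · exact absurd rfl hn
    · simp [appellTerm, polarQuot]
    · simp [appellTerm, polarQuot]

lemma theta4_ne_zero {q : ℂ} (hq0 : q ≠ 0) (hq : ‖q‖ < 1) : theta4 q ≠ 0 := by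
  intro h
  have h1 := theta4_mul_qProd hq0 hq
  rw [h, zero_mul] at h1
  refine qProd_ne_zero hq (fun i => ?_) h1.symm
  rw [one_mul]
  exact one_sub_ne_zero_of_norm_lt (by simpa using norm_mul_pow_lt_one hq (u := 1) (by simpa using hq) i)

/-- The rank generating function as an Appell sum. -/
lemma theta4_mul_rankGen {u q : ℂ} (hu : ‖u‖ = 1) (hu1 : u ≠ 1) (hq0 : q ≠ 0) (hq : ‖q‖ < 1) :
    theta4 q * (1 + u) * rankGen u q =
      (1 - u) * ∑' n : ℤ, (-1) ^ n * q ^ (n ^ 2) * ((1 + u * q ^ n) / (1 - u * q ^ n)) := by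
  have hu0 : u ≠ 0 := by rintro rfl; simp at hu
  have hmem : u ∈ qDomain q := ⟨hu0, by rw [norm_mul, hu, one_mul]; exact hq⟩
  have hui : ‖u⁻¹‖ = 1 := by rw [norm_inv, hu, inv_one]
  have hfac : ∀ i : ℕ, 1 - u⁻¹ * q ^ (i + 1) ≠ 0 := fun i =>
    one_sub_ne_zero_of_norm_lt (norm_mul_pow_lt_one hq (by rw [norm_mul, hui, one_mul]; exact hq) i)
  have hb : qProd q (1 / u) ≠ 0 := by
    rw [one_div]; exact qProd_ne_zero hq hfac
  have hP : polarProd q u ≠ 0 := mul_ne_zero (sub_ne_zero.mpr hu1.symm) hb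
  -- Clearing denominators turns the summand with largest part `l + 1` into twice `hyperTerm q u (l
  -- + 1)`. The constant term 1 contributes `(1 + u) b = 2 b - (1 - u) b` with `b = qProd q (1 /
  -- u)`, which accounts for `polarProd`.
  have hR : (1 + u) * qProd q (1 / u) * rankGen u q =
      2 * ∑' l, hyperTerm q u l - polarProd q u := by
    rw [rankGen_eq_tsum hu hq, (summable_hyperTerm hq hmem).tsum_eq_zero_add, mul_add, ← tsum_mul_left,
      mul_add, ← tsum_mul_left]
    have h0 : hyperTerm q u 0 = qProd q (1 / u) := by simp [hyperTerm]
    have ht : ∀ l : ℕ, (1 + u) * qProd q (1 / u) * (u ^ (l + 1) * (2 * u⁻¹ * q ^ (l + 1) *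
        boundedVal u⁻¹ q l * (1 - u⁻¹ * q ^ (l + 1))⁻¹)) = 2 * hyperTerm q u (l + 1) := by
      intro l
      rw [qProd_eq_prod_mul hq (1 / u) (l + 1), boundedVal, Finset.prod_mul_distrib, hyperTerm,
        Finset.prod_range_succ, Finset.prod_range_succ', Finset.prod_inv_distrib]
      have h1 : ∏ i ∈ Finset.range l, (1 - u⁻¹ * q ^ (i + 1)) ≠ 0 :=
        Finset.prod_ne_zero_iff.mpr fun i _ => hfac i
      have h2 : ∏ j ∈ Finset.range l, (u + q ^ (j + 1)) =
          u ^ l * ∏ j ∈ Finset.range l, (1 + u⁻¹ * q ^ (j + 1)) := by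
        conv_rhs => rw [← Finset.card_range l, ← Finset.prod_const, Finset.card_range,
          ← Finset.prod_mul_distrib]
        exact Finset.prod_congr rfl fun j _ => by field_simp
      rw [h2, one_div, div_eq_inv_mul]
      have h3 := hfac l
      set p := ∏ i ∈ Finset.range l, (1 - u⁻¹ * q ^ (i + 1))
      set d := 1 - u⁻¹ * q ^ (l + 1)
      set B := qProd q (u⁻¹ * q ^ (l + 1))
      set N := ∏ j ∈ Finset.range l, (1 + u⁻¹ * q ^ (j + 1))
      calc _ = 2 * (u ^ l * (u * u⁻¹)) * (1 + u) * q ^ (l + 1) * N * B * (p * p⁻¹) * (d * d⁻¹) := by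
            rw [pow_succ u l]; ring
        _ = _ := by
            rw [mul_inv_cancel₀ hu0, mul_inv_cancel₀ h1, mul_inv_cancel₀ h3]
            ring
    simp only [ht]
    rw [h0, polarProd]
    ring
  have hT : ∑' n, appellTerm q u n = polarProd q u *
      ∑' n : ℤ, (-1) ^ n * q ^ (n ^ 2) * ((1 + u * q ^ n) / (1 - u * q ^ n)) := by
    rw [← tsum_mul_left]
    refine tsum_congr fun n => ?_
    have h := polarQuot_mul hq0 hq hmem n
    have hne : 1 - u * q ^ n ≠ 0 := fun h0 => hP (by rw [← h, h0, mul_zero])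
    rw [appellTerm, ← h]
    field_simp
  have h := theta4_mul_hyper_eq_appell hq0 hq hmem
  rw [hT, ← hR] at h
  apply mul_left_cancel₀ hb
  rw [polarProd] at h
  linear_combination h

end OverpartitionRank

/-! ### Dedekind sums and the multiplier of the eta function. -/

namespace OverpartitionRank

/-! ### Dedekind sums -/

/-- The Dedekind sum `s(h, k)`. -/
noncomputable def dedekindSum (h k : ℤ) : ℝ :=
  ∑ μ ∈ Finset.Ico 0 k, saw ((μ : ℝ) / k) * saw ((h : ℝ) * μ / k)

lemma saw_add_int (x : ℝ) (n : ℤ) : saw (x + n) = saw x := by simp [saw]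

lemma saw_neg (x : ℝ) : saw (-x) = -saw x := by
  unfold saw
  by_cases h : Int.fract x = 0
  · have h' : Int.fract (-x) = 0 := Int.fract_neg_eq_zero.mpr h
    simp [h, h']
  · have h' : Int.fract (-x) ≠ 0 := fun h0 => h (Int.fract_neg_eq_zero.mp h0)
    rw [if_neg h, if_neg h', Int.fract_neg h]
    ring

lemma dedekindSum_add_mul (h k n : ℤ) (hk : 0 < k) :
    dedekindSum (h + n * k) k = dedekindSum h k := by
  refine Finset.sum_congr rfl fun μ _ => ?_
  congr 1
  have hk' : (k : ℝ) ≠ 0 := by exact_mod_cast hk.ne'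
  rw [← saw_add_int ((h : ℝ) * μ / k) (n * μ)]
  congr 1
  push_cast
  field_simp

lemma dedekindSum_neg (h k : ℤ) : dedekindSum (-h) k = -dedekindSum h k := by
  rw [dedekindSum, dedekindSum, ← Finset.sum_neg_distrib]
  refine Finset.sum_congr rfl fun μ _ => ?_
  rw [← mul_neg, ← saw_neg]
  congr 2
  push_cast
  ring

lemma saw_natCast_div (n : ℕ) {k : ℕ} (hk : 0 < k) (h : n % k ≠ 0) :
    saw ((n : ℝ) / k) = ((n % k : ℕ) : ℝ) / k - 1 / 2 := by
  have hf : Int.fract ((n : ℝ) / k) = ((n % k : ℕ) : ℝ) / k := by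
    have := Int.fract_div_natCast_eq_div_natCast_mod (k := ℝ) (m := n) (n := k)
    exact this
  rw [saw, hf, if_neg]
  have : (k : ℝ) ≠ 0 := by exact_mod_cast hk.ne'
  exact div_ne_zero (by exact_mod_cast h) this

lemma sum_mul_mod {h k : ℕ} (hk : 0 < k) (hc : Nat.Coprime h k) (φ : ℕ → ℝ) :
    ∑ μ ∈ Finset.range k, φ (h * μ % k) = ∑ μ ∈ Finset.range k, φ μ := by
  have hmaps : Set.MapsTo (fun μ => h * μ % k) (Finset.range k) (Finset.range k) := fun μ _ => by
    simpa using Nat.mod_lt _ hk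
  have hinj : Set.InjOn (fun μ => h * μ % k) (Finset.range k) := by
    intro a ha b hb hab
    have h1 : a ≡ b [MOD k] := Nat.ModEq.cancel_left_of_coprime hc.symm.gcd_eq_one hab
    have ha' := Finset.mem_range.mp ha
    have hb' := Finset.mem_range.mp hb
    rwa [Nat.ModEq, Nat.mod_eq_of_lt ha', Nat.mod_eq_of_lt hb'] at h1
  exact Finset.sum_nbij (fun μ => h * μ % k) hmaps hinj
    (Finset.surjOn_of_injOn_of_card_le _ hmaps hinj le_rfl) fun _ _ => rfl

/-- `∑ μ ⌊h μ / k⌋`. -/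
noncomputable def floorMoment (h k : ℕ) : ℝ := ∑ μ ∈ Finset.range k, (μ : ℝ) * ((h * μ / k : ℕ) : ℝ)

lemma sum_range_cast (k : ℕ) : ∑ μ ∈ Finset.range k, (μ : ℝ) = k * (k - 1) / 2 := by
  induction k with
  | zero => simp
  | succ k ih => rw [Finset.sum_range_succ, ih]; push_cast; ring

lemma sum_range_sq_cast (k : ℕ) :
    ∑ μ ∈ Finset.range k, (μ : ℝ) ^ 2 = k * (k - 1) * (2 * k - 1) / 6 := by
  induction k with
  | zero => simp
  | succ k ih => rw [Finset.sum_range_succ, ih]; push_cast; ring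

lemma cast_mod (h μ k : ℕ) : ((h * μ % k : ℕ) : ℝ) = h * μ - k * ((h * μ / k : ℕ) : ℝ) := by
  have := Nat.mod_add_div (h * μ) k
  have h2 : ((h * μ % k : ℕ) : ℝ) + k * ((h * μ / k : ℕ) : ℝ) = h * μ := by exact_mod_cast this
  linarith

lemma mul_mod_ne_zero {h k μ : ℕ} (hc : Nat.Coprime h k) (h0 : μ ≠ 0) (hμ : μ < k) :
    h * μ % k ≠ 0 := by
  intro h1
  have := hc.symm.dvd_of_dvd_mul_left (Nat.dvd_of_mod_eq_zero h1)
  exact h0 (Nat.eq_zero_of_dvd_of_lt this hμ)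

/-- The sawtooth at `h μ / k` is the residue of `h μ` over `k`, minus 1/2, and residue equals `h μ -
k ⌊h μ / k⌋`. The linear terms are evaluated because `μ ↦ h μ` permutes the residues. Only `μ = 0`,
where the sawtooth is 0 by convention, needs a correction. -/
lemma dedekindSum_eq_floorMoment {h k : ℕ} (hk : 0 < k) (hc : Nat.Coprime h k) :
    (k : ℝ) ^ 2 * dedekindSum h k = h * (k * (k - 1) * (2 * k - 1) / 6) - k * floorMoment h k -
      k ^ 2 * (k - 1) / 4 := by
  have hk' : (k : ℝ) ≠ 0 := by exact_mod_cast hk.ne'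
  have h1 : dedekindSum h k = ∑ μ ∈ Finset.range k, saw ((μ : ℝ) / k) * saw ((h * μ : ℕ) / k) := by
    refine Finset.sum_nbij' Int.toNat (fun n => (n : ℤ)) ?_ ?_ ?_ ?_ ?_
    · intro μ hμ
      have := Finset.mem_Ico.mp hμ
      rw [Finset.mem_range]; omega
    · intro μ hμ
      have := Finset.mem_range.mp hμ
      rw [Finset.mem_Ico]; omega
    · intro μ hμ
      have := Finset.mem_Ico.mp hμ
      omega
    · intro μ _
      simp
    · intro μ hμ
      have h0 : ((μ.toNat : ℕ) : ℝ) = (μ : ℝ) := by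
        exact_mod_cast Int.toNat_of_nonneg (Finset.mem_Ico.mp hμ).1
      push_cast
      rw [h0]
  have h2 : ∀ μ ∈ Finset.range k, (k : ℝ) ^ 2 * (saw ((μ : ℝ) / k) * saw ((h * μ : ℕ) / k)) =
      μ * ((h * μ % k : ℕ) : ℝ) - k / 2 * (μ + ((h * μ % k : ℕ) : ℝ)) +
        (k ^ 2 / 4 - if μ = 0 then (k : ℝ) ^ 2 / 4 else 0) := by
    intro μ hμ
    by_cases h0 : μ = 0
    · subst h0; simp [saw]
    · rw [if_neg h0, saw_natCast_div _ hk (mul_mod_ne_zero hc h0 (Finset.mem_range.mp hμ)),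
        saw_natCast_div μ hk (by rwa [Nat.mod_eq_of_lt (Finset.mem_range.mp hμ)]),
        Nat.mod_eq_of_lt (Finset.mem_range.mp hμ)]
      field_simp
      ring
  have h3 : ∑ μ ∈ Finset.range k, (μ : ℝ) * ((h * μ % k : ℕ) : ℝ) =
      h * (k * (k - 1) * (2 * k - 1) / 6) - k * floorMoment h k := by
    rw [← sum_range_sq_cast, floorMoment, Finset.mul_sum, Finset.mul_sum, ← Finset.sum_sub_distrib]
    refine Finset.sum_congr rfl fun μ _ => ?_
    rw [cast_mod]; ring
  have h4 := sum_mul_mod hk hc (fun n => (n : ℝ))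
  rw [h1, Finset.mul_sum, Finset.sum_congr rfl h2, Finset.sum_add_distrib, Finset.sum_sub_distrib, h3,
    ← Finset.mul_sum, Finset.sum_add_distrib, h4, sum_range_cast, Finset.sum_sub_distrib,
    Finset.sum_ite_eq', if_pos (Finset.mem_range.mpr hk), Finset.sum_const, Finset.card_range,
    nsmul_eq_mul]
  ring

/-- A lattice point count: `f (f + 1)` is twice the sum of the `j ≤ f`, and exchanging the sums over
`μ` and `j` counts the points below the line `k j = h μ` from the other side. Coprimality keeps
nontrivial points off the line. -/
lemma sum_floor_mul_succ {h k : ℕ} (hh : 0 < h) (hk : 0 < k) (hc : Nat.Coprime h k) :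
    ∑ μ ∈ Finset.range k, ((h * μ / k : ℕ) : ℝ) * (((h * μ / k : ℕ) : ℝ) + 1) =
      (k - 1) * (h * (h - 1)) - 2 * floorMoment k h := by
  have h1 : ∀ μ ∈ Finset.range k, ((h * μ / k : ℕ) : ℝ) * (((h * μ / k : ℕ) : ℝ) + 1) =
      2 * ∑ j ∈ Finset.range h, if k * j < h * μ then (j : ℝ) else 0 := by
    intro μ hμ
    have hμ' := Finset.mem_range.mp hμ
    by_cases h0 : μ = 0
    · subst h0; simp
    · have hfil : (Finset.range h).filter (fun j => k * j < h * μ) =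
          Finset.range (h * μ / k + 1) := by
        ext j
        simp only [Finset.mem_filter, Finset.mem_range, Nat.lt_succ_iff, Nat.le_div_iff_mul_le hk]
        constructor
        · rintro ⟨-, h2⟩; rw [mul_comm]; exact h2.le
        · intro h2
          have h3 : k * j ≠ h * μ := fun h4 =>
            mul_mod_ne_zero hc h0 hμ' (by rw [← h4, Nat.mul_mod_right])
          have h4 : k * j < h * μ := lt_of_le_of_ne (by rwa [mul_comm]) h3
          refine ⟨?_, h4⟩
          by_contra hj
          push Not at hj
          nlinarith
      rw [← Finset.sum_filter, hfil, sum_range_cast]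
      push_cast
      ring
  have h2 : ∀ j ∈ Finset.range h, (∑ μ ∈ Finset.range k, if k * j < h * μ then (j : ℝ) else 0) =
      (k - 1) * j - j * ((k * j / h : ℕ) : ℝ) := by
    intro j hj
    have hj' := Finset.mem_range.mp hj
    have hsplit : ∀ μ : ℕ, (if k * j < h * μ then (j : ℝ) else 0) =
        j - if h * μ ≤ k * j then (j : ℝ) else 0 := by
      intro μ
      by_cases h3 : k * j < h * μ
      · rw [if_pos h3, if_neg (by omega), sub_zero]
      · rw [if_neg h3, if_pos (by omega), sub_self]
    have hfil : (Finset.range k).filter (fun μ => h * μ ≤ k * j) =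
        Finset.range (k * j / h + 1) := by
      ext μ
      simp only [Finset.mem_filter, Finset.mem_range, Nat.lt_succ_iff, Nat.le_div_iff_mul_le hh]
      constructor
      · rintro ⟨-, h2⟩; rwa [mul_comm]
      · intro h2
        refine ⟨?_, by rwa [mul_comm]⟩
        by_contra hμ
        push Not at hμ
        nlinarith
    simp only [hsplit]
    rw [Finset.sum_sub_distrib, ← Finset.sum_filter, hfil, Finset.sum_const, Finset.sum_const,
      Finset.card_range, Finset.card_range, nsmul_eq_mul, nsmul_eq_mul]
    push_cast
    ring
  rw [Finset.sum_congr rfl h1, ← Finset.mul_sum, Finset.sum_comm, Finset.sum_congr rfl h2,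
    Finset.sum_sub_distrib, ← Finset.mul_sum, sum_range_cast, floorMoment]
  ring

/-- Permuting residues fixes `∑ r` and `∑ r²`, which gives the first moment of the floors and
relates their second moment to `floorMoment h k`. The lattice point count relates it to `floorMoment
k h`. What remains is linear elimination. -/
lemma dedekindSum_reciprocity_nat {h k : ℕ} (hh : 0 < h) (hk : 0 < k) (hc : Nat.Coprime h k) :
    dedekindSum h k + dedekindSum k h =
      -1 / 4 + ((h : ℝ) / k + (k : ℝ) / h + 1 / ((h : ℝ) * k)) / 12 := by
  have hk' : (k : ℝ) ≠ 0 := by exact_mod_cast hk.ne'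
  have hh' : (h : ℝ) ≠ 0 := by exact_mod_cast hh.ne'
  have e1 := dedekindSum_eq_floorMoment hk hc
  have e2 := dedekindSum_eq_floorMoment hh hc.symm
  have e3 := sum_floor_mul_succ hh hk hc
  have e4 := sum_mul_mod hk hc (fun n => (n : ℝ))
  have e5 := sum_mul_mod hk hc (fun n => (n : ℝ) ^ 2)
  simp only [cast_mod] at e4 e5
  set f : ℕ → ℝ := fun μ => ((h * μ / k : ℕ) : ℝ) with hf
  have e4' : h * (k * (k - 1) / 2 : ℝ) - k * ∑ μ ∈ Finset.range k, f μ = k * (k - 1) / 2 := by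
    rw [← sum_range_cast, Finset.mul_sum, Finset.mul_sum, ← Finset.sum_sub_distrib]
    exact e4
  have e5' : (h : ℝ) ^ 2 * (k * (k - 1) * (2 * k - 1) / 6) - 2 * h * k * floorMoment h k +
      k ^ 2 * ∑ μ ∈ Finset.range k, f μ ^ 2 = k * (k - 1) * (2 * k - 1) / 6 := by
    have e6 : ∑ μ ∈ Finset.range k, ((h : ℝ) * μ - k * ((h * μ / k : ℕ) : ℝ)) ^ 2 =
        (h : ℝ) ^ 2 * ∑ μ ∈ Finset.range k, (μ : ℝ) ^ 2 - 2 * h * k * floorMoment h k +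
          k ^ 2 * ∑ μ ∈ Finset.range k, f μ ^ 2 := by
      rw [floorMoment, Finset.mul_sum, Finset.mul_sum, Finset.mul_sum,
        ← Finset.sum_sub_distrib, ← Finset.sum_add_distrib]
      exact Finset.sum_congr rfl fun μ _ => by simp only [hf]; ring
    rw [e5, sum_range_sq_cast] at e6
    exact e6.symm
  have e3' : (∑ μ ∈ Finset.range k, f μ ^ 2) + ∑ μ ∈ Finset.range k, f μ =
      (k - 1) * (h * (h - 1)) - 2 * floorMoment k h := by
    rw [← e3, ← Finset.sum_add_distrib]
    exact Finset.sum_congr rfl fun μ _ => by simp only [hf]; ring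
  set F := floorMoment h k
  set G := floorMoment k h
  set s1 := ∑ μ ∈ Finset.range k, f μ
  set s2 := ∑ μ ∈ Finset.range k, f μ ^ 2
  have d1 : dedekindSum h k = (h * (k * (k - 1) * (2 * k - 1) / 6) - k * F - k ^ 2 * (k - 1) / 4) /
      k ^ 2 := by rw [← e1]; field_simp
  have d2 : dedekindSum k h = (k * (h * (h - 1) * (2 * h - 1) / 6) - h * G - h ^ 2 * (h - 1) / 4) /
      h ^ 2 := by rw [← e2]; field_simp
  have d3 : s1 = (h - 1) * (k - 1) / 2 := by
    apply mul_left_cancel₀ hk'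
    linear_combination -e4'
  have d4 : G = ((k - 1) * (h * (h - 1)) - s2 - s1) / 2 := by linear_combination (1 / 2) * e3'
  have d5 : F = ((h : ℝ) ^ 2 * (k * (k - 1) * (2 * k - 1) / 6) + k ^ 2 * s2 -
      k * (k - 1) * (2 * k - 1) / 6) / (2 * h * k) := by
    rw [eq_div_iff (by positivity)]
    linear_combination -e5'
  rw [d1, d2, d4, d5, d3]
  field_simp
  ring

lemma dedekindSum_reciprocity {h k : ℤ} (hh : 0 < h) (hk : 0 < k) (hc : IsCoprime h k) :
    dedekindSum h k + dedekindSum k h =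
      -1 / 4 + ((h : ℝ) / k + (k : ℝ) / h + 1 / ((h : ℝ) * k)) / 12 := by
  lift h to ℕ using hh.le
  lift k to ℕ using hk.le
  have := dedekindSum_reciprocity_nat (by exact_mod_cast hh) (by exact_mod_cast hk)
    (Nat.isCoprime_iff_coprime.mp hc)
  simpa only [Int.cast_natCast] using this

/-! ### The transformation of the eta function -/

/-- `(-i w) ^ (1/2)`. -/
noncomputable def rotSqrt (w : ℂ) : ℂ := (-Complex.I * w) ^ (1 / 2 : ℂ)

lemma rotSqrt_sq (w : ℂ) : rotSqrt w ^ 2 = -Complex.I * w := by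
  rw [rotSqrt, one_div]
  exact_mod_cast Complex.cpow_nat_inv_pow (-Complex.I * w) two_ne_zero

lemma neg_I_mul_re (w : ℂ) : (-Complex.I * w).re = w.im := by simp

lemma rotSqrt_re_pos {w : ℂ} (hw : 0 < w.im) : 0 < (rotSqrt w).re := by
  have h0 : -Complex.I * w ≠ 0 := fun h => by
    have := neg_I_mul_re w
    rw [h, Complex.zero_re] at this
    exact hw.ne this
  rw [rotSqrt, Complex.cpow_def_of_ne_zero h0, Complex.exp_re]
  refine mul_pos (Real.exp_pos _) (Real.cos_pos_of_mem_Ioo ?_)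
  have h1 := Complex.neg_pi_lt_arg (-Complex.I * w)
  have h2 : Complex.arg (-Complex.I * w) < Real.pi :=
    lt_of_le_of_ne (Complex.arg_le_pi _) fun h => by
      have := (Complex.arg_eq_pi_iff.mp h).1
      rw [neg_I_mul_re] at this
      exact lt_asymm hw this
  have h3 : (Complex.log (-Complex.I * w) * (1 / 2 : ℂ)).im = Complex.arg (-Complex.I * w) / 2 := by
    have : (1 / 2 : ℂ) = ((1 / 2 : ℝ) : ℂ) := by push_cast; rfl
    rw [this, Complex.im_mul_ofReal, Complex.log_im]
    ring
  rw [h3]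
  constructor <;> linarith

/-- The root has argument strictly between `-π/4` and `π/4`, since its square has positive real
part. Products of two such roots keep a positive real part, so identities between them can be
checked after squaring, without branch considerations. -/
lemma abs_rotSqrt_im_lt {w : ℂ} (hw : 0 < w.im) : |(rotSqrt w).im| < (rotSqrt w).re := by
  have h1 := congrArg Complex.re (rotSqrt_sq w)
  rw [neg_I_mul_re, sq, Complex.mul_re] at h1
  have h2 := rotSqrt_re_pos hw
  apply abs_lt_of_sq_lt_sq _ h2.le
  nlinarith

lemma rotSqrt_ne_zero {w : ℂ} (hw : 0 < w.im) : rotSqrt w ≠ 0 := fun h => by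
  have := rotSqrt_re_pos hw
  simp [h] at this

lemma eq_of_sq_eq_of_re_pos {a b : ℂ} (h : a ^ 2 = b ^ 2) (ha : 0 < a.re) (hb : 0 < b.re) :
    a = b := by
  rcases sq_eq_sq_iff_eq_or_eq_neg.mp h with h | h
  · exact h
  · rw [h, Complex.neg_re] at ha
    linarith

lemma mul_re_pos_of_abs_im_lt {a b : ℂ} (ha : |a.im| < a.re) (hb : |b.im| < b.re) :
    0 < (a * b).re := by
  rw [Complex.mul_re]
  have h1 : a.im * b.im ≤ |a.im| * |b.im| := by rw [← abs_mul]; exact le_abs_self _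
  have h2 : |a.im| * |b.im| < a.re * b.re :=
    mul_lt_mul'' ha hb (abs_nonneg _) (abs_nonneg _)
  linarith

lemma exp_pi_quarter : Complex.exp (Real.pi * Complex.I * (1 / 4)) =
    ((Real.sqrt 2 / 2 : ℝ) : ℂ) + ((Real.sqrt 2 / 2 : ℝ) : ℂ) * Complex.I := by
  rw [show (Real.pi : ℂ) * Complex.I * (1 / 4) = ((Real.pi / 4 : ℝ) : ℂ) * Complex.I by
    push_cast; ring, Complex.exp_mul_I, ← Complex.ofReal_cos, ← Complex.ofReal_sin,
    Real.cos_pi_div_four, Real.sin_pi_div_four]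

lemma exp_pi_quarter_mul_re_pos {a : ℂ} (ha : |a.im| < a.re) :
    0 < (Complex.exp (Real.pi * Complex.I * (1 / 4)) * a).re := by
  rw [exp_pi_quarter, Complex.mul_re]
  simp only [Complex.add_re, Complex.mul_re, Complex.ofReal_re, Complex.I_re, Complex.ofReal_im,
    Complex.I_im, Complex.add_im, Complex.mul_im]
  have h2 : 0 < Real.sqrt 2 := Real.sqrt_pos.mpr two_pos
  have := (abs_lt.mp ha).2
  nlinarith

lemma exp_pi_quarter_sq : Complex.exp (Real.pi * Complex.I * (1 / 4)) ^ 2 = Complex.I := by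
  rw [← Complex.exp_nat_mul, show ((2 : ℕ) : ℂ) * (Real.pi * Complex.I * (1 / 4)) =
    Real.pi / 2 * Complex.I by push_cast; ring, Complex.exp_pi_div_two_mul_I]

/-- The cocycle relation of the square roots under inversion. -/
lemma rotSqrt_mul_rotSqrt {w v t : ℂ} (hw : 0 < w.im) (hv : 0 < v.im) (ht : 0 < t.im)
    (h : w * v = -t) :
    rotSqrt w * rotSqrt v = Complex.exp (Real.pi * Complex.I * (1 / 4)) * rotSqrt t := by
  refine eq_of_sq_eq_of_re_pos ?_ (mul_re_pos_of_abs_im_lt (abs_rotSqrt_im_lt hw)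
    (abs_rotSqrt_im_lt hv)) (exp_pi_quarter_mul_re_pos (abs_rotSqrt_im_lt ht))
  rw [mul_pow, mul_pow, rotSqrt_sq, rotSqrt_sq, rotSqrt_sq, exp_pi_quarter_sq]
  linear_combination (Complex.I ^ 2) * h

lemma eta_neg_one_div {w : ℂ} (hw : 0 < w.im) :
    ModularForm.eta (-1 / w) = rotSqrt w * ModularForm.eta w := by
  have h := ModularForm.eta_comp_eq_csqrt_I_inv (x := w) hw
  simp only [Function.comp_apply, Pi.smul_apply, Pi.mul_apply, smul_eq_mul] at h
  rw [h, ← mul_assoc]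
  congr 1
  have hI : Complex.sqrt Complex.I = Complex.exp (Real.pi * Complex.I * (1 / 4)) := by
    rw [_root_.sqrt_eq_exp Complex.I_ne_zero, Complex.log_I]
    congr 1; ring
  have hw0 : w ≠ 0 := by rintro rfl; simp at hw
  have h1 : Complex.sqrt w ^ 2 = w := by
    rw [_root_.sqrt_eq_exp hw0, ← Complex.exp_nat_mul, show ((2 : ℕ) : ℂ) * (Complex.log w / 2) =
      Complex.log w by push_cast; ring, Complex.exp_log hw0]
  have h2 : 0 < (Complex.sqrt w).re := by
    rw [_root_.sqrt_eq_exp hw0, Complex.exp_re]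
    refine mul_pos (Real.exp_pos _) (Real.cos_pos_of_mem_Ioo ?_)
    have h3 : (Complex.log w / 2).im = Complex.arg w / 2 := by
      have : Complex.log w / 2 = Complex.log w * ((1 / 2 : ℝ) : ℂ) := by push_cast; ring
      rw [this, Complex.im_mul_ofReal, Complex.log_im]; ring
    have h4 := Complex.arg_nonneg_iff.mpr hw.le
    have h5 : Complex.arg w < Real.pi :=
      lt_of_le_of_ne (Complex.arg_le_pi _) fun h => by
        have := (Complex.arg_eq_pi_iff.mp h).2
        exact hw.ne' this
    rw [h3]
    constructor <;> linarith [Real.pi_pos]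
  rw [hI, inv_mul_eq_div, div_eq_iff (Complex.exp_ne_zero _), mul_comm]
  refine eq_of_sq_eq_of_re_pos ?_ h2 (exp_pi_quarter_mul_re_pos (abs_rotSqrt_im_lt hw))
  rw [h1, mul_pow, exp_pi_quarter_sq, rotSqrt_sq]
  linear_combination w * Complex.I_sq

lemma eta_add_int (w : ℂ) (n : ℤ) : ModularForm.eta (w + n) =
    Complex.exp (Real.pi * Complex.I * (n / 12)) * ModularForm.eta w := by
  have h1 : ∀ m : ℕ, ModularForm.eta_q m (w + n) = ModularForm.eta_q m w := by
    intro m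
    rw [ModularForm.eta_q_eq_cexp, ModularForm.eta_q_eq_cexp, mul_add, Complex.exp_add]
    rw [show 2 * (Real.pi : ℂ) * Complex.I * (m + 1) * n = ((m + 1) * n : ℤ) * (2 * Real.pi * Complex.I) by
      push_cast; ring, Complex.exp_int_mul_two_pi_mul_I, mul_one]
  simp only [ModularForm.eta, h1]
  rw [← mul_assoc]
  congr 1
  rw [Function.Periodic.qParam, Function.Periodic.qParam, ← Complex.exp_add]
  congr 1
  push_cast
  ring

lemma omega_eq (h k : ℤ) : omega h k = Complex.exp (Real.pi * Complex.I * dedekindSum h k) := rfl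

lemma mobius_im_pos {α β γ δ : ℤ} (hdet : α * δ - β * γ = 1) (h0 : γ ≠ 0 ∨ δ ≠ 0) {z : ℂ}
    (hz : 0 < z.im) : 0 < (((α : ℂ) * z + β) / (γ * z + δ)).im ∧ (γ : ℂ) * z + δ ≠ 0 := by
  have hne : (γ : ℂ) * z + δ ≠ 0 := by
    intro h
    have hi := congrArg Complex.im h
    have hr := congrArg Complex.re h
    simp at hi hr
    rcases hi with hi | hi
    · rcases h0 with h0 | h0
      · exact h0 hi
      · simp [hi] at hr
        exact h0 hr
    · exact hz.ne' hi
  refine ⟨?_, hne⟩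
  have hpos : 0 < Complex.normSq ((γ : ℂ) * z + δ) := Complex.normSq_pos.mpr hne
  have : (((α : ℂ) * z + β) / (γ * z + δ)).im = z.im / Complex.normSq ((γ : ℂ) * z + δ) := by
    rw [Complex.div_im]
    simp only [Complex.add_im, Complex.mul_im, Complex.intCast_re, Complex.intCast_im, zero_mul,
      add_zero, Complex.add_re, Complex.mul_re, sub_zero]
    have hd : (α : ℝ) * δ - β * γ = 1 := by exact_mod_cast hdet
    rw [← sub_div]
    congr 1
    linear_combination z.im * hd
  rw [this]
  positivity

/-- Induction on the lower left entry. A translation reduces the upper left entry modulo `γ`, and an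
inversion makes the reduced value the new lower left entry. The Dedekind sum is periodic and odd,
and the reciprocity law matches the change of multiplier under inversion. -/
lemma eta_transform_aux (n : ℕ) : ∀ {α β γ δ : ℤ}, γ.toNat = n → α * δ - β * γ = 1 → 0 < γ →
    ∀ {z : ℂ}, 0 < z.im → ModularForm.eta ((α * z + β) / (γ * z + δ)) =
      Complex.exp (Real.pi * Complex.I * ((α + δ) / (12 * γ))) *
        Complex.exp (-(Real.pi * Complex.I * dedekindSum α γ)) * rotSqrt (γ * z + δ) *
          ModularForm.eta z := by
  induction n using Nat.strong_induction_on with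
  | _ n ih =>
  intro α β γ δ hn hdet hγ z hz
  have hγC : (γ : ℂ) ≠ 0 := by exact_mod_cast hγ.ne'
  obtain ⟨hA, hden⟩ := mobius_im_pos hdet (Or.inl hγ.ne') hz
  -- Translating by `m = α / γ` multiplies eta by `exp (π i m / 12)`, which is the change of the
  -- term `(α + δ) / (12 γ)`.
  suffices h : ∀ {a b : ℤ}, a * δ - b * γ = 1 → 0 ≤ a → a < γ →
      ModularForm.eta ((a * z + b) / (γ * z + δ)) =
      Complex.exp (Real.pi * Complex.I * ((a + δ) / (12 * γ))) *
        Complex.exp (-(Real.pi * Complex.I * dedekindSum a γ)) * rotSqrt (γ * z + δ) *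
          ModularForm.eta z by
    set m := α / γ with hm
    have hα : α = α % γ + m * γ := by rw [hm]; linarith [Int.emod_add_mul_ediv α γ]
    have h1 := h (a := α % γ) (b := β - m * δ)
      (by rw [eq_sub_of_add_eq hα.symm]; linear_combination hdet)
      (Int.emod_nonneg _ hγ.ne') (Int.emod_lt_of_pos _ hγ)
    have hds : dedekindSum α γ = dedekindSum (α % γ) γ := by
      conv_lhs => rw [hα]
      exact dedekindSum_add_mul _ _ _ hγ
    have hαC : (α : ℂ) = ((α % γ : ℤ) : ℂ) + m * γ := by exact_mod_cast hα
    have h2 : ((α : ℂ) * z + β) / (γ * z + δ) =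
        (((α % γ : ℤ) : ℂ) * z + ((β - m * δ : ℤ) : ℂ)) / (γ * z + δ) + m := by
      rw [div_add' _ _ _ hden, hαC]
      congr 1
      push_cast
      ring
    rw [h2, eta_add_int, h1, hds, hαC]
    rw [show (Real.pi : ℂ) * Complex.I * ((((α % γ : ℤ) : ℂ) + m * γ + δ) / (12 * γ)) =
      Real.pi * Complex.I * (m / 12) + Real.pi * Complex.I * ((((α % γ : ℤ) : ℂ) + δ) / (12 * γ)) by
        field_simp; ring, Complex.exp_add]
    ring
  intro a b hab ha0 haγ
  rcases ha0.eq_or_lt with rfl | hapos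
  · -- the base case
    have hb : γ = 1 ∧ b = -1 := by
      have h1 : (-b) * γ = 1 := by linarith
      have h2 := Int.eq_one_or_neg_one_of_mul_eq_one' h1
      omega
    obtain ⟨rfl, rfl⟩ := hb
    have hw : 0 < (z + δ).im := by simpa using hz
    have hds : dedekindSum 0 1 = 0 := by simp [dedekindSum, saw]
    rw [show (((0 : ℤ) : ℂ) * z + ((-1 : ℤ) : ℂ)) / (((1 : ℤ) : ℂ) * z + δ) = -1 / (z + δ) by
      push_cast; ring_nf, eta_neg_one_div hw, eta_add_int, hds]
    push_cast
    simp only [zero_add, mul_zero, neg_zero, Complex.exp_zero, mul_one, one_mul]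
    ring
  · -- the inductive step
    have hapos' : (a : ℂ) ≠ 0 := by exact_mod_cast hapos.ne'
    -- The matrix with rows `(-γ, -δ)` and `(a, b)` gives `w` with `A z = -1 / w`; its lower left
    -- entry `a` is smaller than `γ`.
    have hdet' : (-γ) * b - (-δ) * a = 1 := by linear_combination hab
    obtain ⟨hw, hden'⟩ := mobius_im_pos hdet' (Or.inl hapos.ne') hz
    have h1 := ih a.toNat (by omega) rfl hdet' hapos hz
    set w := (((-γ : ℤ) : ℂ) * z + ((-δ : ℤ) : ℂ)) / (a * z + b) with hwdef
    have him : ∀ {c d : ℤ}, 0 < c → 0 < ((c : ℂ) * z + d).im := fun hc => by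
      simp only [Complex.add_im, Complex.mul_im, Complex.intCast_re, Complex.intCast_im, zero_mul,
        add_zero]
      exact mul_pos (by exact_mod_cast hc) hz
    have h2 : ((a : ℂ) * z + b) / (γ * z + δ) = -1 / w := by
      rw [hwdef]
      push_cast
      rw [show -(γ : ℂ) * z + -(δ : ℂ) = -(γ * z + δ) by ring]
      field_simp
    have h3 : rotSqrt w * rotSqrt (a * z + b) =
        Complex.exp (Real.pi * Complex.I * (1 / 4)) * rotSqrt (γ * z + δ) := by
      refine rotSqrt_mul_rotSqrt hw (him hapos) (him hγ) ?_
      rw [hwdef, div_mul_cancel₀ _ hden']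
      push_cast
      ring
    rw [h2, eta_neg_one_div hw, h1, dedekindSum_neg]
    have hcop : IsCoprime a γ := ⟨δ, -b, by linear_combination hab⟩
    have hrec := dedekindSum_reciprocity hapos hγ hcop
    have hrecC : (dedekindSum a γ : ℂ) + dedekindSum γ a =
        -1 / 4 + ((a : ℂ) / γ + (γ : ℂ) / a + 1 / ((a : ℂ) * γ)) / 12 := by
      exact_mod_cast congrArg (fun x : ℝ => (x : ℂ)) hrec
    have habC : (a : ℂ) * δ - b * γ = 1 := by exact_mod_cast hab
    have hexp : Complex.exp (Real.pi * Complex.I * ((((-γ : ℤ) : ℂ) + b) / (12 * a))) *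
        Complex.exp (-(Real.pi * Complex.I * ((-dedekindSum γ a : ℝ) : ℂ))) *
          Complex.exp (Real.pi * Complex.I * (1 / 4)) =
        Complex.exp (Real.pi * Complex.I * ((a + δ) / (12 * γ))) *
          Complex.exp (-(Real.pi * Complex.I * dedekindSum a γ)) := by
      rw [← Complex.exp_add, ← Complex.exp_add, ← Complex.exp_add]
      congr 1
      have h4 : (dedekindSum γ a : ℂ) = -1 / 4 + ((a : ℂ) / γ + (γ : ℂ) / a + 1 / ((a : ℂ) * γ)) / 12 -
        dedekindSum a γ := by linear_combination hrecC
      push_cast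
      rw [h4]
      field_simp
      linear_combination (-4 : ℂ) * habC
    calc _ = (Complex.exp (Real.pi * Complex.I * ((((-γ : ℤ) : ℂ) + b) / (12 * a))) *
        Complex.exp (-(Real.pi * Complex.I * ((-dedekindSum γ a : ℝ) : ℂ)))) *
          (rotSqrt w * rotSqrt (a * z + b)) * ModularForm.eta z := by ring
      _ = _ := by
        rw [h3, ← hexp]
        ring

/-- The transformation of the eta function with its multiplier in terms of Dedekind sums. -/
lemma eta_transform {α β γ δ : ℤ} (hdet : α * δ - β * γ = 1) (hγ : 0 < γ) {z : ℂ} (hz : 0 < z.im) :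
    ModularForm.eta ((α * z + β) / (γ * z + δ)) =
      Complex.exp (Real.pi * Complex.I * ((α + δ) / (12 * γ))) * (omega α γ)⁻¹ *
        rotSqrt (γ * z + δ) * ModularForm.eta z := by
  rw [eta_transform_aux _ rfl hdet hγ hz, omega_eq, ← Complex.exp_neg]

end OverpartitionRank

/-! ### The Gauss error function and its Poisson summation. -/

namespace OverpartitionRank

open Filter Topology Set MeasureTheory

/-! ### Gaussian sums -/

lemma summable_gaussian {a : ℝ} (ha : 0 < a) (x : ℝ) :
    Summable fun m : ℤ => Real.exp (-a * (x + m) ^ 2) := by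
  have hr : Real.exp (-a / 2) < 1 := by rw [← Real.exp_zero]; exact Real.exp_lt_exp.mpr (by linarith)
  refine Summable.of_nonneg_of_le (fun _ => (Real.exp_pos _).le) (fun m => ?_)
    ((summable_pow_natAbs (Real.exp_pos _).le hr).mul_left (Real.exp (a * x ^ 2)))
  rw [← Real.exp_nat_mul, ← Real.exp_add]
  apply Real.exp_le_exp.mpr
  have h1 : ((m.natAbs : ℕ) : ℝ) ≤ (m : ℝ) ^ 2 := by
    have h2 : ((m.natAbs : ℕ) : ℤ) ≤ m ^ 2 := by
      rw [← Int.natAbs_sq]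
      have := Nat.le_self_pow two_ne_zero m.natAbs
      zify at this ⊢
      exact this
    have h3 : (((m.natAbs : ℕ) : ℤ) : ℝ) ≤ ((m ^ 2 : ℤ) : ℝ) := Int.cast_le.mpr h2
    rwa [Int.cast_natCast, Int.cast_pow] at h3
  nlinarith [sq_nonneg (2 * x + m)]

lemma summable_gaussian_exp {a : ℝ} (ha : 0 < a) (b x : ℝ) :
    Summable fun m : ℤ => Real.exp (-a * (x + m) ^ 2 + b * |x + m|) := by
  refine Summable.of_nonneg_of_le (fun _ => (Real.exp_pos _).le) (fun m => ?_)
    ((summable_gaussian (half_pos ha) x).mul_left (Real.exp (b ^ 2 / (2 * a))))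
  rw [← Real.exp_add]
  apply Real.exp_le_exp.mpr
  have h : 0 ≤ (a * |x + m| - b) ^ 2 / (2 * a) := by positivity
  have h2 : (a * |x + m| - b) ^ 2 / (2 * a) =
      a / 2 * (x + m) ^ 2 - b * |x + m| + b ^ 2 / (2 * a) := by
    rw [← sq_abs (x + m)]; field_simp; ring
  nlinarith

/-! ### The error function -/

/-- `2 √y ∫_{-∞}^t exp (-π y x²) dx`. -/
noncomputable def errInt (y t : ℝ) : ℝ := 2 * √y * ∫ x in Iic t, Real.exp (-(Real.pi * y) * x ^ 2)

lemma integrable_errInt {y : ℝ} (hy : 0 < y) :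
    Integrable fun x : ℝ => Real.exp (-(Real.pi * y) * x ^ 2) :=
  integrable_exp_neg_mul_sq (by positivity)

lemma integral_gauss {y : ℝ} (hy : 0 < y) :
    2 * √y * ∫ x : ℝ, Real.exp (-(Real.pi * y) * x ^ 2) = 2 := by
  rw [integral_gaussian, show Real.pi / (Real.pi * y) = y⁻¹ by
    have := Real.pi_pos.ne'; field_simp, Real.sqrt_inv]
  have : √y ≠ 0 := (Real.sqrt_pos.mpr hy).ne'
  field_simp

lemma errInt_nonneg {y : ℝ} (t : ℝ) : 0 ≤ errInt y t :=
  mul_nonneg (by positivity) (integral_nonneg fun _ => (Real.exp_pos _).le)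

lemma errInt_eq_Ioi {y : ℝ} (t : ℝ) :
    errInt y t = 2 * √y * ∫ x in Ioi (-t), Real.exp (-(Real.pi * y) * x ^ 2) := by
  have h := integral_comp_neg_Iic t fun x => Real.exp (-(Real.pi * y) * x ^ 2)
  simp only [neg_sq] at h
  rw [errInt, h]

lemma errInt_add_neg {y : ℝ} (hy : 0 < y) (t : ℝ) : errInt y t + errInt y (-t) = 2 := by
  rw [errInt_eq_Ioi (-t), neg_neg, errInt, ← mul_add,
    intervalIntegral.integral_Iic_add_Ioi (integrable_errInt hy).integrableOn (integrable_errInt hy).integrableOn,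
    integral_gauss hy]

lemma errInt_le_two {y : ℝ} (hy : 0 < y) (t : ℝ) : errInt y t ≤ 2 := by
  have := errInt_add_neg hy t
  have := errInt_nonneg (y := y) (-t)
  linarith

/-- On the tail `x ≥ t ≥ 0` one has `x² ≥ t² + (x - t)²`, and the shifted Gaussian integrates to at
most the full normalised mass 2. -/
lemma errInt_neg_le {y : ℝ} (hy : 0 < y) {t : ℝ} (ht : 0 ≤ t) :
    errInt y (-t) ≤ 2 * Real.exp (-(Real.pi * y) * t ^ 2) := by
  rw [errInt_eq_Ioi, neg_neg]
  have hi : Integrable fun x : ℝ => Real.exp (-(Real.pi * y) * (x - t) ^ 2) :=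
    (integrable_errInt hy).comp_sub_right t
  have h2 : ∫ x in Ioi t, Real.exp (-(Real.pi * y) * x ^ 2) ≤
      ∫ x in Ioi t, Real.exp (-(Real.pi * y) * t ^ 2) * Real.exp (-(Real.pi * y) * (x - t) ^ 2) := by
    refine setIntegral_mono_on (integrable_errInt hy).integrableOn
      (hi.const_mul _).integrableOn measurableSet_Ioi fun x hx => ?_
    rw [← Real.exp_add]
    apply Real.exp_le_exp.mpr
    have : 0 ≤ (x - t) * t := mul_nonneg (sub_nonneg.mpr (le_of_lt hx)) ht
    have hpy : 0 < Real.pi * y := by positivity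
    nlinarith
  have h3 : ∫ x in Ioi t, Real.exp (-(Real.pi * y) * (x - t) ^ 2) ≤
      ∫ x : ℝ, Real.exp (-(Real.pi * y) * (x - t) ^ 2) :=
    setIntegral_le_integral hi (Eventually.of_forall fun _ => (Real.exp_pos _).le)
  rw [integral_sub_right_eq_self (μ := volume) (fun x : ℝ => Real.exp (-(Real.pi * y) * x ^ 2)) t] at h3
  rw [integral_const_mul] at h2
  calc _ ≤ 2 * √y * (Real.exp (-(Real.pi * y) * t ^ 2) *
        ∫ x : ℝ, Real.exp (-(Real.pi * y) * x ^ 2)) := by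
        gcongr
        exact h2.trans (by gcongr)
    _ = Real.exp (-(Real.pi * y) * t ^ 2) * (2 * √y * ∫ x : ℝ, Real.exp (-(Real.pi * y) * x ^ 2)) := by
        ring
    _ = _ := by rw [integral_gauss hy]; ring

lemma hasDerivAt_errInt {y : ℝ} (hy : 0 < y) (t : ℝ) :
    HasDerivAt (errInt y) (2 * √y * Real.exp (-(Real.pi * y) * t ^ 2)) t := by
  have hi := integrable_errInt hy
  have h1 : ∀ u, ∫ x in Iic u, Real.exp (-(Real.pi * y) * x ^ 2) =
      (∫ x in Iic (0 : ℝ), Real.exp (-(Real.pi * y) * x ^ 2)) +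
        ∫ x in (0 : ℝ)..u, Real.exp (-(Real.pi * y) * x ^ 2) := fun u => by
    rw [← intervalIntegral.integral_Iic_sub_Iic hi.integrableOn hi.integrableOn]; ring
  have hc : Continuous fun x : ℝ => Real.exp (-(Real.pi * y) * x ^ 2) := by fun_prop
  have h2 := ((hc.integral_hasStrictDerivAt 0 t).hasDerivAt.const_add
    (∫ x in Iic (0 : ℝ), Real.exp (-(Real.pi * y) * x ^ 2))).const_mul (2 * √y)
  have h3 : errInt y = fun u => 2 * √y * ((∫ x in Iic (0 : ℝ), Real.exp (-(Real.pi * y) * x ^ 2)) +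
        ∫ x in (0 : ℝ)..u, Real.exp (-(Real.pi * y) * x ^ 2)) := by
    funext u; rw [errInt, h1]
  rw [h3]
  exact h2

/-- `sgn t - E(t √y)`, with `E(t √y) = errInt y t - 1`. -/
noncomputable def signErr (y t : ℝ) : ℝ := Real.sign t * errInt y (-|t|)

lemma one_add_sign_sub_errInt {y : ℝ} (hy : 0 < y) (t : ℝ) :
    1 + Real.sign t - errInt y t = signErr y t := by
  rw [signErr]
  have h := errInt_add_neg hy t
  rcases lt_trichotomy t 0 with h0 | rfl | h0
  · rw [Real.sign_of_neg h0, abs_of_neg h0, neg_neg]; ring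
  · rw [neg_zero] at h
    rw [Real.sign_zero]; linarith
  · rw [Real.sign_of_pos h0, abs_of_pos h0]; linarith

lemma signErr_neg (y t : ℝ) : signErr y (-t) = -signErr y t := by
  rw [signErr, signErr, abs_neg, Real.sign_neg]; ring

lemma abs_signErr_le {y : ℝ} (hy : 0 < y) (t : ℝ) :
    |signErr y t| ≤ 2 * Real.exp (-(Real.pi * y) * t ^ 2) := by
  have h := errInt_neg_le hy (abs_nonneg t)
  rw [sq_abs] at h
  have h1 : |Real.sign t| ≤ 1 := by
    rcases Real.sign_apply_eq t with h | h | h <;> simp [h]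
  rw [signErr, abs_mul, abs_of_nonneg (errInt_nonneg _)]
  exact (mul_le_of_le_one_left (errInt_nonneg _) h1).trans h

lemma norm_e (w : ℂ) : ‖e w‖ = Real.exp (-(2 * Real.pi) * w.im) := by
  rw [e, Complex.norm_exp]
  congr 1
  simp

lemma e_add (v w : ℂ) : e (v + w) = e v * e w := by rw [e, e, e, ← Complex.exp_add, mul_add]

lemma e_int (n : ℤ) : e n = 1 := by
  rw [e, mul_comm]; exact Complex.exp_int_mul_two_pi_mul_I n

lemma e_ne_zero (w : ℂ) : e w ≠ 0 := Complex.exp_ne_zero _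

lemma e_zpow (w : ℂ) (n : ℤ) : e w ^ n = e (n * w) := by
  rw [e, e, ← Complex.exp_int_mul]; congr 1; ring

lemma continuous_e : Continuous e := by unfold e; fun_prop

/-- For `t ≥ 0` the exponential decays and the error integral is bounded. For `t ≤ 0` the Gaussian
tail beats the growing exponential; completing the square in `y t + 2 Im v` yields the constant `4 π
(Im v)² / y`. -/
lemma norm_errInt_mul_e_le {y : ℝ} (hy : 0 < y) {v : ℂ} (hv : 0 < v.im) (t : ℝ) :
    ‖(errInt y t : ℂ) * e (t * v)‖ ≤
      2 * Real.exp (4 * Real.pi * v.im ^ 2 / y) * Real.exp (-(2 * Real.pi * v.im) * |t|) := by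
  have him : ((t : ℂ) * v).im = t * v.im := by simp
  rw [norm_mul, Complex.norm_real, Real.norm_of_nonneg (errInt_nonneg _), norm_e, him]
  rcases le_total 0 t with ht | ht
  · rw [abs_of_nonneg ht]
    have h1 : 1 ≤ Real.exp (4 * Real.pi * v.im ^ 2 / y) := Real.one_le_exp (by positivity)
    have h2 := errInt_le_two hy t
    calc _ ≤ 2 * 1 * Real.exp (-(2 * Real.pi) * (t * v.im)) := by rw [mul_one]; gcongr
      _ ≤ 2 * Real.exp (4 * Real.pi * v.im ^ 2 / y) * Real.exp (-(2 * Real.pi) * (t * v.im)) := by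
        gcongr
      _ = _ := by congr 2; ring
  · rw [abs_of_nonpos ht]
    have h1 := errInt_neg_le hy (neg_nonneg.mpr ht)
    rw [neg_neg, neg_sq] at h1
    calc _ ≤ 2 * Real.exp (-(Real.pi * y) * t ^ 2) * Real.exp (-(2 * Real.pi) * (t * v.im)) := by gcongr
      _ = 2 * Real.exp (-(Real.pi * y) * t ^ 2 - 2 * Real.pi * (t * v.im)) := by
        rw [mul_assoc, ← Real.exp_add]; congr 2; ring
      _ ≤ 2 * Real.exp (4 * Real.pi * v.im ^ 2 / y + -(2 * Real.pi * v.im) * -t) := by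
        gcongr
        have h : 0 ≤ Real.pi * (y * t + 2 * v.im) ^ 2 / y := by positivity
        have h2 : Real.pi * (y * t + 2 * v.im) ^ 2 / y =
          Real.pi * y * t ^ 2 + 4 * Real.pi * v.im * t + 4 * Real.pi * v.im ^ 2 / y := by
            field_simp; ring
        nlinarith
      _ = _ := by rw [Real.exp_add]; ring

/-! ### Poisson summation -/

/-- `exp (-π w² / y) / w`. -/
noncomputable def gaussPole (y : ℝ) (w : ℂ) : ℂ := Complex.exp (-(Real.pi * w ^ 2 / y)) / w

lemma gaussPole_neg (y : ℝ) (w : ℂ) : gaussPole y (-w) = -gaussPole y w := by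
  rw [gaussPole, gaussPole, neg_sq, div_neg]

lemma norm_gaussPole (y : ℝ) (w : ℂ) :
    ‖gaussPole y w‖ = Real.exp (-(Real.pi / y) * (w.re ^ 2 - w.im ^ 2)) / ‖w‖ := by
  rw [gaussPole, norm_div, Complex.norm_exp]
  congr 2
  have : (Real.pi * w ^ 2 / y : ℂ) = ((Real.pi / y : ℝ) : ℂ) * w ^ 2 := by push_cast; ring
  rw [Complex.neg_re, this, Complex.re_ofReal_mul, sq w, Complex.mul_re]
  ring

lemma continuous_errInt {y : ℝ} (hy : 0 < y) : Continuous (errInt y) :=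
  continuous_iff_continuousAt.mpr fun t => (hasDerivAt_errInt hy t).continuousAt

lemma integrable_exp_neg_mul_abs {b : ℝ} (hb : 0 < b) :
    Integrable fun x : ℝ => Real.exp (-b * |x|) := by
  rw [← integrableOn_univ, ← Iic_union_Ioi (a := (0 : ℝ))]
  refine IntegrableOn.union ?_ ?_
  · refine (integrableOn_exp_mul_Iic hb 0).congr_fun (fun x hx => ?_) measurableSet_Iic
    rw [abs_of_nonpos hx]; ring_nf
  · refine (integrableOn_exp_mul_Ioi (neg_neg_of_pos hb) 0).congr_fun (fun x hx => ?_) measurableSet_Ioi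
    rw [abs_of_pos hx]

lemma integrable_errInt_mul_e {y : ℝ} (hy : 0 < y) {v : ℂ} (hv : 0 < v.im) :
    Integrable fun t : ℝ => (errInt y t : ℂ) * e (t * v) := by
  refine Integrable.mono' ((integrable_exp_neg_mul_abs (b := 2 * Real.pi * v.im) (by positivity)).const_mul
    (2 * Real.exp (4 * Real.pi * v.im ^ 2 / y))) ?_
    (Eventually.of_forall fun t => norm_errInt_mul_e_le hy hv t)
  refine Continuous.aestronglyMeasurable ?_
  have := continuous_errInt hy
  have := continuous_e
  fun_prop

/-- Integration by parts: the derivative of the error integral is a Gaussian, whose Fourier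
transform is again Gaussian, and the antiderivative of `e(t v)` supplies the simple pole `1 / v`.
Boundary terms vanish by the exponential bound. -/
lemma integral_errInt_mul_e {y : ℝ} (hy : 0 < y) {v : ℂ} (hv : 0 < v.im) :
    ∫ t : ℝ, (errInt y t : ℂ) * e (t * v) = Complex.I / Real.pi * gaussPole y v := by
  have hv0 : v ≠ 0 := by rintro rfl; simp at hv
  have hpi : (Real.pi : ℂ) ≠ 0 := by exact_mod_cast Real.pi_ne_zero
  have hyC : (y : ℂ) ≠ 0 := by exact_mod_cast hy.ne'
  have hgint : Integrable fun t : ℝ =>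
      Complex.exp (Complex.I * (2 * Real.pi * v) * t) * Complex.exp (-(Real.pi * y : ℂ) * (t : ℂ) ^ 2) := by
    have := integrable_cexp_quadratic (b := (Real.pi * y : ℂ)) (by
      rw [← Complex.ofReal_mul, Complex.ofReal_re]
      positivity) (Complex.I * (2 * Real.pi * v)) 0
    refine this.congr (Eventually.of_forall fun t => ?_)
    simp only
    rw [← Complex.exp_add]
    congr 1; ring
  have hg : ∫ t : ℝ, Complex.exp (Complex.I * (2 * Real.pi * v) * t) *
      Complex.exp (-(Real.pi * y : ℂ) * (t : ℂ) ^ 2) =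
        (√y : ℂ)⁻¹ * Complex.exp (-(Real.pi * v ^ 2 / y)) := by
    rw [fourierIntegral_gaussian (by rw [← Complex.ofReal_mul, Complex.ofReal_re]; positivity)]
    congr 1
    · rw [show (Real.pi : ℂ) / (Real.pi * y) = ((y⁻¹ : ℝ) : ℂ) by push_cast; field_simp,
        show (1 / 2 : ℂ) = ((1 / 2 : ℝ) : ℂ) by push_cast; rfl,
        ← Complex.ofReal_cpow (by positivity), ← Real.sqrt_eq_rpow, Real.sqrt_inv]
      push_cast; rfl
    · congr 1
      field_simp
      ring
  have hderiv : ∀ t : ℝ, HasDerivAt (fun t : ℝ => (errInt y t : ℂ) * (e (t * v) / (2 * Real.pi * Complex.I * v)))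
      ((2 * √y / (2 * Real.pi * Complex.I * v)) * (Complex.exp (Complex.I * (2 * Real.pi * v) * t) *
        Complex.exp (-(Real.pi * y : ℂ) * (t : ℂ) ^ 2)) + (errInt y t : ℂ) * e (t * v)) t := by
    intro t
    have h1 := (hasDerivAt_errInt hy t).ofReal_comp
    have h2 : HasDerivAt (fun t : ℝ => e (t * v) / (2 * Real.pi * Complex.I * v)) (e (t * v)) t := by
      have h3 : HasDerivAt (fun t : ℝ => (2 * Real.pi * Complex.I) * ((t : ℂ) * v))
          ((2 * Real.pi * Complex.I) * (1 * v)) t :=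
        ((Complex.ofRealCLM.hasDerivAt (x := t)).mul_const v).const_mul _
      have h4 := (h3.cexp).div_const (2 * Real.pi * Complex.I * v)
      convert! h4 using 1
      rw [e]
      field_simp
    convert! h1.mul h2 using 1
    rw [e]
    push_cast
    rw [show (2 * Real.pi * Complex.I * (t * v) : ℂ) = Complex.I * (2 * Real.pi * v) * t by ring]
    ring
  have hfi := integrable_errInt_mul_e hy hv
  have hbound : ∀ t : ℝ, ‖(errInt y t : ℂ) * (e (t * v) / (2 * Real.pi * Complex.I * v))‖ ≤
      2 * Real.exp (4 * Real.pi * v.im ^ 2 / y) * Real.exp (-(2 * Real.pi * v.im) * |t|) /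
        ‖2 * Real.pi * Complex.I * v‖ := by
    intro t
    rw [← mul_div_assoc, norm_div]
    gcongr
    exact norm_errInt_mul_e_le hy hv t
  have hexp0 : Tendsto (fun s : ℝ => 2 * Real.exp (4 * Real.pi * v.im ^ 2 / y) *
      Real.exp (-(2 * Real.pi * v.im) * s) / ‖2 * Real.pi * Complex.I * v‖) atTop (𝓝 0) := by
    have h1 : Tendsto (fun s : ℝ => Real.exp (-(2 * Real.pi * v.im) * s)) atTop (𝓝 0) := by
      refine Real.tendsto_exp_atBot.comp ?_
      exact tendsto_id.const_mul_atTop_of_neg (by have : 0 < 2 * Real.pi * v.im := by positivity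
                                                  linarith)
    have h2 := (h1.const_mul (2 * Real.exp (4 * Real.pi * v.im ^ 2 / y))).div_const
      ‖2 * Real.pi * Complex.I * v‖
    rwa [mul_zero, zero_div] at h2
  have hint := integral_of_hasDerivAt_of_tendsto hderiv ((hgint.const_mul _).add hfi)
    (squeeze_zero_norm hbound (hexp0.comp tendsto_abs_atBot_atTop))
    (squeeze_zero_norm hbound (hexp0.comp tendsto_abs_atTop_atTop))
  rw [integral_add (hgint.const_mul _) hfi, integral_const_mul, hg, sub_zero] at hint
  have hsq : (√y : ℂ) ≠ 0 := by exact_mod_cast (Real.sqrt_pos.mpr hy).ne'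
  rw [eq_neg_of_add_eq_zero_right hint, gaussPole]
  field_simp
  rw [Complex.I_sq]

lemma summable_gaussPole {y : ℝ} (hy : 0 < y) {v : ℂ} (hv : v.im ≠ 0) {ξ : ℤ → ℂ}
    (hξ : ∀ m, ‖ξ m‖ = 1) : Summable fun m : ℤ => ξ m * gaussPole y (v + m) := by
  refine Summable.of_norm_bounded (g := fun m : ℤ => Real.exp (Real.pi / y * v.im ^ 2) / |v.im| *
    Real.exp (-(Real.pi / y) * (v.re + m) ^ 2)) ((summable_gaussian (by positivity) _).mul_left _)
    fun m => ?_
  rw [norm_mul, hξ, one_mul, norm_gaussPole]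
  have h1 : |v.im| ≤ ‖v + m‖ := by
    have := Complex.abs_im_le_norm (v + m)
    simpa using this
  have h2 : 0 < |v.im| := abs_pos.mpr hv
  calc _ ≤ Real.exp (-(Real.pi / y) * ((v + m).re ^ 2 - (v + m).im ^ 2)) / |v.im| := by gcongr
    _ = _ := by
      simp only [Complex.add_re, Complex.intCast_re, Complex.add_im, Complex.intCast_im, add_zero]
      rw [div_mul_eq_mul_div, ← Real.exp_add]
      congr 2; ring

/-- Multiplying by `e(t v)` only translates the Fourier variable, so the transform at an integer `m`
is the Gaussian pole at `v - m`. -/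
lemma poisson_errInt {y : ℝ} (hy : 0 < y) {v : ℂ} (hv : 0 < v.im) (s : ℝ) :
    ∑' n : ℤ, (errInt y (s + n) : ℂ) * e ((s + n) * v) =
      Complex.I / Real.pi * ∑' m : ℤ, e (m * s) * gaussPole y (v - m) := by
  set f : ℝ → ℂ := fun t => (errInt y t : ℂ) * e (t * v) with hf
  have hfc : Continuous f := by
    have := continuous_errInt hy
    have := continuous_e
    fun_prop
  have hF : ∀ n : ℤ, FourierTransform.fourier f (n : ℝ) = Complex.I / Real.pi * gaussPole y (v - n) := by
    intro n
    rw [Real.fourier_real_eq_integral_exp_smul, ← integral_errInt_mul_e hy (v := v - n) (by simpa using hv)]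
    congr 1
    ext t
    rw [smul_eq_mul, hf]
    simp only
    rw [mul_sub, sub_eq_add_neg, e_add, mul_left_comm, mul_comm (Complex.exp _)]
    congr 2
    rw [e]
    congr 1
    push_cast
    ring
  have hsum : Summable fun n : ℤ => FourierTransform.fourier f (n : ℝ) := by
    simp only [hF]
    refine Summable.mul_left _ ?_
    have h := (summable_gaussPole hy (v := v) hv.ne' (ξ := fun _ => 1) (by simp)).comp_injective
      neg_injective
    refine h.congr fun n => ?_
    simp [sub_eq_add_neg]
  have hO : f =O[cocompact ℝ] fun x : ℝ => |x| ^ (-2 : ℝ) := by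
    set c := 2 * Real.pi * v.im
    have hc : 0 < c := by positivity
    refine Asymptotics.IsBigO.of_bound (2 * Real.exp (4 * Real.pi * v.im ^ 2 / y) * (2 / c ^ 2)) ?_
    have h0 : ∀ᶠ x : ℝ in cocompact ℝ, x ≠ 0 := by
      have : ({0} : Set ℝ)ᶜ ∈ cocompact ℝ := isCompact_singleton.compl_mem_cocompact
      filter_upwards [this] with x hx using hx
    filter_upwards [h0] with t ht
    refine (norm_errInt_mul_e_le hy hv t).trans ?_
    -- The exponential bound is converted to `|t| ^ (-2)` through `exp x ≥ x² / 2` for `x ≥ 0`,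
    -- whence the factor `2 / c²`.
    rw [mul_assoc _ (2 / c ^ 2)]
    gcongr
    rw [Real.norm_of_nonneg (by positivity), Real.rpow_neg (abs_nonneg _), Real.rpow_two]
    have h1 := Real.quadratic_le_exp_of_nonneg (x := c * |t|) (by positivity)
    have ht' : 0 < |t| := abs_pos.mpr ht
    rw [neg_mul, Real.exp_neg, div_mul_eq_mul_div, ← div_eq_mul_inv, div_div, ← one_div,
      div_le_div_iff₀ (Real.exp_pos _) (by positivity)]
    have : 0 < c * |t| := by positivity
    nlinarith
  have hP := Real.tsum_eq_tsum_fourier_of_rpow_decay_of_summable hfc one_lt_two hO hsum s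
  simp only [hF, fourier_coe_apply] at hP
  simp only [hf] at hP
  push_cast at hP
  rw [hP, ← tsum_mul_left]
  refine tsum_congr fun m => ?_
  rw [e, show (2 * Real.pi * Complex.I * m * s / 1 : ℂ) = 2 * Real.pi * Complex.I * (m * s) by ring]
  ring

end OverpartitionRank

/-! ### Cotangent and cosecant from Gaussian-regularised partial fractions. -/

namespace OverpartitionRank

open Filter Topology Set

/-! ### Completion of `cot` and `1 / sin` -/

/-- `C` is the odd kernel with `I * C v = ∑ (1 + sgn (s + n)) e((s + n) v)` for `Im v > 0`. -/
structure IsSignKernel (s : ℝ) (C : ℂ → ℂ) : Prop where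
  two_mul : ∃ k : ℤ, 2 * s = k
  hasSum : ∀ v : ℂ, 0 < v.im →
    HasSum (fun n : ℤ => ((1 + Real.sign (s + n) : ℝ) : ℂ) * e ((s + n) * v)) (Complex.I * C v)
  odd : ∀ v, C (-v) = -C v
  continuousAt : ∀ v : ℂ, (∀ m : ℤ, v ≠ m) → ContinuousAt C v

lemma norm_e_ofReal (x : ℝ) : ‖e x‖ = 1 := by simp [norm_e]

lemma norm_signErr_mul_e_le {y : ℝ} (hy : 0 < y) (t : ℝ) {v : ℂ} {b : ℝ} (hv : |v.im| ≤ b) :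
    ‖(signErr y t : ℂ) * e (t * v)‖ ≤
      2 * Real.exp (-(Real.pi * y) * t ^ 2 + 2 * Real.pi * b * |t|) := by
  have him : ((t : ℂ) * v).im = t * v.im := by simp
  rw [norm_mul, Complex.norm_real, Real.norm_eq_abs, norm_e, him, Real.exp_add, ← mul_assoc 2]
  refine mul_le_mul (abs_signErr_le hy t) (Real.exp_le_exp.mpr ?_) (Real.exp_pos _).le (by positivity)
  · have h1 : -(t * v.im) ≤ |t| * b := by
      calc _ ≤ |t * v.im| := neg_le_abs _
        _ = |t| * |v.im| := abs_mul _ _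
        _ ≤ _ := by gcongr
    have := Real.pi_pos
    nlinarith

lemma summable_signErr_mul_e {y : ℝ} (hy : 0 < y) (s : ℝ) (v : ℂ) :
    Summable fun n : ℤ => (signErr y (s + n) : ℂ) * e ((s + n) * v) := by
  refine Summable.of_norm_bounded
    ((summable_gaussian_exp (a := Real.pi * y) (by positivity) (2 * Real.pi * |v.im|) s).mul_left 2)
    fun n => ?_
  have := norm_signErr_mul_e_le hy (s + n) (v := v) le_rfl
  push_cast at this
  exact this

lemma continuousOn_tsum_signErr_mul_e {y : ℝ} (hy : 0 < y) (s : ℝ) (b : ℝ) :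
    ContinuousOn (fun v : ℂ => ∑' n : ℤ, (signErr y (s + n) : ℂ) * e ((s + n) * v))
      {v | |v.im| ≤ b} := by
  refine continuousOn_tsum (fun n => ?_)
    ((summable_gaussian_exp (a := Real.pi * y) (by positivity) (2 * Real.pi * b) s).mul_left 2)
    fun n v hv => ?_
  · have := continuous_e
    fun_prop
  · have := norm_signErr_mul_e_le hy (s + n) (v := v) hv
    push_cast at this
    exact this

lemma continuousOn_tsum_gaussPole {y : ℝ} (hy : 0 < y) {x : ℝ} (hx : ∀ m : ℤ, x ≠ m) {ξ : ℤ → ℂ}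
    (hξ : ∀ m, ‖ξ m‖ = 1) :
    ContinuousOn (fun t : ℝ => ∑' m : ℤ, ξ m * gaussPole y (x + Complex.I * t + m)) (Icc 0 1) := by
  set d := |x - round x|
  have hd : 0 < d := abs_pos.mpr (sub_ne_zero.mpr (hx _))
  have hre : ∀ (t : ℝ) (m : ℤ), ((x : ℂ) + Complex.I * t + m).re = x + m := by simp
  have hdle : ∀ (t : ℝ) (m : ℤ), d ≤ ‖(x : ℂ) + Complex.I * t + m‖ := fun t m => by
    have h1 := Complex.abs_re_le_norm ((x : ℂ) + Complex.I * t + m)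
    rw [hre] at h1
    have h2 := round_le x (-m)
    push_cast at h2
    rw [sub_neg_eq_add] at h2
    exact h2.trans h1
  refine continuousOn_tsum (u := fun m : ℤ => Real.exp (Real.pi / y) / d *
    Real.exp (-(Real.pi / y) * (x + m) ^ 2)) (fun m => ?_)
    ((summable_gaussian (by positivity) _).mul_left _) fun m t ht => ?_
  · refine continuousOn_const.mul ?_
    unfold gaussPole
    refine ContinuousOn.div (by fun_prop) (by fun_prop) fun t _ h0 => ?_
    have := hdle t m
    rw [h0, norm_zero] at this
    linarith
  · rw [norm_mul, hξ, one_mul, norm_gaussPole, hre]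
    have him : ((x : ℂ) + Complex.I * t + m).im = t := by simp
    rw [him, div_mul_eq_mul_div, ← Real.exp_add]
    have ht2 : t ^ 2 ≤ 1 := by nlinarith [ht.1, ht.2]
    have hpy : 0 < Real.pi / y := by positivity
    gcongr
    · nlinarith
    · exact hdle t m

lemma IsSignKernel.e_neg_mul {s : ℝ} {C : ℂ → ℂ} (hC : IsSignKernel s C) (m : ℤ) :
    e (-m * s) = e (m * s) := by
  obtain ⟨k, hk⟩ := hC.two_mul
  have hk' : (2 * s : ℂ) = k := by exact_mod_cast hk
  have : (-m * s : ℂ) = m * s + ((-m * k : ℤ) : ℂ) := by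
    push_cast
    rw [← hk']; ring
  rw [this, e_add, e_int, mul_one]

lemma IsSignKernel.completion_of_im_pos {s : ℝ} {C : ℂ → ℂ} (hC : IsSignKernel s C) {y : ℝ}
    (hy : 0 < y) {v : ℂ} (hv : 0 < v.im) :
    1 / Real.pi * ∑' m : ℤ, e (m * s) * gaussPole y (v + m) =
      C v + Complex.I * ∑' n : ℤ, (signErr y (s + n) : ℂ) * e ((s + n) * v) := by
  have h1 : ∑' m : ℤ, e (m * s) * gaussPole y (v + m) =
      ∑' m : ℤ, e (m * s) * gaussPole y (v - m) := by
    rw [← (Equiv.neg ℤ).tsum_eq]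
    refine tsum_congr fun m => ?_
    simp only [Equiv.neg_apply, Int.cast_neg]
    rw [hC.e_neg_mul, sub_eq_add_neg]
  have hsum := hC.hasSum v hv
  have h2 : ∀ n : ℤ, (errInt y (s + n) : ℂ) * e ((s + n) * v) =
      ((1 + Real.sign (s + n) : ℝ) : ℂ) * e ((s + n) * v) -
        (signErr y (s + n) : ℂ) * e ((s + n) * v) := fun n => by
    rw [← sub_mul, ← one_add_sign_sub_errInt hy]
    push_cast
    ring
  have h3 := poisson_errInt hy hv s
  rw [tsum_congr h2, hsum.summable.tsum_sub (summable_signErr_mul_e hy s v), hsum.tsum_eq, ← h1] at h3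
  linear_combination Complex.I * h3 + (1 / Real.pi *
    ∑' m : ℤ, e (m * s) * gaussPole y (v + m) - C v) * Complex.I_sq

lemma IsSignKernel.completion_of_im_neg {s : ℝ} {C : ℂ → ℂ} (hC : IsSignKernel s C) {y : ℝ}
    (hy : 0 < y) {v : ℂ} (hv : v.im < 0) :
    1 / Real.pi * ∑' m : ℤ, e (m * s) * gaussPole y (v + m) =
      C v + Complex.I * ∑' n : ℤ, (signErr y (s + n) : ℂ) * e ((s + n) * v) := by
  have h0 := hC.completion_of_im_pos hy (v := -v) (by simpa using hv)
  obtain ⟨k, hk⟩ := hC.two_mul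
  have hk' : (2 * s : ℂ) = k := by exact_mod_cast hk
  have h1 : ∑' m : ℤ, e (m * s) * gaussPole y (-v + m) =
      -∑' m : ℤ, e (m * s) * gaussPole y (v + m) := by
    rw [← (Equiv.neg ℤ).tsum_eq, ← tsum_neg]
    refine tsum_congr fun m => ?_
    simp only [Equiv.neg_apply, Int.cast_neg]
    rw [hC.e_neg_mul, ← neg_add, gaussPole_neg, mul_neg]
  have h2 : ∑' n : ℤ, (signErr y (s + n) : ℂ) * e ((s + n) * -v) =
      -∑' n : ℤ, (signErr y (s + n) : ℂ) * e ((s + n) * v) := by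
    rw [← (Equiv.subLeft (-k)).tsum_eq, ← tsum_neg]
    refine tsum_congr fun n => ?_
    simp only [Equiv.subLeft_apply]
    have h3 : s + ((-k - n : ℤ) : ℝ) = -(s + n) := by push_cast; rw [← hk]; ring
    have h4 : (s : ℂ) + ((-k - n : ℤ) : ℂ) = -(s + n) := by push_cast; rw [← hk']; ring
    rw [h3, h4, signErr_neg, neg_mul_neg]
    push_cast
    ring
  rw [h1, h2, hC.odd] at h0
  linear_combination -h0

/-- In the upper half-plane this is Poisson summation with `errInt` written as `1 + sgn` minus
`signErr`: the sign part sums to the kernel. The lower half-plane follows because all terms are odd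
in `v`, using that `2 s` is an integer. Real non-integral points are limits from above; they are
needed for the row `n = 0` of the lattice. -/
lemma IsSignKernel.completion {s : ℝ} {C : ℂ → ℂ} (hC : IsSignKernel s C) {y : ℝ}
    (hy : 0 < y) {v : ℂ} (hv : ∀ m : ℤ, v ≠ m) :
    1 / Real.pi * ∑' m : ℤ, e (m * s) * gaussPole y (v + m) =
      C v + Complex.I * ∑' n : ℤ, (signErr y (s + n) : ℂ) * e ((s + n) * v) := by
  rcases lt_trichotomy v.im 0 with h | h | h
  · exact hC.completion_of_im_neg hy h
  · obtain ⟨x, rfl⟩ : ∃ x : ℝ, v = x := ⟨v.re, Complex.ext rfl (by simpa using h)⟩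
    have hx : ∀ m : ℤ, x ≠ m := fun m hm => hv m (by rw [hm]; simp)
    have hmem : ∀ t : ℝ, ∀ m : ℤ, (x : ℂ) + Complex.I * t ≠ m := fun t m hm => by
      have h1 := congrArg Complex.re hm
      simp at h1
      exact hx m h1
    have key : EqOn (fun t : ℝ => 1 / Real.pi * ∑' m : ℤ, e (m * s) *
        gaussPole y (x + Complex.I * t + m)) (fun t : ℝ => C (x + Complex.I * t) +
          Complex.I * ∑' n : ℤ, (signErr y (s + n) : ℂ) * e ((s + n) * (x + Complex.I * t)))
        (Icc 0 1) := by
      refine EqOn.of_subset_closure (s := Ioc 0 1) (fun t ht => ?_) ?_ ?_ Ioc_subset_Icc_self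
        (by rw [closure_Ioc zero_ne_one])
      · exact hC.completion_of_im_pos hy (by simpa using ht.1)
      · exact continuousOn_const.mul (continuousOn_tsum_gaussPole hy hx fun m => by
          rw [show (m * s : ℂ) = ((m * s : ℝ) : ℂ) by push_cast; rfl, norm_e_ofReal])
      · refine ContinuousOn.add ?_ (continuousOn_const.mul ?_)
        · exact fun t _ => ((hC.continuousAt _ (hmem t)).comp (f := fun t : ℝ => (x : ℂ) + Complex.I * t)
            (by fun_prop)).continuousWithinAt
        · refine (continuousOn_tsum_signErr_mul_e hy s 1).comp (f := fun t : ℝ => (x : ℂ) + Complex.I * t)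
            (by fun_prop) fun t ht => ?_
          simp only [mem_ofPred_eq]
          simpa [abs_le] using ⟨by linarith [ht.1], ht.2⟩
    have := key (left_mem_Icc.mpr zero_le_one)
    simpa using this
  · exact hC.completion_of_im_pos hy h

/-! ### The two kernels -/

lemma sin_pi_mul_ne_zero {v : ℂ} (hv : ∀ m : ℤ, v ≠ m) : Complex.sin (Real.pi * v) ≠ 0 := by
  rw [Complex.sin_ne_zero_iff]
  intro k h
  refine hv k ?_
  have : (Real.pi : ℂ) ≠ 0 := by exact_mod_cast Real.pi_ne_zero
  rw [mul_comm] at h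
  exact mul_right_cancel₀ this h

lemma ne_int_of_im_ne_zero {v : ℂ} (hv : v.im ≠ 0) (m : ℤ) : v ≠ m := by
  rintro rfl; simp at hv

lemma e_sub_one_eq (v : ℂ) : e v - 1 = 2 * Complex.I * Complex.sin (Real.pi * v) * e (v / 2) := by
  have h1 : e v = Complex.exp (Real.pi * v * Complex.I) ^ 2 := by
    rw [e, ← Complex.exp_nat_mul]; congr 1; push_cast; ring
  have h2 : e (v / 2) = Complex.exp (Real.pi * v * Complex.I) := by rw [e]; congr 1; ring
  have h3 : Complex.exp (-(Real.pi * v) * Complex.I) * Complex.exp (Real.pi * v * Complex.I) = 1 := by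
    rw [← Complex.exp_add]; simp
  rw [h1, h2, Complex.sin]
  linear_combination h3 - (Complex.exp (-(Real.pi * v) * Complex.I) -
    Complex.exp (Real.pi * v * Complex.I)) * Complex.exp (Real.pi * v * Complex.I) * Complex.I_sq 

lemma e_add_one_eq (v : ℂ) : e v + 1 = 2 * Complex.cos (Real.pi * v) * e (v / 2) := by
  have h1 : e v = Complex.exp (Real.pi * v * Complex.I) ^ 2 := by
    rw [e, ← Complex.exp_nat_mul]; congr 1; push_cast; ring
  have h2 : e (v / 2) = Complex.exp (Real.pi * v * Complex.I) := by rw [e]; congr 1; ring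
  have h3 : Complex.exp (-(Real.pi * v) * Complex.I) * Complex.exp (Real.pi * v * Complex.I) = 1 := by
    rw [← Complex.exp_add]; simp
  rw [h1, h2, Complex.cos]
  linear_combination (-1 : ℂ) * h3

lemma one_add_e_div_one_sub_e (v : ℂ) (hv : ∀ m : ℤ, v ≠ m) :
    (1 + e v) / (1 - e v) = Complex.I * Complex.cot (Real.pi * v) := by
  have hs := sin_pi_mul_ne_zero hv
  have h1 := e_sub_one_eq v
  have h2 := e_add_one_eq v
  have he := e_ne_zero (v / 2)
  have h3 : 1 - e v ≠ 0 := by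
    rw [← neg_sub, h1]
    simp [hs, he]
  rw [div_eq_iff h3, Complex.cot]
  field_simp
  linear_combination Complex.sin (Real.pi * v) * h2 - Complex.I * Complex.cos (Real.pi * v) * (-1) * h1 +
    2 * Complex.cos (Real.pi * v) * e (v / 2) * Complex.sin (Real.pi * v) * Complex.I_sq

lemma norm_e_lt_one {v : ℂ} (hv : 0 < v.im) : ‖e v‖ < 1 := by
  rw [norm_e, Real.exp_lt_one_iff]
  have := Real.pi_pos
  nlinarith

lemma hasSum_int_of_nat_of_neg_zero {f : ℤ → ℂ} {a : ℂ} (h : HasSum (fun n : ℕ => f n) a)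
    (h0 : ∀ n : ℕ, f (-(n + 1 : ℕ)) = 0) : HasSum f a := by
  refine (Function.Injective.hasSum_iff (g := fun n : ℕ => (n : ℤ)) Nat.cast_injective
    (fun x hx => ?_)).mp h
  rcases Int.eq_nat_or_neg x with ⟨n, rfl | rfl⟩
  · exact absurd ⟨n, rfl⟩ hx
  · rcases n with _ | n
    · exact absurd ⟨0, by simp⟩ hx
    · exact h0 n

/-- The convention `sgn 0 = 0` gives the term `n = 0` half the weight of those with `n > 0`, so the
series is `1 + 2 ∑ e(n v) = (1 + e(v)) / (1 - e(v))`, with `n ≥ 1`. -/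
lemma isSignKernel_cot : IsSignKernel 0 fun v => Complex.cot (Real.pi * v) where
  two_mul := ⟨0, by simp⟩
  hasSum v hv := by
    have hn := norm_e_lt_one hv
    have h1e := one_sub_ne_zero_of_norm_lt hn
    rw [← one_add_e_div_one_sub_e v (ne_int_of_im_ne_zero hv.ne')]
    refine hasSum_int_of_nat_of_neg_zero ?_ fun n => ?_
    · rw [← hasSum_nat_add_iff' 1]
      have h := ((hasSum_geometric_of_norm_lt_one hn).mul_left (2 * e v))
      have h2 : 2 * e v * (1 - e v)⁻¹ = (1 + e v) / (1 - e v) - ∑ i ∈ Finset.range 1,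
          ((1 + Real.sign (0 + ((i : ℤ) : ℝ)) : ℝ) : ℂ) * e (((0 : ℝ) + ((i : ℤ) : ℂ)) * v) := by
        simp only [Finset.range_one, Finset.sum_singleton]
        have : e 0 = 1 := by simp [e]
        simp [this]
        field_simp
        ring
      rw [← h2]
      refine h.congr_fun fun n => ?_
      have hp : (0 : ℝ) < 0 + (((n + 1 : ℕ) : ℤ) : ℝ) := by push_cast; positivity
      rw [Real.sign_of_pos hp, mul_assoc, ← pow_succ', ← zpow_natCast, e_zpow]
      push_cast
      norm_num
    · have hp : (0 : ℝ) + ((-(n + 1 : ℕ) : ℤ) : ℝ) < 0 := by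
        push_cast
        have : (0 : ℝ) ≤ n := n.cast_nonneg
        linarith
      rw [Real.sign_of_neg hp]
      simp
  odd v := by rw [mul_neg, Complex.cot, Complex.cot, Complex.cos_neg, Complex.sin_neg, div_neg]
  continuousAt v hv := by
    unfold Complex.cot
    exact ContinuousAt.div (by fun_prop) (by fun_prop) (sin_pi_mul_ne_zero hv)

lemma isSignKernel_csc : IsSignKernel (1 / 2) fun v => 1 / Complex.sin (Real.pi * v) where
  two_mul := ⟨1, by norm_num⟩
  hasSum v hv := by
    have hn := norm_e_lt_one hv
    have h1e := one_sub_ne_zero_of_norm_lt hn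
    have hs := sin_pi_mul_ne_zero (ne_int_of_im_ne_zero hv.ne')
    refine hasSum_int_of_nat_of_neg_zero ?_ fun n => ?_
    · have h := ((hasSum_geometric_of_norm_lt_one hn).mul_left (2 * e (v / 2)))
      have h2 : 2 * e (v / 2) * (1 - e v)⁻¹ = Complex.I * (1 / Complex.sin (Real.pi * v)) := by
        rw [← neg_sub, e_sub_one_eq]
        have he := e_ne_zero (v / 2)
        field_simp
        rw [Complex.I_sq, mul_comm v]
        ring
      rw [← h2]
      refine h.congr_fun fun n => ?_
      have hp : (0 : ℝ) < 1 / 2 + ((n : ℤ) : ℝ) := by push_cast; positivity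
      rw [Real.sign_of_pos hp, mul_assoc, ← zpow_natCast, e_zpow, ← e_add]
      push_cast
      congr 1
      · norm_num
      · congr 1; ring
    · have hp : (1 / 2 : ℝ) + ((-(n + 1 : ℕ) : ℤ) : ℝ) < 0 := by
        push_cast
        have : (0 : ℝ) ≤ n := n.cast_nonneg
        linarith
      rw [Real.sign_of_neg hp]
      simp
  odd v := by rw [mul_neg, Complex.sin_neg, div_neg]
  continuousAt v hv :=
    ContinuousAt.div (by fun_prop) (by fun_prop) (sin_pi_mul_ne_zero hv)

end OverpartitionRank

/-! ### Error functions as period integrals of unary theta series. -/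

namespace OverpartitionRank

open Filter Topology Set MeasureTheory

/-! ### Period integrals of unary theta series -/

/-- Along the vertical path `-i (τ + z)` is the positive real number `2 Im z + t`, so no branch
question arises. -/
lemma sqrt_factor (z : ℂ) (hz : 0 < z.im) {t : ℝ} (ht : 0 ≤ t) :
    (-Complex.I * ((-(starRingEnd ℂ z) + Complex.I * t) + z)) ^ (1 / 2 : ℂ) =
      (√(2 * z.im + t) : ℂ) := by
  have h1 : -Complex.I * ((-(starRingEnd ℂ z) + Complex.I * t) + z) = ((2 * z.im + t : ℝ) : ℂ) := by
    apply Complex.ext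
    · simp
      ring
    · simp
  rw [h1, Real.sqrt_eq_rpow, Complex.ofReal_cpow (by positivity)]
  push_cast
  rfl

lemma periodIntegral_eq (g : ℂ → ℂ) {z : ℂ} (hz : 0 < z.im) :
    periodIntegral g z = Complex.I * ∫ t in Ioi (0 : ℝ),
      g (-(starRingEnd ℂ z) + Complex.I * t) / (√(2 * z.im + t) : ℂ) := by
  rw [periodIntegral, ← integral_const_mul]
  refine setIntegral_congr_fun measurableSet_Ioi fun t ht => ?_
  rw [sqrt_factor z hz (le_of_lt ht), mul_comm]

lemma periodIntegral_const_mul (a : ℂ) (g : ℂ → ℂ) (z : ℂ) :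
    periodIntegral (fun τ => a * g τ) z = a * periodIntegral g z := by
  rw [periodIntegral, periodIntegral, ← integral_const_mul]
  congr 1
  ext t
  ring

lemma periodIntegral_congr {f g : ℂ → ℂ} (h : ∀ τ : ℂ, 0 < τ.im → f τ = g τ) {z : ℂ}
    (hz : 0 < z.im) : periodIntegral f z = periodIntegral g z := by
  rw [periodIntegral, periodIntegral]
  refine setIntegral_congr_fun measurableSet_Ioi fun t ht => ?_
  have ht0 : (0 : ℝ) < t := ht
  rw [h]
  simp
  linarith

/-- The antiderivative behind the period integral: the substitution `x = l √((2 y + t) / (2 y))`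
turns its integrand into a Gaussian, and `t = 0` corresponds to `x = l`. -/
lemma hasDerivAt_errInt_sqrt {y l : ℝ} (hy : 0 < y) (hl : 0 < l) {t : ℝ} (ht : 0 ≤ t) :
    HasDerivAt (fun t : ℝ => -(√2 / l) * errInt y (-(l / √(2 * y) * √(2 * y + t))))
      (Real.exp (-(Real.pi / 2 * l ^ 2) * (2 * y + t)) / √(2 * y + t)) t := by
  have hpos : 0 < 2 * y + t := by positivity
  have h1 : HasDerivAt (fun t : ℝ => -(l / √(2 * y) * √(2 * y + t)))
      (-(l / √(2 * y) * (1 / (2 * √(2 * y + t))))) t :=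
    (((hasDerivAt_id t).const_add (2 * y)).sqrt hpos.ne').const_mul (l / √(2 * y)) |>.neg
  have h2 := ((hasDerivAt_errInt hy _).comp t h1).const_mul (-(√2 / l))
  have hs2 : √(2 * y) = √2 * √y := Real.sqrt_mul zero_le_two y
  have hsy : 0 < √y := Real.sqrt_pos.mpr hy
  have hs : (0 : ℝ) < √2 := by positivity
  have hst : 0 < √(2 * y + t) := Real.sqrt_pos.mpr hpos
  convert! h2 using 1
  have h3 : -(Real.pi * y) * (-(l / √(2 * y) * √(2 * y + t))) ^ 2 =
      -(Real.pi / 2 * l ^ 2) * (2 * y + t) := by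
    rw [neg_sq, mul_pow, div_pow, Real.sq_sqrt (by positivity), Real.sq_sqrt hpos.le]
    field_simp
  rw [h3, hs2]
  field_simp

lemma tendsto_errInt_sqrt {y l : ℝ} (hy : 0 < y) (hl : 0 < l) :
    Tendsto (fun t : ℝ => -(√2 / l) * errInt y (-(l / √(2 * y) * √(2 * y + t)))) atTop (𝓝 0) := by
  have h1 : Tendsto (fun t : ℝ => 2 * y + t) atTop atTop := tendsto_atTop_add_const_left _ _ tendsto_id
  have h2 : Tendsto (fun t : ℝ => 2 * Real.exp (-(Real.pi / 2 * l ^ 2) * (2 * y + t))) atTop (𝓝 0) := by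
    rw [← mul_zero (2 : ℝ)]
    refine (Real.tendsto_exp_atBot.comp (h1.const_mul_atTop_of_neg ?_)).const_mul 2
    have : 0 < Real.pi / 2 * l ^ 2 := by positivity
    linarith
  rw [← mul_zero (-(√2 / l))]
  refine Tendsto.const_mul _ (squeeze_zero' (Eventually.of_forall fun t => errInt_nonneg _) ?_ h2)
  filter_upwards [eventually_ge_atTop 0] with t ht
  have hpos : 0 < 2 * y + t := by positivity
  have h := errInt_neg_le hy (t := l / √(2 * y) * √(2 * y + t)) (by positivity)
  have h3 : -(Real.pi * y) * (l / √(2 * y) * √(2 * y + t)) ^ 2 =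
      -(Real.pi / 2 * l ^ 2) * (2 * y + t) := by
    rw [mul_pow, div_pow, Real.sq_sqrt (by positivity), Real.sq_sqrt hpos.le]
    field_simp
  rwa [h3] at h

lemma integral_exp_div_sqrt {y l : ℝ} (hy : 0 < y) (hl : 0 < l) :
    IntegrableOn (fun t : ℝ => Real.exp (-(Real.pi / 2 * l ^ 2) * (2 * y + t)) / √(2 * y + t)) (Ioi 0) ∧
    ∫ t in Ioi (0 : ℝ), Real.exp (-(Real.pi / 2 * l ^ 2) * (2 * y + t)) / √(2 * y + t) =
      √2 / l * errInt y (-l) := by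
  have hd : ∀ t ∈ Ici (0 : ℝ), _ := fun t ht => hasDerivAt_errInt_sqrt hy hl (t := t) ht
  have hp : ∀ t ∈ Ioi (0 : ℝ),
      0 ≤ Real.exp (-(Real.pi / 2 * l ^ 2) * (2 * y + t)) / √(2 * y + t) := fun t _ => by positivity
  refine ⟨integrableOn_Ioi_deriv_of_nonneg' hd hp (tendsto_errInt_sqrt hy hl), ?_⟩
  rw [integral_Ioi_of_hasDerivAt_of_nonneg' hd hp (tendsto_errInt_sqrt hy hl), add_zero]
  have : √(2 * y) ≠ 0 := (Real.sqrt_pos.mpr (by positivity)).ne'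
  rw [div_mul_cancel₀ _ this]
  ring

lemma e_period_path (l : ℝ) (z : ℂ) (t : ℝ) :
    e ((l : ℂ) ^ 2 / 4 * (-(starRingEnd ℂ z) + Complex.I * t)) =
      e (-((l : ℂ) ^ 2 * z / 4)) * (Real.exp (-(Real.pi / 2 * l ^ 2) * (2 * z.im + t)) : ℂ) := by
  have h : -(starRingEnd ℂ z) + Complex.I * t = -z + Complex.I * ((2 * z.im + t : ℝ) : ℂ) := by
    apply Complex.ext
    · simp
    · simp; ring
  rw [h, mul_add, e_add]
  congr 1
  · congr 1; ring
  · rw [e]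
    push_cast
    congr 1
    linear_combination (2 * Real.pi * (l : ℂ) ^ 2 / 4 * (2 * z.im + t)) * Complex.I_sq

/-- On the path `τ = -z + i (2 Im z + t)`, so `e(l² τ / 4)` splits into `e(-l² z / 4)` and a real
exponential whose integral is an error function. The sign of `l` restores `l` from `|l|`; for `l =
0` both sides vanish. -/
lemma signErr_mul_e {l : ℝ} {z : ℂ} (hz : 0 < z.im) :
    (signErr z.im l : ℂ) * e (-((l : ℂ) ^ 2 * z / 4)) =
      -Complex.I * √2 * ((l : ℂ) / 2) * periodIntegral (fun τ => e ((l : ℂ) ^ 2 / 4 * τ)) z := by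
  rcases eq_or_ne l 0 with rfl | hl
  · simp [signErr]
  have hl' : 0 < |l| := abs_pos.mpr hl
  rw [periodIntegral_eq _ hz]
  have h1 : ∀ t : ℝ, e ((l : ℂ) ^ 2 / 4 * (-(starRingEnd ℂ z) + Complex.I * t)) / (√(2 * z.im + t) : ℂ) =
      e (-((l : ℂ) ^ 2 * z / 4)) *
        ((Real.exp (-(Real.pi / 2 * |l| ^ 2) * (2 * z.im + t)) / √(2 * z.im + t) : ℝ) : ℂ) := fun t => by
    rw [e_period_path, sq_abs]
    push_cast
    ring
  simp only [h1]
  rw [integral_const_mul, integral_complex_ofReal, (integral_exp_div_sqrt hz hl').2, signErr]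
  have h2 : (√2 : ℂ) ^ 2 = 2 := by
    rw [← Complex.ofReal_pow, Real.sq_sqrt zero_le_two]; simp
  have h3 : Real.sign l * |l| = l := by
    rcases hl.lt_or_gt with h | h
    · rw [Real.sign_of_neg h, abs_of_neg h]; ring
    · rw [Real.sign_of_pos h, abs_of_pos h]; ring
  have h3' : (Real.sign l : ℂ) * (|l| : ℝ) = l := by exact_mod_cast h3
  have h4 : ((|l| : ℝ) : ℂ) ≠ 0 := by exact_mod_cast hl'.ne'
  push_cast
  field_simp
  rw [h2, Complex.I_sq]
  linear_combination (2 * (errInt z.im (-|l|) : ℂ) * e (-((l : ℂ) ^ 2 * z / 4))) * h3'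

/-- The unary theta series `∑ c(l) (λ / 2) e(λ x) e(λ² τ / 4)`, `λ = s + l`. -/
noncomputable def thetaSeries (s x : ℝ) (c : ℤ → ℂ) (τ : ℂ) : ℂ :=
  ∑' l : ℤ, c l * ((s + l) / 2) * e ((s + l) * x) * e (((s + l : ℝ) : ℂ) ^ 2 / 4 * τ)

lemma norm_thetaSeries_term_le {s x : ℝ} {c : ℤ → ℂ} (hc : ∀ l, ‖c l‖ ≤ 1) (l : ℤ) (τ : ℂ) :
    ‖c l * ((s + l) / 2) * e ((s + l) * x) * e (((s + l : ℝ) : ℂ) ^ 2 / 4 * τ)‖ ≤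
      |s + l| / 2 * Real.exp (-(Real.pi / 2) * (s + l) ^ 2 * τ.im) := by
  have h1 : ‖((s : ℂ) + l) / 2‖ = |s + l| / 2 := by
    rw [show ((s : ℂ) + l) / 2 = ((((s + l) / 2 : ℝ)) : ℂ) by push_cast; rfl, Complex.norm_real,
      Real.norm_eq_abs, abs_div, abs_of_pos (zero_lt_two' ℝ)]
  have h2 : ‖e (((s : ℂ) + l) * x)‖ = 1 := by
    rw [show ((s : ℂ) + l) * x = (((s + l) * x : ℝ) : ℂ) by push_cast; rfl, norm_e_ofReal]
  have h3 : ‖e (((s + l : ℝ) : ℂ) ^ 2 / 4 * τ)‖ = Real.exp (-(Real.pi / 2) * (s + l) ^ 2 * τ.im) := by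
    rw [norm_e, show ((s + l : ℝ) : ℂ) ^ 2 / 4 * τ = (((s + l) ^ 2 / 4 : ℝ) : ℂ) * τ by push_cast; rfl,
      Complex.im_ofReal_mul]
    congr 1; ring
  rw [norm_mul, norm_mul, norm_mul, h1, h2, h3, mul_one]
  gcongr
  exact mul_le_of_le_one_left (by positivity) (hc l)

lemma summable_abs_mul_gaussian {a : ℝ} (ha : 0 < a) (s : ℝ) :
    Summable fun l : ℤ => |s + l| / 2 * Real.exp (-a * (s + l) ^ 2) := by
  refine Summable.of_nonneg_of_le (fun l => by positivity) (fun l => ?_) (summable_gaussian_exp ha 1 s)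
  rw [Real.exp_add, one_mul, mul_comm]
  gcongr
  have := Real.add_one_le_exp |s + l|
  linarith [abs_nonneg (s + (l : ℝ))]

lemma half_le_abs_of_two_mul {s : ℝ} (hs : ∃ k : ℤ, 2 * s = k) (l : ℤ) (h : s + l ≠ 0) :
    1 / 2 ≤ |s + l| := by
  obtain ⟨k, hk⟩ := hs
  have h1 : s + l = ((k + 2 * l : ℤ) : ℝ) / 2 := by push_cast; rw [← hk]; ring
  have h2 : k + 2 * l ≠ 0 := by rintro h0; rw [h1, h0] at h; simp at h
  rw [h1, abs_div, abs_of_pos (zero_lt_two' ℝ), ← Int.cast_abs]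
  have : (1 : ℝ) ≤ (|k + 2 * l| : ℤ) := by exact_mod_cast Int.one_le_abs h2
  linarith

lemma differentiableOn_thetaSeries {s x : ℝ} {c : ℤ → ℂ} (hc : ∀ l, ‖c l‖ ≤ 1) :
    DifferentiableOn ℂ (thetaSeries s x c) upperHalf := by
  intro τ hτ
  have hτ' : 0 < τ.im := hτ
  have hopen : IsOpen {w : ℂ | τ.im / 2 < w.im} := isOpen_lt continuous_const Complex.continuous_im
  have h := Complex.differentiableOn_tsum_of_summable_norm
    (F := fun (l : ℤ) τ => c l * ((s + l) / 2) * e ((s + l) * x) * e (((s + l : ℝ) : ℂ) ^ 2 / 4 * τ))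
    (summable_abs_mul_gaussian (a := Real.pi / 2 * (τ.im / 2)) (by positivity) s)
    (fun l => by unfold e; fun_prop) hopen fun l w hw => ?_
  · exact ((h τ (by simp; linarith)).differentiableAt
      (hopen.mem_nhds (by simp; linarith))).differentiableWithinAt
  · refine (norm_thetaSeries_term_le hc l w).trans ?_
    have hw' : τ.im / 2 < w.im := hw
    refine mul_le_mul_of_nonneg_left (Real.exp_le_exp.mpr ?_) (by positivity)
    have h2 : 0 ≤ Real.pi / 2 * (s + l) ^ 2 := by positivity
    nlinarith

/-- The frequency 0 is killed by the factor `λ / 2`, and every other `λ` has `|λ| ≥ 1/2` because `2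
s` is an integer. The rate `π / 8` is `(π / 2) (1/2)²`. -/
lemma thetaSeries_decay {s x : ℝ} (hs : ∃ k : ℤ, 2 * s = k) {c : ℤ → ℂ} (hc : ∀ l, ‖c l‖ ≤ 1) :
    ∃ K ε : ℝ, 0 < ε ∧ ∀ τ : ℂ, 1 ≤ τ.im → ‖thetaSeries s x c τ‖ ≤ K * Real.exp (-ε * τ.im) := by
  have hsum := summable_abs_mul_gaussian (a := Real.pi / 2) (by positivity) s
  refine ⟨(∑' l : ℤ, |s + l| / 2 * Real.exp (-(Real.pi / 2) * (s + l) ^ 2)) * Real.exp (Real.pi / 8),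
    Real.pi / 8, by positivity, fun τ hτ => ?_⟩
  rw [mul_assoc, ← Real.exp_add, ← tsum_mul_right]
  refine tsum_of_norm_bounded (hsum.mul_right _).hasSum fun l => ?_
  refine (norm_thetaSeries_term_le hc l τ).trans ?_
  rw [mul_assoc _ (Real.exp _), ← Real.exp_add]
  rcases eq_or_ne (s + l) 0 with h0 | h0
  · simp [h0]
  have h1 := half_le_abs_of_two_mul hs l h0
  have h2 : 1 / 4 ≤ (s + l) ^ 2 := by rw [← sq_abs]; nlinarith
  gcongr
  have := Real.pi_pos
  have h3 : 0 ≤ (Real.pi / 2) * (((s + l) ^ 2 - 1 / 4) * (τ.im - 1)) :=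
    mul_nonneg (by positivity) (mul_nonneg (by linarith) (by linarith))
  nlinarith

lemma hasSum_periodIntegral_thetaSeries {s x : ℝ} (hs : ∃ k : ℤ, 2 * s = k) {c : ℤ → ℂ}
    (hc : ∀ l, ‖c l‖ ≤ 1) {z : ℂ} (hz : 0 < z.im) :
    HasSum (fun l : ℤ => c l * ((s + l) / 2) * e ((s + l) * x) *
        periodIntegral (fun τ => e (((s + l : ℝ) : ℂ) ^ 2 / 4 * τ)) z)
      (periodIntegral (thetaSeries s x c) z) := by
  set b : ℤ → ℂ := fun l => c l * ((s + l) / 2) * e ((s + l) * x) with hb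
  set F : ℤ → ℝ → ℂ := fun l t => b l * (e (((s + l : ℝ) : ℂ) ^ 2 / 4 *
    (-(starRingEnd ℂ z) + Complex.I * t)) / (√(2 * z.im + t) : ℂ)) with hF
  have hbz : ∀ l : ℤ, s + l = 0 → b l = 0 := fun l h => by
    have : (s : ℂ) + l = 0 := by exact_mod_cast h
    rw [hb]; simp [this]
  have hbn : ∀ l : ℤ, ‖b l‖ ≤ |s + l| / 2 := fun l => by
    have h := norm_thetaSeries_term_le (s := s) (x := x) hc l 0
    have h0 : e 0 = 1 := by simp [e]
    simpa [hb, h0] using h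
  -- The Gaussian at height `z.im + t` is split: the part at `z.im` is summable in `l`, and `λ² ≥
  -- 1/4` leaves `exp (-π t / 8)`, integrable in `t` uniformly in `l`.
  have hFn : ∀ l : ℤ, ∀ t ∈ Ioi (0 : ℝ), ‖F l t‖ ≤ |s + l| / 2 *
      Real.exp (-(Real.pi / 2 * z.im) * (s + l) ^ 2) / √(2 * z.im) *
        Real.exp (-(Real.pi / 8) * t) := fun l t ht => by
    have ht0 : (0 : ℝ) < t := ht
    rcases eq_or_ne (s + l) 0 with h0 | h0
    · simp [hF, hbz l h0, h0]
    have h1 := half_le_abs_of_two_mul hs l h0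
    have h2 : 1 / 4 ≤ (s + l) ^ 2 := by rw [← sq_abs]; nlinarith
    have h3 : ‖F l t‖ = ‖b l‖ * (Real.exp (-(Real.pi / 2) * (s + l) ^ 2 * (z.im + t)) / √(2 * z.im + t)) := by
      rw [hF]
      simp only
      rw [norm_mul, norm_div, norm_e, Complex.norm_real, Real.norm_of_nonneg (Real.sqrt_nonneg _),
        show ((s + l : ℝ) : ℂ) ^ 2 / 4 = (((s + l) ^ 2 / 4 : ℝ) : ℂ) by push_cast; rfl,
        Complex.im_ofReal_mul]
      congr 3
      simp
      ring
    rw [h3, mul_div_assoc (|s + l| / 2), mul_assoc (|s + l| / 2), div_mul_eq_mul_div (Real.exp _), ← Real.exp_add]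
    refine mul_le_mul (hbn l) ?_ (by positivity) (by positivity)
    refine div_le_div₀ (Real.exp_pos _).le (Real.exp_le_exp.mpr ?_) (Real.sqrt_pos.mpr (by positivity))
      (Real.sqrt_le_sqrt (by linarith))
    have h4 : 0 ≤ Real.pi / 2 * (((s + l) ^ 2 - 1 / 4) * t) :=
      mul_nonneg (by positivity) (mul_nonneg (by linarith) ht0.le)
    nlinarith
  have hexp : IntegrableOn (fun t : ℝ => Real.exp (-(Real.pi / 8) * t)) (Ioi 0) :=
    exp_neg_integrableOn_Ioi 0 (by positivity)
  have hFi : ∀ l, IntegrableOn (F l) (Ioi 0) := fun l => by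
    refine Integrable.mono' (hexp.const_mul _) ?_ ((ae_restrict_mem measurableSet_Ioi).mono fun t ht => hFn l t ht)
    refine Measurable.aestronglyMeasurable ?_
    have := continuous_e
    have h1 : Continuous fun t : ℝ => e (((s + l : ℝ) : ℂ) ^ 2 / 4 *
      (-(starRingEnd ℂ z) + Complex.I * t)) := by fun_prop
    have h2 : Continuous fun t : ℝ => (√(2 * z.im + t) : ℂ) := by fun_prop
    exact (h1.measurable.div h2.measurable).const_mul _
  have hsumN : Summable fun l => ∫ t in Ioi (0 : ℝ), ‖F l t‖ := by
    have h1 := ((summable_abs_mul_gaussian (a := Real.pi / 2 * z.im) (by positivity) s).div_const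
      (√(2 * z.im))).mul_right (∫ t in Ioi (0 : ℝ), Real.exp (-(Real.pi / 8) * t))
    refine Summable.of_nonneg_of_le (fun l => integral_nonneg fun t => norm_nonneg _) (fun l => ?_) h1
    rw [← integral_const_mul]
    exact setIntegral_mono_on (hFi l).norm (hexp.const_mul _) measurableSet_Ioi (hFn l)
  have h := (hasSum_integral_of_summable_integral_norm hFi hsumN).mul_left Complex.I
  convert! h using 1
  · funext l
    rw [periodIntegral_eq _ hz, hF]
    simp only
    rw [integral_const_mul]
    ring
  · rw [periodIntegral_eq _ hz]
    congr 1
    refine setIntegral_congr_fun measurableSet_Ioi fun t _ => ?_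
    simp only [thetaSeries, hF, hb]
    rw [← tsum_div_const]
    refine tsum_congr fun l => ?_
    ring

end OverpartitionRank

/-! ### The regularised lattice sum as Appell sum plus period integral. -/

namespace OverpartitionRank

open Filter Topology Set

/-! ### Gaussian lattice sums with a pole -/

/-- `e(-n x) exp (-π |w|² / y) / w` with `w = x + m + n z`, `y = Im z`. -/
noncomputable def latTerm (x : ℝ) (z : ℂ) (n m : ℤ) : ℂ :=
  e (-(n * x)) * (Real.exp (-(Real.pi / z.im) * Complex.normSq (x + m + n * z)) : ℂ) /
    (x + m + n * z)

/-- `π⁻¹ ∑ ε(n, m) e(-n x) exp (-π |w|² / y) / w`, `w = x + m + n z`. -/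
noncomputable def latSum (ε : ℤ × ℤ → ℂ) (x : ℝ) (z : ℂ) : ℂ :=
  1 / Real.pi * ∑' p : ℤ × ℤ, ε p * latTerm x z p.1 p.2

lemma add_mul_ne_int {x : ℝ} (hx : ∀ m : ℤ, x ≠ m) {z : ℂ} (hz : 0 < z.im) (n m : ℤ) :
    (x : ℂ) + n * z ≠ m := by
  intro h
  have him := congrArg Complex.im h
  simp at him
  rcases him with h0 | h0
  · rw [h0] at h
    simp at h
    exact hx m (by exact_mod_cast h)
  · exact hz.ne' h0

lemma exists_pos_le_norm {x : ℝ} (hx : ∀ m : ℤ, x ≠ m) {z : ℂ} (hz : 0 < z.im) :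
    ∃ d : ℝ, 0 < d ∧ ∀ n m : ℤ, d ≤ ‖(x : ℂ) + m + n * z‖ := by
  refine ⟨min |x - round x| z.im, lt_min (abs_pos.mpr (sub_ne_zero.mpr (hx _))) hz, fun n m => ?_⟩
  rcases eq_or_ne n 0 with rfl | hn
  · refine (min_le_left _ _).trans ?_
    have h2 := round_le x (-m)
    push_cast at h2
    rw [sub_neg_eq_add] at h2
    refine h2.trans ?_
    rw [Int.cast_zero, zero_mul, add_zero, ← Real.norm_eq_abs, ← Complex.norm_real]
    push_cast
    rfl
  · refine (min_le_right _ _).trans ?_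
    have h1 := Complex.abs_im_le_norm ((x : ℂ) + m + n * z)
    have h2 : ((x : ℂ) + m + n * z).im = n * z.im := by simp
    rw [h2, abs_mul, abs_of_pos hz] at h1
    have h3 : (1 : ℝ) ≤ |(n : ℝ)| := by
      rw [← Int.cast_abs]; exact_mod_cast Int.one_le_abs hn
    nlinarith

/-- Positive definiteness of `|m + n z|²` with an explicit constant; the term `4 x²` absorbs the
translation by `x`. -/
lemma le_normSq_add_mul (x : ℝ) {z : ℂ} (hz : 0 < z.im) :
    ∃ K : ℝ, 0 < K ∧ ∀ n m : ℤ,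
      ((m : ℝ) ^ 2 + (n : ℝ) ^ 2 - 4 * x ^ 2) / K ≤ Complex.normSq (x + m + n * z) := by
  have hK : 0 < 4 + (2 * z.re ^ 2 + 1) / z.im ^ 2 := by positivity
  refine ⟨_, hK, fun n m => ?_⟩
  rw [div_le_iff₀ hK, Complex.normSq_apply]
  have hre : ((x : ℂ) + m + n * z).re = x + m + n * z.re := by simp
  have him : ((x : ℂ) + m + n * z).im = n * z.im := by simp
  rw [hre, him]
  set r := z.re
  set y := z.im
  have h1 : n * y * (n * y) * ((2 * r ^ 2 + 1) / y ^ 2) = (2 * r ^ 2 + 1) * n ^ 2 := by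
    field_simp
  have h2 : 0 ≤ (x + m + n * r) * (x + m + n * r) * ((2 * r ^ 2 + 1) / y ^ 2) := by
    have := mul_self_nonneg (x + m + n * r)
    positivity
  have h3 : 0 ≤ n * y * (n * y) := mul_self_nonneg _
  nlinarith [sq_nonneg (m + 2 * n * r), sq_nonneg (m + 2 * x + n * r)]

lemma summable_gaussian_prod {a : ℝ} (ha : 0 < a) (s : ℝ) :
    Summable fun p : ℤ × ℤ => Real.exp (-a * ((p.1 : ℝ) ^ 2 + (s + p.2) ^ 2)) := by
  have h := (summable_gaussian ha 0).mul_of_nonneg (summable_gaussian ha s)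
    (fun _ => (Real.exp_pos _).le) (fun _ => (Real.exp_pos _).le)
  refine h.congr fun p => ?_
  rw [← Real.exp_add, zero_add]
  congr 1; ring

lemma norm_latTerm (x : ℝ) (z : ℂ) (n m : ℤ) :
    ‖latTerm x z n m‖ = Real.exp (-(Real.pi / z.im) * Complex.normSq (x + m + n * z)) /
      ‖(x : ℂ) + m + n * z‖ := by
  rw [latTerm, norm_div, norm_mul, Complex.norm_real, Real.norm_of_nonneg (Real.exp_pos _).le,
    show (-(n * x) : ℂ) = ((-(n * x) : ℝ) : ℂ) by push_cast; rfl, norm_e_ofReal, one_mul]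

lemma summable_latTerm {x : ℝ} (hx : ∀ m : ℤ, x ≠ m) {z : ℂ} (hz : 0 < z.im) {ε : ℤ × ℤ → ℂ}
    (hε : ∀ p, ‖ε p‖ = 1) : Summable fun p : ℤ × ℤ => ε p * latTerm x z p.1 p.2 := by
  obtain ⟨d, hd, hdle⟩ := exists_pos_le_norm hx hz
  obtain ⟨K, hK, hKle⟩ := le_normSq_add_mul x hz
  refine Summable.of_norm_bounded
    ((summable_gaussian_prod (a := Real.pi / z.im / K) (by positivity) 0).mul_left
      (Real.exp (Real.pi / z.im / K * (4 * x ^ 2)) / d)) fun p => ?_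
  rw [norm_mul, hε, one_mul, norm_latTerm, div_mul_eq_mul_div, ← Real.exp_add]
  refine div_le_div₀ (Real.exp_pos _).le (Real.exp_le_exp.mpr ?_) hd (hdle _ _)
  have h := mul_le_mul_of_nonneg_left (hKle p.1 p.2) (show 0 ≤ Real.pi / z.im by positivity)
  have h2 : Real.pi / z.im * (((p.2 : ℝ) ^ 2 + (p.1 : ℝ) ^ 2 - 4 * x ^ 2) / K) =
    Real.pi / z.im / K * ((p.1 : ℝ) ^ 2 + (0 + p.2) ^ 2) - Real.pi / z.im / K * (4 * x ^ 2) := by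
      ring
  linarith

/-- The conjugate of `w` is `w - 2 i n y`, so `exp (-π |w|² / y)` is `exp (-π w² / y)` times `e(n
w)`. The latter equals `e(n x) e(n² z)` because `e(n m) = 1`, and the prefactor `e(-n x)` removes
the dependence on `x`. -/
lemma latTerm_eq (x : ℝ) {z : ℂ} (hz : 0 < z.im) (n m : ℤ) :
    latTerm x z n m = e ((n : ℂ) ^ 2 * z) * gaussPole z.im (x + n * z + m) := by
  have hy : (z.im : ℂ) ≠ 0 := by exact_mod_cast hz.ne'
  rw [latTerm, gaussPole, show (x : ℂ) + n * z + m = x + m + n * z by ring, mul_div_assoc, mul_div_assoc',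
    mul_div_assoc']
  congr 1
  set w : ℂ := x + m + n * z with hw
  have h1 : (Complex.normSq w : ℂ) = w * (w - 2 * Complex.I * n * z.im) := by
    rw [Complex.normSq_eq_conj_mul_self, mul_comm]
    congr 1
    apply Complex.ext
    · simp [hw]
    · simp [hw]; ring
  rw [← mul_one (e ((n : ℂ) ^ 2 * z)), ← e_int (n * m), ← e_add, e, e, Complex.ofReal_exp,
    ← Complex.exp_add, ← Complex.exp_add]
  congr 1
  push_cast
  rw [h1]
  field_simp
  rw [hw]
  ring

/-- The family in the non-holomorphic part, summed over the theta variable `n` and `λ = s + l`. -/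
lemma summable_signErr_prod {s x : ℝ} {χ : ℤ → ℂ} (hχ : ∀ n, ‖χ n‖ = 1) {z : ℂ} (hz : 0 < z.im) :
    Summable fun p : ℤ × ℤ => χ p.1 * e ((p.1 : ℂ) ^ 2 * z) *
      ((signErr z.im (s + p.2) : ℂ) * e ((s + p.2) * (x + p.1 * z))) := by
  refine Summable.of_norm_bounded
    ((summable_gaussian_prod (a := Real.pi * z.im / 3) (by positivity) s).mul_left 2) fun p => ?_
  obtain ⟨n, l⟩ := p
  simp only
  have h1 : ((n : ℂ) ^ 2 * z).im = n ^ 2 * z.im := by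
    rw [show (n : ℂ) ^ 2 = ((n ^ 2 : ℝ) : ℂ) by push_cast; rfl, Complex.im_ofReal_mul]
  have h2 : (((s : ℂ) + l) * (x + n * z)).im = (s + l) * (n * z.im) := by
    rw [show (s : ℂ) + l = ((s + l : ℝ) : ℂ) by push_cast; rfl, Complex.im_ofReal_mul]
    simp
  rw [norm_mul, norm_mul, hχ, one_mul, norm_mul, norm_e, norm_e, h1, h2, Complex.norm_real,
    Real.norm_eq_abs]
  have h3 := abs_signErr_le hz (s + l)
  calc _ ≤ Real.exp (-(2 * Real.pi) * (n ^ 2 * z.im)) * (2 * Real.exp (-(Real.pi * z.im) * (s + l) ^ 2) *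
        Real.exp (-(2 * Real.pi) * ((s + l) * (n * z.im)))) := by gcongr
    _ = 2 * Real.exp (-(2 * Real.pi) * (n ^ 2 * z.im) + (-(Real.pi * z.im) * (s + l) ^ 2 +
        -(2 * Real.pi) * ((s + l) * (n * z.im)))) := by
      rw [Real.exp_add, Real.exp_add]; ring
    _ ≤ _ := by
      gcongr
      -- The exponent is `-π y (2 n² + 2 n λ + λ²)`, a definite form; removing `(n² + λ²) / 3`
      -- leaves this form, still nonnegative.
      have h4 : 0 ≤ Real.pi * z.im * (5 / 3 * n ^ 2 + 2 * n * (s + l) + 2 / 3 * (s + l) ^ 2) := by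
        refine mul_nonneg (by positivity) ?_
        nlinarith [sq_nonneg (5 / 3 * (n : ℝ) + (s + l)), sq_nonneg (s + l)]
      nlinarith

/-- The sum over `m` is the completed kernel at `x + n z`. In the error part the sum over `n` is
carried out first: by `hϑ` it is a fixed theta constant `ϑ` times `e(-λ² z / 4)`, exactly the factor
that makes `signErr` a period integral. The remaining sum over `l` is the unary theta series. -/
lemma latSum_eq {s : ℝ} {C : ℂ → ℂ} (hC : IsSignKernel s C) {χ c : ℤ → ℂ} (hχ : ∀ n, ‖χ n‖ = 1)
    (hc : ∀ l, ‖c l‖ ≤ 1) {x : ℝ} (hx : ∀ m : ℤ, x ≠ m) {z ϑ : ℂ} (hz : 0 < z.im)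
    (hϑ : ∀ l : ℤ, ∑' n : ℤ, χ n * e ((n : ℂ) ^ 2 * z + n * (s + l) * z) =
      c l * ϑ * e (-(((s + l : ℝ) : ℂ) ^ 2 * z / 4))) :
    (Summable fun n : ℤ => χ n * e ((n : ℂ) ^ 2 * z) * C (x + n * z)) ∧
    latSum (fun p => χ p.1 * e (p.2 * s)) x z =
      ∑' n : ℤ, χ n * e ((n : ℂ) ^ 2 * z) * C (x + n * z) +
        √2 * ϑ * periodIntegral (thetaSeries s x c) z := by
  have hε : ∀ p : ℤ × ℤ, ‖χ p.1 * e (p.2 * s)‖ = 1 := fun p => by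
    rw [norm_mul, hχ, one_mul, show (p.2 * s : ℂ) = ((p.2 * s : ℝ) : ℂ) by push_cast; rfl,
      norm_e_ofReal]
  have hS := summable_latTerm hx hz hε
  have hS2 := summable_signErr_prod (s := s) (x := x) hχ hz
  have hinner : ∀ n : ℤ, 1 / Real.pi * ∑' m : ℤ, χ n * e (m * s) * latTerm x z n m =
      χ n * e ((n : ℂ) ^ 2 * z) * C (x + n * z) + Complex.I * ∑' l : ℤ, χ n * e ((n : ℂ) ^ 2 * z) *
        ((signErr z.im (s + l) : ℂ) * e ((s + l) * (x + n * z))) := fun n => by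
    have h1 := hC.completion hz (add_mul_ne_int hx hz n)
    rw [tsum_mul_left (a := χ n * e ((n : ℂ) ^ 2 * z)), mul_left_comm Complex.I, ← mul_add, ← h1,
      mul_left_comm (χ n * _), ← tsum_mul_left (a := χ n * e ((n : ℂ) ^ 2 * z))]
    congr 1
    refine tsum_congr fun m => ?_
    rw [latTerm_eq x hz]
    ring
  have hsum1 : Summable fun n : ℤ => 1 / Real.pi * ∑' m : ℤ, χ n * e (m * s) * latTerm x z n m :=
    hS.prod.mul_left _
  have hsum2 : Summable fun n : ℤ => Complex.I * ∑' l : ℤ, χ n * e ((n : ℂ) ^ 2 * z) *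
        ((signErr z.im (s + l) : ℂ) * e ((s + l) * (x + n * z))) := hS2.prod.mul_left _
  have hsum3 : Summable fun n : ℤ => χ n * e ((n : ℂ) ^ 2 * z) * C (x + n * z) :=
    (hsum1.sub hsum2).congr fun n => by rw [hinner]; ring
  refine ⟨hsum3, ?_⟩
  rw [latSum, hS.tsum_prod, ← tsum_mul_left, tsum_congr hinner, hsum3.tsum_add hsum2]
  congr 1
  rw [tsum_mul_left, Summable.tsum_comm (f := fun l n : ℤ => χ n * e ((n : ℂ) ^ 2 * z) *
    ((signErr z.im (s + l) : ℂ) * e ((s + l) * (x + n * z)))) hS2.prod_symm]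
  rw [← (hasSum_periodIntegral_thetaSeries hC.two_mul hc hz).tsum_eq, ← tsum_mul_left, ← tsum_mul_left]
  refine tsum_congr fun l => ?_
  have h1 : ∀ n : ℤ, χ n * e ((n : ℂ) ^ 2 * z) *
      ((signErr z.im (s + l) : ℂ) * e ((s + l) * (x + n * z))) =
      (signErr z.im (s + l) : ℂ) * e ((s + l) * x) * (χ n * e ((n : ℂ) ^ 2 * z + n * (s + l) * z)) :=
    fun n => by
      rw [e_add, mul_add, e_add, show ((s : ℂ) + l) * (n * z) = n * (s + l) * z by ring]
      ring
  rw [tsum_congr h1, tsum_mul_left, hϑ]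
  have h2 := signErr_mul_e (l := s + l) hz
  push_cast at h2 ⊢
  linear_combination (Complex.I * e ((s + l) * x) * c l * ϑ) * h2 - (√2 * ϑ * c l * ((s + l) / 2) *
    e ((s + l) * x) * periodIntegral (fun τ => e (((s : ℂ) + l) ^ 2 / 4 * τ)) z) * Complex.I_sq

end OverpartitionRank

/-! ### The two theta constants and their transformation. -/

namespace OverpartitionRank

open ModularForm

/-! ### Theta functions as eta quotients -/

/-- `∑ e((n + 1/4)² z)`. -/
noncomputable def thetaQuarter (z : ℂ) : ℂ := ∑' n : ℤ, e (((n : ℂ) + 1 / 4) ^ 2 * z)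

lemma theta4_e (z : ℂ) : theta4 (e z) = ∑' n : ℤ, (-1 : ℂ) ^ n * e ((n : ℂ) ^ 2 * z) := by
  rw [theta4]
  refine tsum_congr fun n => ?_
  rw [e_zpow]
  push_cast
  rfl

lemma eta_eq_qProd (z : ℂ) : eta z = e (z / 24) * qProd (e z) 1 := by
  rw [eta, qProd, Function.Periodic.qParam]
  congr 1
  · rw [e]; congr 1; push_cast; ring
  · refine tprod_congr fun n => ?_
    rw [eta_q_eq_pow, one_mul, e]

lemma eta_ne_zero' {z : ℂ} (hz : 0 < z.im) : eta z ≠ 0 := eta_ne_zero hz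

lemma qProd_one_mul_neg_one {q : ℂ} (hq : ‖q‖ < 1) :
    qProd q 1 * qProd q (-1) = qProd (q ^ 2) 1 := by
  rw [qProd, qProd, qProd, ← (multipliable_qProd hq 1).tprod_mul (multipliable_qProd hq (-1))]
  refine tprod_congr fun i => ?_
  ring

lemma theta4_mul_eta {z : ℂ} (hz : 0 < z.im) : theta4 (e z) * eta (2 * z) = eta z ^ 2 := by
  have hq := norm_e_lt_one hz
  have h2 : e (2 * z) = e z ^ 2 := by
    rw [← zpow_natCast, e_zpow]; push_cast; rfl
  have h24 : e (2 * z / 24) = e (z / 24) ^ 2 := by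
    rw [← zpow_natCast, e_zpow]; push_cast; congr 1; ring
  rw [eta_eq_qProd, eta_eq_qProd, h2, h24, ← qProd_one_mul_neg_one hq, mul_pow,
    ← theta4_mul_qProd (e_ne_zero z) hq]
  ring

lemma rotSqrt_ofReal_mul {r : ℝ} (hr : 0 < r) {w : ℂ} (hw : 0 < w.im) :
    rotSqrt (r * w) = √r * rotSqrt w := by
  refine eq_of_sq_eq_of_re_pos ?_ (rotSqrt_re_pos ?_) ?_
  · rw [rotSqrt_sq, mul_pow, rotSqrt_sq, ← Complex.ofReal_pow, Real.sq_sqrt hr.le]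
    ring
  · rw [Complex.im_ofReal_mul]; positivity
  · rw [Complex.re_ofReal_mul]
    exact mul_pos (Real.sqrt_pos.mpr hr) (rotSqrt_re_pos hw)

lemma neg_one_div_im_pos {z : ℂ} (hz : 0 < z.im) : 0 < (-1 / z).im := by
  have h := (mobius_im_pos (α := 0) (β := -1) (γ := 1) (δ := 0) (by norm_num) (Or.inl one_ne_zero) hz).1
  simpa using h

/-- The even terms of `∑ i ^ n e(-n² / (4 z))` give `theta4` at `-1 / z`; the odd ones cancel. -/
lemma jacobiTheta₂_quarter {z : ℂ} (hz : 0 < z.im) :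
    jacobiTheta₂ (1 / 4) (-1 / (2 * z)) = theta4 (e (-1 / z)) := by
  have hτ : 0 < (-1 / (2 * z)).im := neg_one_div_im_pos (by simpa using hz)
  have hs := (hasSum_jacobiTheta₂_term (1 / 4) hτ).summable
  have h0 : ∀ n : ℤ, jacobiTheta₂_term n (1 / 4) (-1 / (2 * z)) =
      e (n / 4) * e ((n : ℂ) ^ 2 / 4 * (-1 / z)) := fun n => by
    rw [jacobiTheta₂_term, ← e_add, e]
    congr 1
    field_simp
    ring
  -- For odd `n` the values of `i ^ n` at `n` and `-n` are opposite, while the Gaussian factor is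
  -- even.
  have hodd : ∑' n : ℤ, (if Even n then 0 else jacobiTheta₂_term n (1 / 4) (-1 / (2 * z))) = 0 := by
    have h1 : ∑' n : ℤ, (if Even n then 0 else jacobiTheta₂_term n (1 / 4) (-1 / (2 * z))) =
        -∑' n : ℤ, (if Even n then 0 else jacobiTheta₂_term n (1 / 4) (-1 / (2 * z))) := by
      conv_lhs => rw [← (Equiv.neg ℤ).tsum_eq]
      rw [← tsum_neg]
      refine tsum_congr fun n => ?_
      simp only [Equiv.neg_apply, even_neg]
      split_ifs with h
      · simp
      · obtain ⟨k, hk⟩ := Int.not_even_iff_odd.mp h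
        rw [h0, h0, ← neg_mul]
        push_cast
        rw [neg_sq]
        congr 1
        have h2 : (-(n : ℂ) / 4) = n / 4 + ((-(k + 1) : ℤ) : ℂ) + 1 / 2 := by
          rw [hk]; push_cast; ring
        have h3 : e (1 / 2) = -1 := by
          rw [e, ← Complex.exp_pi_mul_I]; congr 1; ring
        rw [h2, e_add, e_add, e_int, h3]
        ring
    exact self_eq_neg.mp h1
  have heven : ∑' n : ℤ, (if Even n then jacobiTheta₂_term n (1 / 4) (-1 / (2 * z)) else 0) =
      theta4 (e (-1 / z)) := by
    have hinj : Function.Injective fun k : ℤ => 2 * k := fun a b h => by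
      simpa using h
    rw [theta4_e, ← hinj.tsum_eq]
    · refine tsum_congr fun k => ?_
      rw [if_pos (even_two_mul k), h0]
      congr 1
      · have h3 : e (1 / 2) = -1 := by
          rw [e, ← Complex.exp_pi_mul_I]; congr 1; ring
        rw [← h3, e_zpow]
        congr 1; push_cast; ring
      · congr 1; push_cast; ring
    · intro n hn
      by_cases h : Even n
      · obtain ⟨k, hk⟩ := h.two_dvd
        exact ⟨k, hk.symm⟩
      · simp [h] at hn
  rw [jacobiTheta₂, ← heven]
  have hse : Summable fun n : ℤ => if Even n then jacobiTheta₂_term n (1 / 4) (-1 / (2 * z)) else 0 :=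
    (hs.indicator {n : ℤ | Even n}).congr fun n => by simp [Set.indicator]
  have hso : Summable fun n : ℤ => if Even n then 0 else jacobiTheta₂_term n (1 / 4) (-1 / (2 * z)) :=
    (hs.sub hse).congr fun n => by split_ifs <;> simp
  have hadd := hse.tsum_add hso
  rw [hodd, add_zero] at hadd
  rw [← hadd]
  refine tsum_congr fun n => ?_
  split_ifs <;> simp

/-- Jacobi inversion carries `thetaQuarter z` to `theta4` at `-1 / z`, so this is the inverted form
of `theta4_mul_eta`, with `2 (-1 / z) = -1 / (z / 2)`. -/
lemma thetaQuarter_mul_eta {z : ℂ} (hz : 0 < z.im) :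
    thetaQuarter z * eta (z / 2) = eta z ^ 2 := by
  have hz0 : z ≠ 0 := by rintro rfl; simp at hz
  have h1 : thetaQuarter z = e (z / 16) * jacobiTheta₂ (z / 2) (2 * z) := by
    rw [thetaQuarter, jacobiTheta₂, ← tsum_mul_left]
    refine tsum_congr fun n => ?_
    rw [jacobiTheta₂_term, e, e, ← Complex.exp_add]
    congr 1; ring
  have h2 := jacobiTheta₂_functional_equation (z / 2) (2 * z)
  rw [show z / 2 / (2 * z) = 1 / 4 by field_simp; norm_num, jacobiTheta₂_quarter hz] at h2
  have h3 : e (z / 16) * Complex.exp (-Real.pi * Complex.I * (z / 2) ^ 2 / (2 * z)) = 1 := by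
    rw [e, ← Complex.exp_add, ← Complex.exp_zero]
    congr 1
    field_simp
    ring
  have h4 : (-Complex.I * (2 * z)) ^ (1 / 2 : ℂ) = √2 * rotSqrt z := by
    have := rotSqrt_ofReal_mul zero_lt_two hz
    rw [← this, rotSqrt]
    push_cast; rfl
  have hz2 : 0 < (z / 2).im := by simpa using hz
  have h5 : rotSqrt z = √2 * rotSqrt (z / 2) := by
    rw [← rotSqrt_ofReal_mul zero_lt_two hz2]
    congr 1; push_cast; ring
  have h6 := theta4_mul_eta (neg_one_div_im_pos hz)
  rw [show 2 * (-1 / z) = -1 / (z / 2) by field_simp, eta_neg_one_div hz, eta_neg_one_div hz2] at h6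
  have hr := rotSqrt_ne_zero hz2
  have hs : (√2 : ℂ) ^ 2 = 2 := by
    rw [← Complex.ofReal_pow, Real.sq_sqrt zero_le_two]; simp
  have hs0 : (√2 : ℂ) ≠ 0 := by
    intro h; rw [h] at hs; norm_num at hs
  rw [h1, h2, h4]
  rw [h5] at h6 ⊢
  have h7 : theta4 (e (-1 / z)) * eta (z / 2) = 2 * rotSqrt (z / 2) * eta z ^ 2 := by
    apply mul_left_cancel₀ hr
    linear_combination h6 + rotSqrt (z / 2) ^ 2 * eta z ^ 2 * hs
  set E := Complex.exp (-Real.pi * Complex.I * (z / 2) ^ 2 / (2 * z))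
  set T := theta4 (e (-1 / z))
  field_simp
  linear_combination (T * eta (z / 2)) * h3 + h7 - rotSqrt (z / 2) * eta z ^ 2 * hs

lemma thetaQuarter_ne_zero {z : ℂ} (hz : 0 < z.im) : thetaQuarter z ≠ 0 := fun h => by
  have h1 := thetaQuarter_mul_eta hz
  rw [h, zero_mul] at h1
  exact pow_ne_zero 2 (eta_ne_zero' hz) h1.symm

/-! ### Shifted theta sums -/

/-- Completing the square moves the centre to `-l / 2`. For even `l` an integer shift brings it back
at the cost of a sign; for odd `l` the alternating sum about a half-integer is zero. -/
lemma theta4_shift {z : ℂ} (hz : 0 < z.im) (l : ℤ) :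
    ∑' n : ℤ, (-1 : ℂ) ^ n * e ((n : ℂ) ^ 2 * z + n * (((0 : ℝ) : ℂ) + l) * z) =
      (if Even l then (-1 : ℂ) ^ (l / 2) else 0) * theta4 (e z) *
        e (-((((0 : ℝ) + l : ℝ) : ℂ) ^ 2 * z / 4)) := by
  have hq := norm_e_lt_one hz
  split_ifs with h
  · obtain ⟨k, rfl⟩ := h.two_dvd
    rw [Int.mul_ediv_cancel_left _ two_ne_zero, theta4_e, ← (Equiv.subRight k).tsum_eq, mul_right_comm,
      ← tsum_mul_left]
    refine tsum_congr fun n => ?_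
    rw [Equiv.subRight_apply, zpow_sub₀ (by norm_num), div_eq_mul_inv, ← inv_zpow,
      show (-1 : ℂ)⁻¹ = -1 by norm_num]
    rw [show (-1 : ℂ) ^ k * e (-((((0 : ℝ) + ((2 * k : ℤ) : ℝ) : ℝ) : ℂ) ^ 2 * z / 4)) *
      ((-1) ^ n * e ((n : ℂ) ^ 2 * z)) = (-1) ^ n * (-1) ^ k * (e ((n : ℂ) ^ 2 * z) *
        e (-((((0 : ℝ) + ((2 * k : ℤ) : ℝ) : ℝ) : ℂ) ^ 2 * z / 4))) by ring, ← e_add]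
    congr 2
    push_cast
    ring
  · obtain ⟨k, rfl⟩ := Int.not_even_iff_odd.mp h
    rw [zero_mul, zero_mul, ← (Equiv.subRight (k + 1)).tsum_eq]
    have h1 := (hasSum_theta4_half_shift (e_ne_zero z) hq).mul_left
      ((-1) ^ (k + 1) * e (-((k : ℂ) ^ 2 + k) * z))
    rw [mul_zero] at h1
    refine (h1.congr_fun fun n => ?_).tsum_eq
    rw [Equiv.subRight_apply, zpow_sub₀ (by norm_num), div_eq_mul_inv, ← inv_zpow,
      show (-1 : ℂ)⁻¹ = -1 by norm_num, e_zpow]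
    rw [show (-1 : ℂ) ^ (k + 1) * e (-((k : ℂ) ^ 2 + k) * z) * ((-1) ^ n * e (((n ^ 2 - n : ℤ) : ℂ) * z))
      = (-1) ^ n * (-1) ^ (k + 1) * (e (-((k : ℂ) ^ 2 + k) * z) * e (((n ^ 2 - n : ℤ) : ℂ) * z)) by ring,
      ← e_add]
    congr 2
    push_cast
    ring

/-- Here the completed square is `(n + 1/4 + l / 2)²`. The cosets of 1/4 and 3/4 modulo 1 are
exchanged by negation, so every `l` gives the same theta constant: a shift for even `l`, a
reflection for odd `l`. -/
lemma thetaQuarter_shift (z : ℂ) (l : ℤ) :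
    ∑' n : ℤ, 1 * e ((n : ℂ) ^ 2 * z + n * (((1 / 2 : ℝ) : ℂ) + l) * z) =
      1 * thetaQuarter z * e (-((((1 / 2 : ℝ) + l : ℝ) : ℂ) ^ 2 * z / 4)) := by
  rw [one_mul, thetaQuarter]
  rcases Int.even_or_odd' l with ⟨k, rfl | rfl⟩
  · rw [← (Equiv.subRight k).tsum_eq, ← tsum_mul_right]
    refine tsum_congr fun n => ?_
    rw [Equiv.subRight_apply, one_mul, ← e_add]
    congr 1
    push_cast
    ring
  · rw [← (Equiv.subLeft (-k - 1)).tsum_eq, ← tsum_mul_right]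
    refine tsum_congr fun n => ?_
    rw [Equiv.subLeft_apply, one_mul, ← e_add]
    congr 1
    push_cast
    ring

/-! ### Transformation of `theta4` -/

/-- In the eta quotient, `2 A z` is the image of `2 z` under the integral matrix with rows `(α, 2
β)` and `(γ / 2, δ)`. The exponentials in `α + δ` cancel and only the `ω` factors survive. -/
lemma theta4_transform_of_even {α β γ δ : ℤ} (hdet : α * δ - β * γ = 1) (hγ : 0 < γ) (h : Even γ)
    {z : ℂ} (hz : 0 < z.im) :
    theta4 (e ((α * z + β) / (γ * z + δ))) = (omega α γ ^ 2)⁻¹ * omega α (γ / 2) *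
      rotSqrt (γ * z + δ) * theta4 (e z) := by
  obtain ⟨k, rfl⟩ := h.two_dvd
  have hk : 0 < k := by omega
  rw [Int.mul_ediv_cancel_left _ two_ne_zero]
  have hz2 : 0 < (2 * z).im := by simpa using hz
  obtain ⟨hA, hne⟩ := mobius_im_pos hdet (Or.inl hγ.ne') hz
  have h1 := theta4_mul_eta hA
  have h2 := eta_transform hdet hγ hz
  have h3 := eta_transform (α := α) (β := 2 * β) (γ := k) (δ := δ) (by rw [← hdet]; ring) hk hz2
  have h4 : 2 * ((α * z + β) / (((2 * k : ℤ) : ℂ) * z + δ)) =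
      (α * (2 * z) + ((2 * β : ℤ) : ℂ)) / (k * (2 * z) + δ) := by
    push_cast
    rw [← mul_div_assoc]
    congr 1 <;> ring
  have h5 : (k : ℂ) * (2 * z) + δ = ((2 * k : ℤ) : ℂ) * z + δ := by push_cast; ring
  rw [h4, h3, h5, h2] at h1
  have h6 := theta4_mul_eta hz
  have hkC : (k : ℂ) ≠ 0 := by exact_mod_cast hk.ne'
  have hexp : Complex.exp (Real.pi * Complex.I * ((α + δ) / (12 * k))) =
      Complex.exp (Real.pi * Complex.I * ((α + δ) / (12 * ((2 * k : ℤ) : ℂ)))) ^ 2 := by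
    rw [← Complex.exp_nat_mul]
    congr 1
    push_cast
    field_simp
  rw [hexp] at h1
  have he := Complex.exp_ne_zero (Real.pi * Complex.I * ((α + δ) / (12 * ((2 * k : ℤ) : ℂ))))
  have ho1 : omega α (2 * k) ≠ 0 := Complex.exp_ne_zero _
  have ho2 : omega α k ≠ 0 := Complex.exp_ne_zero _
  have hw : 0 < (((2 * k : ℤ) : ℂ) * z + δ).im := by
    rw [Complex.add_im, Complex.intCast_im, add_zero, ← Complex.ofReal_intCast, Complex.im_ofReal_mul]
    have : (0 : ℝ) < ((2 * k : ℤ) : ℝ) := by exact_mod_cast hγ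
    positivity
  have hr := rotSqrt_ne_zero hw
  have heta := eta_ne_zero' hz2
  set E := Complex.exp (Real.pi * Complex.I * ((α + δ) / (12 * ((2 * k : ℤ) : ℂ))))
  set R := rotSqrt (((2 * k : ℤ) : ℂ) * z + δ)
  apply mul_right_cancel₀ (mul_ne_zero (mul_ne_zero (mul_ne_zero (pow_ne_zero 2 he) (inv_ne_zero ho2)) hr) heta)
  rw [h1]
  field_simp
  linear_combination -h6

/-- For even `δ`, `2 A z` is the image of `z / 2` under the matrix with rows `(2 α, β)` and `(γ, δ /
2)`, so the quotient becomes `η(z)² / η(z / 2)`. The exponentials now leave `exp (π i δ / (8 γ))`,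
and the halved automorphy factor leaves `√2`. -/
lemma theta4_transform_of_odd {α β γ δ : ℤ} (hdet : α * δ - β * γ = 1) (hγ : 0 < γ) (h : Even δ)
    {z : ℂ} (hz : 0 < z.im) :
    theta4 (e ((α * z + β) / (γ * z + δ))) = Complex.exp (Real.pi * Complex.I * δ / (8 * γ)) *
      (omega α γ ^ 2)⁻¹ * omega (2 * α) γ * √2 * rotSqrt (γ * z + δ) * thetaQuarter z := by
  obtain ⟨k, rfl⟩ := h.two_dvd
  have hz2 : 0 < (z / 2).im := by simpa using hz
  obtain ⟨hA, hne⟩ := mobius_im_pos hdet (Or.inl hγ.ne') hz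
  have hγC : (γ : ℂ) ≠ 0 := by exact_mod_cast hγ.ne'
  have h1 := theta4_mul_eta hA
  have h2 := eta_transform hdet hγ hz
  have h3 := eta_transform (α := 2 * α) (β := β) (γ := γ) (δ := k) (by rw [← hdet]; ring) hγ hz2
  have h5 : (γ : ℂ) * (z / 2) + k = (γ * z + ((2 * k : ℤ) : ℂ)) / 2 := by push_cast; ring
  have h4 : 2 * ((α * z + β) / (γ * z + ((2 * k : ℤ) : ℂ))) =
      (((2 * α : ℤ) : ℂ) * (z / 2) + β) / (γ * (z / 2) + k) := by
    rw [h5]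
    push_cast
    field_simp
  have hw : 0 < (γ * z + ((2 * k : ℤ) : ℂ)).im := by
    rw [Complex.add_im, Complex.intCast_im, add_zero, ← Complex.ofReal_intCast, Complex.im_ofReal_mul]
    have : (0 : ℝ) < (γ : ℝ) := by exact_mod_cast hγ
    positivity
  have hw2 : 0 < ((γ * z + ((2 * k : ℤ) : ℂ)) / 2).im := by simpa using hw
  have h7 : rotSqrt (γ * z + ((2 * k : ℤ) : ℂ)) =
      √2 * rotSqrt ((γ * z + ((2 * k : ℤ) : ℂ)) / 2) := by
    rw [← rotSqrt_ofReal_mul zero_lt_two hw2]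
    congr 1; push_cast; ring
  rw [h4, h3, h5, h2, h7] at h1
  rw [h7]
  have h6 := thetaQuarter_mul_eta hz
  have hexp : Complex.exp (Real.pi * Complex.I * ((α + ((2 * k : ℤ) : ℂ)) / (12 * γ))) ^ 2 =
      Complex.exp (Real.pi * Complex.I * ((2 * k : ℤ) : ℂ) / (8 * γ)) *
      Complex.exp (Real.pi * Complex.I * ((((2 * α : ℤ) : ℂ) + k) / (12 * γ))) := by
    rw [← Complex.exp_nat_mul, ← Complex.exp_add]
    congr 1
    push_cast
    field_simp
    ring
  rw [mul_pow, mul_pow, mul_pow, hexp] at h1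
  have hr := rotSqrt_ne_zero hw2
  have heta := eta_ne_zero' hz2
  have he1 := Complex.exp_ne_zero (Real.pi * Complex.I * ((((2 * α : ℤ) : ℂ) + k) / (12 * γ)))
  have ho1 : omega α γ ≠ 0 := Complex.exp_ne_zero _
  have ho2 : omega (2 * α) γ ≠ 0 := Complex.exp_ne_zero _
  set E1 := Complex.exp (Real.pi * Complex.I * ((((2 * α : ℤ) : ℂ) + k) / (12 * γ)))
  set R := rotSqrt ((γ * z + ((2 * k : ℤ) : ℂ)) / 2)
  apply mul_right_cancel₀ (mul_ne_zero (mul_ne_zero (mul_ne_zero he1 (inv_ne_zero ho2)) hr) heta)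
  rw [h1]
  field_simp
  rw [← h6]

end OverpartitionRank

/-! ### `𝒪`, `𝒰` and `J` in terms of the completed sums. -/

namespace OverpartitionRank

open ModularForm

/-! ### The two completed sums -/

/-- The coefficients `(-1) ^ (l / 2)` at even `l`, and `0` at odd `l`. -/
noncomputable def evenSign (l : ℤ) : ℂ := if Even l then (-1) ^ (l / 2) else 0

lemma norm_neg_one_zpow (n : ℤ) : ‖(-1 : ℂ) ^ n‖ = 1 := by
  rw [norm_zpow, norm_neg, norm_one, one_zpow]

lemma norm_evenSign_le (l : ℤ) : ‖evenSign l‖ ≤ 1 := by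
  rw [evenSign]
  split_ifs
  · exact (norm_neg_one_zpow _).le
  · simp

lemma e_half : e (1 / 2) = -1 := by
  rw [e, ← Complex.exp_pi_mul_I]; congr 1; ring

lemma latSum_cot {x : ℝ} (hx : ∀ m : ℤ, x ≠ m) {z : ℂ} (hz : 0 < z.im) :
    latSum (fun p => (-1) ^ p.1) x z =
      ∑' n : ℤ, (-1) ^ n * e ((n : ℂ) ^ 2 * z) * Complex.cot (Real.pi * (x + n * z)) +
        √2 * theta4 (e z) * periodIntegral (thetaSeries 0 x evenSign) z := by
  rw [← (latSum_eq isSignKernel_cot norm_neg_one_zpow norm_evenSign_le hx hz (theta4_shift hz)).2]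
  simp [e]

lemma summable_csc {x : ℝ} (hx : ∀ m : ℤ, x ≠ m) {z : ℂ} (hz : 0 < z.im) :
    Summable fun n : ℤ => e ((n : ℂ) ^ 2 * z) / Complex.sin (Real.pi * (x + n * z)) := by
  refine (latSum_eq isSignKernel_csc (χ := fun _ => 1) (c := fun _ => 1) (by simp) (by simp) hx hz
    (thetaQuarter_shift z)).1.congr fun n => ?_
  ring

lemma latSum_csc {x : ℝ} (hx : ∀ m : ℤ, x ≠ m) {z : ℂ} (hz : 0 < z.im) :
    latSum (fun p => (-1) ^ p.2) x z =
      ∑' n : ℤ, e ((n : ℂ) ^ 2 * z) / Complex.sin (Real.pi * (x + n * z)) +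
        √2 * thetaQuarter z * periodIntegral (thetaSeries (1 / 2) x fun _ => 1) z := by
  have h := (latSum_eq isSignKernel_csc (χ := fun _ => 1) (c := fun _ => 1) (by simp) (by simp) hx hz
    (thetaQuarter_shift z)).2
  simp only [one_mul, mul_one_div] at h
  rw [← h]
  congr 1
  funext p
  rw [← e_half, e_zpow]
  push_cast
  rfl

/-! ### `𝒪` and `𝒰` as Appell sums -/

/-- Half-angle form of the Appell identity: the summands become cotangents, and the prefactor `(1 -
u) / (1 + u)` at `u = e(x)` is `-i tan(π x)`. -/
lemma theta4_mul_calO {x : ℝ} (hx : ∀ m : ℤ, x ≠ m) (hcos : Real.cos (Real.pi * x) ≠ 0) {z : ℂ}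
    (hz : 0 < z.im) : theta4 (e z) * calO x z = Real.tan (Real.pi * x) *
      ∑' n : ℤ, (-1) ^ n * e ((n : ℂ) ^ 2 * z) * Complex.cot (Real.pi * (x + n * z)) := by
  have hxC : ∀ m : ℤ, (x : ℂ) ≠ m := fun m h => hx m (by exact_mod_cast h)
  have hsin := sin_pi_mul_ne_zero hxC
  have hhalf := e_ne_zero (x / 2)
  have h1 := e_sub_one_eq x
  have h2 := e_add_one_eq x
  have hu1 : e x ≠ 1 := fun h => by
    rw [h, sub_self] at h1
    exact mul_ne_zero (mul_ne_zero (mul_ne_zero two_ne_zero Complex.I_ne_zero) hsin) hhalf h1.symm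
  have h := theta4_mul_rankGen (norm_e_ofReal x) hu1 (e_ne_zero z) (norm_e_lt_one hz)
  have hterm : ∀ n : ℤ, (-1 : ℂ) ^ n * e z ^ (n ^ 2) * ((1 + e x * e z ^ n) / (1 - e x * e z ^ n)) =
      Complex.I * ((-1) ^ n * e ((n : ℂ) ^ 2 * z) * Complex.cot (Real.pi * (x + n * z))) := fun n => by
    rw [e_zpow, e_zpow, ← e_add, one_add_e_div_one_sub_e _ (add_mul_ne_int hx hz n)]
    push_cast
    ring
  rw [tsum_congr hterm, tsum_mul_left, add_comm 1 (e x), h2, ← neg_sub (e x) 1, h1] at h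
  have hcosC : Complex.cos (Real.pi * x) ≠ 0 := by exact_mod_cast hcos
  rw [calO, Complex.ofReal_tan]
  push_cast
  rw [Complex.tan_eq_sin_div_cos]
  set S := ∑' n : ℤ, (-1) ^ n * e ((n : ℂ) ^ 2 * z) * Complex.cot (Real.pi * (x + n * z))
  field_simp
  apply mul_left_cancel₀ hhalf
  linear_combination h / 2 - Complex.sin (Real.pi * x) * e (x / 2) * S * Complex.I_sq

/-- The denominator of `𝒰` factors into the sines at `x + n z` and `x - n z`, and the sum-to-product
formula for these sines produces the numerator. The summand is thus a symmetrised cosecant. -/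
lemma calU_term_eq {x : ℝ} (hx : ∀ m : ℤ, x ≠ m) {z : ℂ} (hz : 0 < z.im) (n : ℤ) :
    (Real.sin (Real.pi * x) : ℂ) * ((1 + e (n * z)) * e (((n : ℂ) ^ 2 + n / 2) * z) /
      (1 - 2 * e (n * z) * (Real.cos (2 * Real.pi * x) : ℂ) + e (2 * n * z))) =
    1 / 4 * (e ((n : ℂ) ^ 2 * z) / Complex.sin (Real.pi * (x + n * z)) +
      e (((-n : ℤ) : ℂ) ^ 2 * z) / Complex.sin (Real.pi * (x + ((-n : ℤ) : ℂ) * z))) := by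
  have hs1 := sin_pi_mul_ne_zero (add_mul_ne_int hx hz n)
  have hs2 := sin_pi_mul_ne_zero (add_mul_ne_int hx hz (-n))
  have h1 := e_sub_one_eq (x + n * z)
  have h2 := e_sub_one_eq (x + ((-n : ℤ) : ℂ) * z)
  have h3 := e_add_one_eq (n * z)
  have hs : Complex.sin (Real.pi * (x + n * z)) + Complex.sin (Real.pi * (x + ((-n : ℤ) : ℂ) * z)) =
      2 * Complex.sin (Real.pi * x) * Complex.cos (Real.pi * (n * z)) := by
    push_cast
    rw [show (Real.pi : ℂ) * (x + -n * z) = Real.pi * x - Real.pi * (n * z) by ring, mul_add,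
      Complex.sin_add, Complex.sin_sub]
    ring
  have hden : 1 - 2 * e (n * z) * (Real.cos (2 * Real.pi * x) : ℂ) + e (2 * n * z) =
      4 * Complex.sin (Real.pi * (x + n * z)) * Complex.sin (Real.pi * (x + ((-n : ℤ) : ℂ) * z)) *
        e (n * z) := by
    have hcos : 2 * (Real.cos (2 * Real.pi * x) : ℂ) = e x + e (-x) := by
      push_cast
      rw [Complex.cos, e, e]
      ring_nf
    have hB : e (2 * n * z) = e (x + n * z) * e (n * z) * e (-x) := by
      rw [← e_add, ← e_add]; congr 1; ring
    have hE : e (x + ((-n : ℤ) : ℂ) * z) * e (n * z) = e x := by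
      rw [← e_add]; congr 1; push_cast; ring
    have hD : e (x + n * z) = e x * e (n * z) := e_add _ _
    have hx1 : e x * e (-x) = 1 := by rw [← e_add]; simp [e]
    have hfac : 1 - 2 * e (n * z) * (Real.cos (2 * Real.pi * x) : ℂ) + e (2 * n * z) =
        -e (-x) * (e (x + n * z) - 1) * ((e (x + ((-n : ℤ) : ℂ) * z) - 1) * e (n * z)) := by
      have : 2 * e (n * z) * (Real.cos (2 * Real.pi * x) : ℂ) = e (n * z) * (e x + e (-x)) := by
        rw [← hcos]; ring
      rw [this, sub_mul (e (x + ((-n : ℤ) : ℂ) * z)), hE, hB, hD]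
      linear_combination (e (n * z) * e x - 1) * hx1
    have hE2 : e ((x + n * z) / 2) * e ((x + ((-n : ℤ) : ℂ) * z) / 2) * e (-x) = 1 := by
      rw [← e_add, ← e_add]
      push_cast
      rw [show ((x : ℂ) + n * z) / 2 + (x + -n * z) / 2 + -x = 0 by ring]
      simp [e]
    rw [hfac, h1, h2]
    set s1 := Complex.sin (Real.pi * (x + n * z))
    set s2 := Complex.sin (Real.pi * (x + ((-n : ℤ) : ℂ) * z))
    linear_combination (4 * s1 * s2 * e (n * z)) * hE2 - 4 * s1 * s2 * e (n * z) *
      (e ((x + n * z) / 2) * e ((x + ((-n : ℤ) : ℂ) * z) / 2) * e (-x)) * Complex.I_sq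
  have hnum : (1 + e (n * z)) * e (((n : ℂ) ^ 2 + n / 2) * z) =
      2 * Complex.cos (Real.pi * (n * z)) * e ((n : ℂ) ^ 2 * z) * e (n * z) := by
    have h4 : e (((n : ℂ) ^ 2 + n / 2) * z) = e ((n : ℂ) ^ 2 * z) * e (n * z / 2) := by
      rw [← e_add]; congr 1; ring
    have h5 : e (n * z) = e (n * z / 2) * e (n * z / 2) := by
      rw [← e_add]; congr 1; ring
    rw [add_comm 1, h3, h4, h5]
    ring
  have hen := e_ne_zero (n * z)
  rw [hden, hnum, show (((-n : ℤ) : ℂ)) ^ 2 = (n : ℂ) ^ 2 by push_cast; ring]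
  set s1 := Complex.sin (Real.pi * (x + n * z))
  set s2 := Complex.sin (Real.pi * (x + ((-n : ℤ) : ℂ) * z))
  set cn := Complex.cos (Real.pi * (n * z))
  push_cast
  field_simp
  linear_combination -e ((n : ℂ) ^ 2 * z) * hs

lemma thetaQuarter_mul_calU {x : ℝ} (hx : ∀ m : ℤ, x ≠ m) {z : ℂ} (hz : 0 < z.im) :
    thetaQuarter z * calU x z =
      1 / 2 * ∑' n : ℤ, e ((n : ℂ) ^ 2 * z) / Complex.sin (Real.pi * (x + n * z)) := by
  have h1 := thetaQuarter_mul_eta hz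
  have h2 := eta_ne_zero' hz
  have hS := summable_csc hx hz
  have hS' : Summable fun n : ℤ => e (((-n : ℤ) : ℂ) ^ 2 * z) /
      Complex.sin (Real.pi * (x + ((-n : ℤ) : ℂ) * z)) := (Equiv.neg ℤ).summable_iff.mpr hS
  have h3 := (Equiv.neg ℤ).tsum_eq fun n : ℤ =>
    e ((n : ℂ) ^ 2 * z) / Complex.sin (Real.pi * (x + n * z))
  rw [calU, mul_right_comm, ← tsum_mul_left, tsum_congr (calU_term_eq hx hz), tsum_mul_left,
    hS.tsum_add hS']
  simp only [Equiv.neg_apply] at h3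
  rw [h3]
  set S := ∑' n : ℤ, e ((n : ℂ) ^ 2 * z) / Complex.sin (Real.pi * (x + n * z))
  field_simp
  linear_combination (4 * S) * h1

/-! ### The non-holomorphic part -/

/-- Inversion of a weight 3/2 unary theta series, from the functional equation of the derivative of
Jacobi's theta function in its elliptic variable, taken at `2 τ`. -/
lemma tsum_shift_gaussian {b τ : ℂ} (hτ : 0 < τ.im) :
    ∑' m : ℤ, ((m : ℂ) + b) * e (-1 / τ * ((m : ℂ) + b) ^ 2 / 4) =
      -2 * √2 * τ * rotSqrt τ * ∑' n : ℤ, (n : ℂ) * e (n * b) * e ((n : ℂ) ^ 2 * τ) := by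
  have hτ0 : τ ≠ 0 := by rintro rfl; simp at hτ
  have hpi : (2 * Real.pi * Complex.I : ℂ) ≠ 0 := Complex.two_pi_I_ne_zero
  have h2τ : 0 < (2 * τ).im := by simpa using hτ
  set σ : ℂ := -1 / (2 * τ) with hσdef
  have hσ : 0 < σ.im := neg_one_div_im_pos h2τ
  have hf := jacobiTheta₂'_functional_equation b (2 * τ)
  have hbσ : b / (2 * τ) = -(b * σ) := by rw [hσdef]; ring
  rw [hbσ, ← hσdef, jacobiTheta₂'_neg_left, jacobiTheta₂_neg_left] at hf
  have h4 : (-Complex.I * (2 * τ)) ^ (1 / 2 : ℂ) = √2 * rotSqrt τ := by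
    have := rotSqrt_ofReal_mul zero_lt_two hτ
    rw [← this, rotSqrt]
    push_cast; rfl
  have hL : 2 * Real.pi * Complex.I * ∑' m : ℤ, ((m : ℂ) + b) * e (-1 / τ * ((m : ℂ) + b) ^ 2 / 4) =
      Complex.exp (-Real.pi * Complex.I * b ^ 2 / (2 * τ)) *
        (jacobiTheta₂' (b * σ) σ + 2 * Real.pi * Complex.I * b * jacobiTheta₂ (b * σ) σ) := by
    have hs := ((hasSum_jacobiTheta₂'_term (b * σ) hσ).add
      ((hasSum_jacobiTheta₂_term (b * σ) hσ).mul_left (2 * Real.pi * Complex.I * b))).mul_left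
        (Complex.exp (-Real.pi * Complex.I * b ^ 2 / (2 * τ)))
    rw [← hs.tsum_eq, ← tsum_mul_left]
    refine tsum_congr fun m => ?_
    rw [jacobiTheta₂'_term, jacobiTheta₂_term, ← add_mul]
    have : e (-1 / τ * ((m : ℂ) + b) ^ 2 / 4) = Complex.exp (-Real.pi * Complex.I * b ^ 2 / (2 * τ)) *
        Complex.exp (2 * Real.pi * Complex.I * m * (b * σ) + Real.pi * Complex.I * m ^ 2 * σ) := by
      rw [e, ← Complex.exp_add, hσdef]
      congr 1
      field_simp
      ring
    rw [this]
    ring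
  have hR : jacobiTheta₂' b (2 * τ) = 2 * Real.pi * Complex.I *
      ∑' n : ℤ, (n : ℂ) * e (n * b) * e ((n : ℂ) ^ 2 * τ) := by
    rw [jacobiTheta₂', ← tsum_mul_left]
    refine tsum_congr fun n => ?_
    have : Complex.exp (2 * Real.pi * Complex.I * n * b + Real.pi * Complex.I * n ^ 2 * (2 * τ)) =
        e (n * b) * e ((n : ℂ) ^ 2 * τ) := by
      rw [← e_add, e]
      congr 1
      ring
    rw [jacobiTheta₂'_term, jacobiTheta₂_term, this]
    ring
  have hr := rotSqrt_ne_zero hτ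
  have hs0 : (√2 : ℂ) ≠ 0 := by
    have : √2 ≠ 0 := by positivity
    exact_mod_cast this
  rw [h4, hR] at hf
  apply mul_left_cancel₀ hpi
  rw [hL]
  set E := Complex.exp (-Real.pi * Complex.I * b ^ 2 / (2 * τ))
  set G := ∑' n : ℤ, (n : ℂ) * e (n * b) * e ((n : ℂ) ^ 2 * τ)
  rw [show 2 * Real.pi * Complex.I * (-2 * √2 * τ * rotSqrt τ * G) =
    -2 * √2 * τ * rotSqrt τ * (2 * Real.pi * Complex.I * G) by ring, hf]
  field_simp
  ring

lemma thetaSeries_evenSign (x : ℝ) (τ : ℂ) : thetaSeries 0 x evenSign τ =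
    ∑' n : ℤ, (n : ℂ) * e (n * (1 / 2 + 2 * x)) * e ((n : ℂ) ^ 2 * τ) := by
  have hinj : Function.Injective fun k : ℤ => 2 * k := fun a b h => by simpa using h
  rw [thetaSeries, ← hinj.tsum_eq]
  · refine tsum_congr fun k => ?_
    rw [evenSign, if_pos (even_two_mul k), Int.mul_ediv_cancel_left _ two_ne_zero, ← e_half, e_zpow,
      show (k : ℂ) * (1 / 2 + 2 * x) = k * (1 / 2) + (((0 : ℝ) : ℂ) + ((2 * k : ℤ) : ℂ)) * x by
        push_cast; ring, e_add, show ((0 + ((2 * k : ℤ) : ℝ) : ℝ) : ℂ) ^ 2 / 4 * τ = (k : ℂ) ^ 2 * τ by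
        push_cast; ring]
    push_cast
    ring
  · intro n hn
    by_cases h : Even n
    · obtain ⟨k, hk⟩ := h.two_dvd
      exact ⟨k, hk.symm⟩
    · simp [evenSign, h] at hn

/-- The summation index of `Theta` is `2 c (m + 1/2 + 2 a / c)`. Inversion turns the shift `1/2 + 2
a / c` into the character `e(n (1/2 + 2 a / c))`, and the factor `(-i τ) ^ (-3/2)` cancels the
weight. -/
lemma Theta_neg_one_div {a c : ℕ} (hc : 0 < c) {τ : ℂ} (hτ : 0 < τ.im) :
    (-Complex.I * τ) ^ (-(3 / 2) : ℂ) * Theta a c (-1 / τ) =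
      -(4 * √2 * c * Complex.I) * thetaSeries 0 ((a : ℝ) / c) evenSign τ := by
  have hcC : (c : ℂ) ≠ 0 := by exact_mod_cast hc.ne'
  have hτ0 : τ ≠ 0 := by rintro rfl; simp at hτ
  have hr := rotSqrt_ne_zero hτ
  have hsq := rotSqrt_sq τ
  have h1 : Theta a c (-1 / τ) = 2 * c * ∑' m : ℤ, ((m : ℂ) + (1 / 2 + 2 * (((a : ℝ) / c : ℝ) : ℂ))) *
      e (-1 / τ * ((m : ℂ) + (1 / 2 + 2 * (((a : ℝ) / c : ℝ) : ℂ))) ^ 2 / 4) := by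
    rw [Theta, theta, ← tsum_mul_left]
    refine tsum_congr fun m => ?_
    rw [← mul_assoc]
    push_cast
    congr 1
    · field_simp
      ring
    · congr 1
      field_simp
      ring
  have h2 : (-Complex.I * τ) ^ (-(3 / 2) : ℂ) = (rotSqrt τ ^ 3)⁻¹ := by
    rw [show (-(3 / 2) : ℂ) = (1 / 2) * ((-3 : ℤ) : ℂ) by push_cast; ring, Complex.cpow_mul_int,
      ← rotSqrt, zpow_neg]
    rfl
  rw [h1, tsum_shift_gaussian hτ, ← thetaSeries_evenSign, h2]
  have hτr : τ = Complex.I * rotSqrt τ ^ 2 := by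
    rw [hsq]
    linear_combination τ * Complex.I_sq
  set r := rotSqrt τ
  rw [hτr]
  field_simp
  ring

lemma J_eq {a c : ℕ} (hc : 0 < c) {z : ℂ} (hz : 0 < z.im) :
    J a c z = -(√2 * Real.tan (Real.pi * a / c)) *
      periodIntegral (thetaSeries 0 ((a : ℝ) / c) evenSign) z := by
  have hcC : (c : ℂ) ≠ 0 := by exact_mod_cast hc.ne'
  rw [J, periodIntegral_congr (fun τ hτ => Theta_neg_one_div hc hτ) hz, periodIntegral_const_mul]
  field_simp
  rw [Complex.I_sq]
  ring

/-- The definition of `J` is precisely what completes the cotangent sum to the full lattice sum. -/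
lemma theta4_mul_calM {a c : ℕ} (hc : 0 < c) (hx : ∀ m : ℤ, (a : ℝ) / c ≠ m)
    (hcos : Real.cos (Real.pi * ((a : ℝ) / c)) ≠ 0) {z : ℂ} (hz : 0 < z.im) :
    theta4 (e z) * calM a c z = Real.tan (Real.pi * a / c) *
      latSum (fun p => (-1) ^ p.1) ((a : ℝ) / c) z := by
  rw [calM, mul_sub, theta4_mul_calO hx hcos hz, J_eq hc hz, latSum_cot hx hz, mul_div_assoc]
  ring

end OverpartitionRank

/-! ### Modularity of the lattice sums and of `ℳ`. -/

namespace OverpartitionRank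

/-! ### Modularity of the completed sums -/

/-- The change of variables `(n, m) ↦ (γ m + α n + b, δ m + β n)`. -/
def affineEquiv {α β γ δ : ℤ} (hdet : α * δ - β * γ = 1) (b : ℤ) : ℤ × ℤ ≃ ℤ × ℤ where
  toFun p := (γ * p.2 + α * p.1 + b, δ * p.2 + β * p.1)
  invFun p := (δ * (p.1 - b) - γ * p.2, α * p.2 - β * (p.1 - b))
  left_inv p := by
    ext
    · simp only
      linear_combination p.1 * hdet
    · simp only
      linear_combination p.2 * hdet
  right_inv p := by
    ext
    · simp only
      linear_combination (p.1 - b) * hdet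
    · simp only
      linear_combination p.2 * hdet

/-- Multiplying `a / c + m + n A z` by `γ z + δ` gives a point of the lattice translated by `a δ /
c`. The coefficient of `z` is an integer because `a γ / c = a γ₁`, which is where `c ∣ γ` enters.
The norm scales like the imaginary part, so the Gaussian is invariant. -/
lemma latTerm_transform {a c : ℕ} (hc : 0 < c) {α β γ δ γ₁ : ℤ} (hdet : α * δ - β * γ = 1)
    (hγ : 0 < γ) (hγ₁ : γ = c * γ₁) {z : ℂ} (hz : 0 < z.im) (n m : ℤ) :
    latTerm ((a : ℝ) / c) ((α * z + β) / (γ * z + δ)) n m =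
      (γ * z + δ) * e ((a : ℂ) ^ 2 * δ * γ₁ / c) *
        latTerm ((a : ℝ) * δ / c) z (γ * m + α * n + γ₁ * a) (δ * m + β * n) := by
  obtain ⟨hA, hne⟩ := mobius_im_pos hdet (Or.inl hγ.ne') hz
  have hcC : (c : ℂ) ≠ 0 := by exact_mod_cast hc.ne'
  have hγC : (γ : ℂ) = c * γ₁ := by rw [hγ₁]; push_cast; rfl
  have hdetC : (α : ℂ) * δ - β * γ = 1 := by exact_mod_cast hdet
  have hn0 : Complex.normSq (γ * z + δ) ≠ 0 := by rwa [Ne, Complex.normSq_eq_zero]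
  have him : ((α * z + β) / (γ * z + δ)).im = z.im / Complex.normSq (γ * z + δ) := by
    rw [Complex.div_im]
    have hdetR : (α : ℝ) * δ - β * γ = 1 := by exact_mod_cast hdet
    simp
    field_simp
    linear_combination hdetR
  set w := (((a : ℝ) / c : ℝ) : ℂ) + m + n * ((α * z + β) / (γ * z + δ)) with hw
  set w' := (((a : ℝ) * δ / c : ℝ) : ℂ) + ((δ * m + β * n : ℤ) : ℂ) +
    ((γ * m + α * n + γ₁ * a : ℤ) : ℂ) * z with hw'
  have hww : w = w' / (γ * z + δ) := by
    rw [eq_div_iff hne, hw, hw', add_mul, mul_assoc, div_mul_cancel₀ _ hne]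
    push_cast
    field_simp
    linear_combination (a : ℂ) * z * hγC
  have hnorm : -(Real.pi / ((α * z + β) / (γ * z + δ)).im) * Complex.normSq w =
      -(Real.pi / z.im) * Complex.normSq w' := by
    rw [hww, him, map_div₀]
    have hy := hz.ne'
    field_simp
  have he : e (-(n * (((a : ℝ) / c : ℝ) : ℂ))) = e ((a : ℂ) ^ 2 * δ * γ₁ / c) *
      e (-(((γ * m + α * n + γ₁ * a : ℤ) : ℂ) * (((a : ℝ) * δ / c : ℝ) : ℂ))) := by
    -- The two phases differ by the exponential of this integer, once `α δ - β γ = 1` and `γ = c γ₁`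
    -- are used.
    rw [← e_add, ← mul_one (e (-(n * (((a : ℝ) / c : ℝ) : ℂ)))), ← e_int (-(γ₁ * m * δ * a + β * γ₁ * n * a)),
      ← e_add]
    congr 1
    push_cast
    field_simp
    linear_combination (n * a : ℂ) * hdetC + (a * δ * m + n * a * β : ℂ) * hγC
  rw [latTerm, latTerm, ← hw, ← hw', hnorm, he, hww]
  field_simp

lemma latSum_transform {a c : ℕ} (hc : 0 < c) {α β γ δ γ₁ : ℤ} (hdet : α * δ - β * γ = 1)
    (hγ : 0 < γ) (hγ₁ : γ = c * γ₁) {z : ℂ} (hz : 0 < z.im) {ε ε' : ℤ × ℤ → ℂ}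
    (hε : ∀ n m : ℤ, ε (n, m) = ε' (γ * m + α * n + γ₁ * a, δ * m + β * n)) :
    latSum ε ((a : ℝ) / c) ((α * z + β) / (γ * z + δ)) =
      (γ * z + δ) * e ((a : ℂ) ^ 2 * δ * γ₁ / c) * latSum ε' ((a : ℝ) * δ / c) z := by
  rw [latSum, latSum, ← (affineEquiv hdet (γ₁ * a)).tsum_eq fun p =>
    ε' p * latTerm ((a : ℝ) * δ / c) z p.1 p.2, mul_left_comm (_ * e _),
    ← tsum_mul_left (a := (γ * z + δ) * e ((a : ℂ) ^ 2 * δ * γ₁ / c))]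
  congr 1
  refine tsum_congr fun p => ?_
  obtain ⟨n, m⟩ := p
  simp only [affineEquiv, Equiv.coe_fn_mk]
  rw [hε, latTerm_transform hc hdet hγ hγ₁ hz]
  ring

lemma neg_one_zpow_congr {m n : ℤ} (h : Even m ↔ Even n) : (-1 : ℂ) ^ m = (-1) ^ n := by
  by_cases hm : Even m
  · rw [hm.neg_one_zpow, (h.mp hm).neg_one_zpow]
  · rw [(Int.not_even_iff_odd.mp hm).neg_one_zpow,
      (Int.not_even_iff_odd.mp fun hn => hm (h.mpr hn)).neg_one_zpow]

/-- Here `γ₁` is even because `c` is odd, and `α` is odd, so `γ m + α n + γ₁ a` has the parity of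
`n`. -/
lemma latSum_transform_of_even {a c : ℕ} (hc : Odd c) {α β γ δ γ₁ : ℤ} (hdet : α * δ - β * γ = 1)
    (hγ : 0 < γ) (hγ₁ : γ = c * γ₁) (h : Even γ) {z : ℂ} (hz : 0 < z.im) :
    latSum (fun p => (-1) ^ p.1) ((a : ℝ) / c) ((α * z + β) / (γ * z + δ)) =
      (γ * z + δ) * e ((a : ℂ) ^ 2 * δ * γ₁ / c) *
        latSum (fun p => (-1) ^ p.1) ((a : ℝ) * δ / c) z := by
  refine latSum_transform hc.pos hdet hγ hγ₁ hz fun n m => neg_one_zpow_congr ?_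
  have hc' : Odd (c : ℤ) := by exact_mod_cast hc
  have h1 : Even γ₁ := by
    rw [hγ₁, Int.even_mul] at h
    exact h.resolve_left (Int.not_even_iff_odd.mpr hc')
  have h2 : Odd α := by
    have h3 : Odd (α * δ) := by
      rw [show α * δ = β * γ + 1 by linarith]
      exact (h.mul_left β).add_one
    exact (Int.odd_mul.mp h3).1
  have h2' : ¬Even α := Int.not_even_iff_odd.mpr h2
  simp only [Int.even_add, Int.even_mul, h, h1, h2', true_or, false_or, true_iff, iff_true]

/-- With `δ` even and `β` odd, it is the second coordinate `δ m + β n` that has the parity of `n`;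
the sign moves from the theta variable to the Poisson variable. -/
lemma latSum_transform_of_odd {a c : ℕ} (hc : Odd c) {α β γ δ γ₁ : ℤ} (hdet : α * δ - β * γ = 1)
    (hγ : 0 < γ) (hγ₁ : γ = c * γ₁) (h : Even δ) {z : ℂ} (hz : 0 < z.im) :
    latSum (fun p => (-1) ^ p.1) ((a : ℝ) / c) ((α * z + β) / (γ * z + δ)) =
      (γ * z + δ) * e ((a : ℂ) ^ 2 * δ * γ₁ / c) *
        latSum (fun p => (-1) ^ p.2) ((a : ℝ) * δ / c) z := by
  refine latSum_transform hc.pos hdet hγ hγ₁ hz fun n m => neg_one_zpow_congr ?_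
  have h2 : Odd β := by
    have h3 : Odd (β * γ) := by
      rw [show β * γ = δ * α - 1 by linarith]
      exact (h.mul_right α).sub_odd odd_one
    exact (Int.odd_mul.mp h3).1
  have h2' : ¬Even β := Int.not_even_iff_odd.mpr h2
  simp only [Int.even_add, Int.even_mul, h, h2', true_or, false_or, true_iff]

/-! ### Transformation of `ℳ` -/

lemma ne_int_of_not_dvd {c : ℕ} (hc : 0 < c) {k : ℤ} (hk : ¬(c : ℤ) ∣ k) (m : ℤ) :
    (k : ℝ) / c ≠ m := by
  intro h
  have hc' : (c : ℝ) ≠ 0 := by exact_mod_cast hc.ne'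
  rw [div_eq_iff hc'] at h
  have h2 : k = m * c := by exact_mod_cast h
  exact hk ⟨m, by rw [h2, mul_comm]⟩

/-- A zero of the cosine would make `2 k` a multiple of `c`; oddness of `c` then forces `c ∣ k`. -/
lemma cos_ne_zero_of_not_dvd {c : ℕ} (hc : Odd c) {k : ℤ} (hk : ¬(c : ℤ) ∣ k) :
    Real.cos (Real.pi * ((k : ℝ) / c)) ≠ 0 := by
  rw [Real.cos_ne_zero_iff]
  intro l h
  have hc' : (c : ℝ) ≠ 0 := by exact_mod_cast hc.pos.ne'
  have hpi := Real.pi_ne_zero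
  have h1 : (2 * k : ℝ) = (2 * l + 1) * c := by
    field_simp at h
    linarith
  have h2 : 2 * k = (2 * l + 1) * (c : ℤ) := by exact_mod_cast h1
  have hcop : IsCoprime (c : ℤ) 2 := by
    have := (Nat.coprime_two_right.mpr hc)
    exact_mod_cast Nat.isCoprime_iff_coprime.mpr this
  exact hk (hcop.dvd_of_dvd_mul_left ⟨2 * l + 1, by rw [h2, mul_comm]⟩)

lemma not_dvd_mul {a c : ℕ} (ha : 0 < a) (hac : a < c) {α β γ δ γ₁ : ℤ} (hdet : α * δ - β * γ = 1)
    (hγ₁ : γ = c * γ₁) : ¬(c : ℤ) ∣ a * δ := by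
  intro h
  have hcop : IsCoprime (c : ℤ) δ := ⟨-(β * γ₁), α, by rw [← hdet, hγ₁]; ring⟩
  have h1 := hcop.dvd_of_dvd_mul_right h
  have h2 : c ∣ a := by exact_mod_cast h1
  exact absurd (Nat.le_of_dvd ha h2) (not_le.mpr hac)

lemma rotSqrt_sq_mul_I (w : ℂ) : w = Complex.I * rotSqrt w ^ 2 := by
  rw [rotSqrt_sq]
  linear_combination w * Complex.I_sq

lemma im_mul_add_pos {γ : ℤ} (hγ : 0 < γ) (δ : ℤ) {z : ℂ} (hz : 0 < z.im) :
    0 < ((γ : ℂ) * z + δ).im := by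
  rw [Complex.add_im, Complex.intCast_im, add_zero, ← Complex.ofReal_intCast, Complex.im_ofReal_mul]
  have : (0 : ℝ) < γ := by exact_mod_cast hγ
  positivity

/-- The weight 1 law of the lattice sum is divided by the weight 1/2 law of `theta4`. Since `γ z + δ
= i R²` for the root `R`, the quotient is `i R`; the constant `theta4 (e z)` cancels from both the
Appell and the period part. -/
lemma calM_transform_of_even {a c : ℕ} (ha : 0 < a) (hac : a < c) (hc : Odd c) {α β γ δ γ₁ : ℤ}
    (hdet : α * δ - β * γ = 1) (hγ : 0 < γ) (hγ₁ : γ = c * γ₁) (h : Even γ) {z : ℂ}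
    (hz : 0 < z.im) :
    calM a c ((α * z + β) / (γ * z + δ)) = Complex.I * e ((a : ℂ) ^ 2 * δ * γ₁ / c) *
        Real.tan (Real.pi * a / c) * (omega α γ ^ 2 / omega α (γ / 2)) * rotSqrt (γ * z + δ) *
      (Real.cot (Real.pi * a * δ / c) * calO ((a : ℝ) * δ / c) z +
        √2 * periodIntegral (thetaSeries 0 ((a : ℝ) * δ / c) evenSign) z) := by
  obtain ⟨hA, -⟩ := mobius_im_pos hdet (Or.inl hγ.ne') hz
  have hnd : ¬(c : ℤ) ∣ a := by
    have := not_dvd_mul ha hac (α := 1) (β := 0) (γ := 0) (δ := 1) (γ₁ := 0) (by norm_num) (by simp)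
    simpa using this
  have hnd' := not_dvd_mul ha hac hdet hγ₁
  have hx : ∀ m : ℤ, (a : ℝ) / c ≠ m := by simpa using ne_int_of_not_dvd hc.pos hnd
  have hx' : ∀ m : ℤ, (a : ℝ) * δ / c ≠ m := by simpa using ne_int_of_not_dvd hc.pos hnd'
  have hcos : Real.cos (Real.pi * ((a : ℝ) / c)) ≠ 0 := by simpa using cos_ne_zero_of_not_dvd hc hnd
  have hcos' : Real.cos (Real.pi * ((a : ℝ) * δ / c)) ≠ 0 := by
    simpa using cos_ne_zero_of_not_dvd hc hnd'
  have h1 := theta4_mul_calM hc.pos hx hcos hA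
  rw [latSum_transform_of_even hc hdet hγ hγ₁ h hz, latSum_cot hx' hz,
    theta4_transform_of_even hdet hγ h hz] at h1
  have h2 := theta4_mul_calO hx' hcos' hz
  have hr := rotSqrt_ne_zero (im_mul_add_pos hγ δ hz)
  have hj := rotSqrt_sq_mul_I (γ * z + δ)
  have ho1 : omega α γ ≠ 0 := Complex.exp_ne_zero _
  have ho2 : omega α (γ / 2) ≠ 0 := Complex.exp_ne_zero _
  have ht := theta4_ne_zero (e_ne_zero z) (norm_e_lt_one hz)
  have hsin' : Real.sin (Real.pi * ((a : ℝ) * δ / c)) ≠ 0 := by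
    have := sin_pi_mul_ne_zero (v := (((a : ℝ) * δ / c : ℝ) : ℂ)) (fun m hm => hx' m (by exact_mod_cast hm))
    exact_mod_cast this
  have hct : (Real.cot (Real.pi * a * δ / c) : ℂ) * Real.tan (Real.pi * ((a : ℝ) * δ / c)) = 1 := by
    rw [← Complex.ofReal_mul, show Real.pi * a * δ / c = Real.pi * ((a : ℝ) * δ / c) by ring,
      Real.cot_eq_cos_div_sin, Real.tan_eq_sin_div_cos, div_mul_div_cancel₀ hsin', div_self hcos',
      Complex.ofReal_one]
  set S := ∑' n : ℤ, (-1) ^ n * e ((n : ℂ) ^ 2 * z) *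
    Complex.cot (Real.pi * ((((a : ℝ) * δ / c : ℝ) : ℂ) + n * z))
  have h3 : S = theta4 (e z) * (Real.cot (Real.pi * a * δ / c) * calO ((a : ℝ) * δ / c) z) := by
    linear_combination (-S) * hct - (Real.cot (Real.pi * a * δ / c) : ℂ) * h2
  rw [h3] at h1
  set R := rotSqrt (γ * z + δ)
  set M := calM a c ((α * z + β) / (γ * z + δ))
  rw [hj] at h1
  set P := periodIntegral (thetaSeries 0 ((a : ℝ) * δ / c) evenSign) z
  set O := calO ((a : ℝ) * δ / c) z
  set ct : ℂ := (Real.cot (Real.pi * a * δ / c) : ℂ)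
  set tn : ℂ := (Real.tan (Real.pi * a / c) : ℂ)
  set T := theta4 (e z)
  set E := e ((a : ℂ) ^ 2 * δ * γ₁ / c)
  apply mul_left_cancel₀ (mul_ne_zero (mul_ne_zero (mul_ne_zero (inv_ne_zero (pow_ne_zero 2 ho1)) ho2) hr) ht)
  rw [h1]
  field_simp

/-- The same division, with the cosecant sum and `thetaQuarter` on the right. The constant `√2`
comes from the factor 2 in `thetaQuarter_mul_calU` over the `√2` in the law of `theta4`. -/
lemma calM_transform_of_odd {a c : ℕ} (ha : 0 < a) (hac : a < c) (hc : Odd c) {α β γ δ γ₁ : ℤ}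
    (hdet : α * δ - β * γ = 1) (hγ : 0 < γ) (hγ₁ : γ = c * γ₁) (h : Even δ) {z : ℂ}
    (hz : 0 < z.im) :
    calM a c ((α * z + β) / (γ * z + δ)) =
      Complex.I * Complex.exp (-(Real.pi * Complex.I * δ / (8 * γ)) +
            2 * Real.pi * Complex.I * (a : ℂ) ^ 2 * δ * γ₁ / c) *
        Real.tan (Real.pi * a / c) * (omega α γ ^ 2 / omega (2 * α) γ) * rotSqrt (γ * z + δ) *
      (√2 * calU ((a : ℝ) * δ / c) z +
        periodIntegral (thetaSeries (1 / 2) ((a : ℝ) * δ / c) fun _ => 1) z) := by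
  obtain ⟨hA, -⟩ := mobius_im_pos hdet (Or.inl hγ.ne') hz
  have hnd : ¬(c : ℤ) ∣ a := by
    have := not_dvd_mul ha hac (α := 1) (β := 0) (γ := 0) (δ := 1) (γ₁ := 0) (by norm_num) (by simp)
    simpa using this
  have hnd' := not_dvd_mul ha hac hdet hγ₁
  have hx : ∀ m : ℤ, (a : ℝ) / c ≠ m := by simpa using ne_int_of_not_dvd hc.pos hnd
  have hx' : ∀ m : ℤ, (a : ℝ) * δ / c ≠ m := by simpa using ne_int_of_not_dvd hc.pos hnd'
  have hcos : Real.cos (Real.pi * ((a : ℝ) / c)) ≠ 0 := by simpa using cos_ne_zero_of_not_dvd hc hnd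
  have h1 := theta4_mul_calM hc.pos hx hcos hA
  rw [latSum_transform_of_odd hc hdet hγ hγ₁ h hz, latSum_csc hx' hz,
    theta4_transform_of_odd hdet hγ h hz] at h1
  have h2 := thetaQuarter_mul_calU hx' hz
  have hr := rotSqrt_ne_zero (im_mul_add_pos hγ δ hz)
  have hj := rotSqrt_sq_mul_I (γ * z + δ)
  have ho1 : omega α γ ≠ 0 := Complex.exp_ne_zero _
  have ho2 : omega (2 * α) γ ≠ 0 := Complex.exp_ne_zero _
  have ht := thetaQuarter_ne_zero hz
  set S := ∑' n : ℤ, e ((n : ℂ) ^ 2 * z) /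
    Complex.sin (Real.pi * ((((a : ℝ) * δ / c : ℝ) : ℂ) + n * z))
  have h3 : S = 2 * thetaQuarter z * calU ((a : ℝ) * δ / c) z := by linear_combination -2 * h2
  have hE : Complex.exp (-(Real.pi * Complex.I * δ / (8 * γ)) +
      2 * Real.pi * Complex.I * (a : ℂ) ^ 2 * δ * γ₁ / c) =
      (Complex.exp (Real.pi * Complex.I * δ / (8 * γ)))⁻¹ * e ((a : ℂ) ^ 2 * δ * γ₁ / c) := by
    rw [Complex.exp_add, Complex.exp_neg, e]
    congr 2
    ring
  have hE0 := Complex.exp_ne_zero (Real.pi * Complex.I * δ / (8 * γ))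
  have hs0 : (√2 : ℂ) ≠ 0 := by
    have : √2 ≠ 0 := by positivity
    exact_mod_cast this
  have hs2 : (√2 : ℂ) ^ 2 = 2 := by
    rw [← Complex.ofReal_pow, Real.sq_sqrt zero_le_two]; simp
  rw [h3] at h1
  rw [hE]
  set R := rotSqrt (γ * z + δ)
  set M := calM a c ((α * z + β) / (γ * z + δ))
  rw [hj] at h1
  set P := periodIntegral (thetaSeries (1 / 2) ((a : ℝ) * δ / c) fun _ => 1) z
  set U := calU ((a : ℝ) * δ / c) z
  set tn : ℂ := (Real.tan (Real.pi * a / c) : ℂ)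
  set T := thetaQuarter z
  set E := e ((a : ℂ) ^ 2 * δ * γ₁ / c)
  set X := Complex.exp (Real.pi * Complex.I * δ / (8 * γ))
  apply mul_left_cancel₀ (mul_ne_zero (mul_ne_zero (mul_ne_zero (mul_ne_zero (mul_ne_zero hE0
    (inv_ne_zero (pow_ne_zero 2 ho1))) ho2) hs0) hr) ht)
  rw [h1]
  field_simp
  linear_combination (-(tn * E * U)) * hs2

end OverpartitionRank

/-! ### Holomorphy and recognition of holomorphic parts. -/

namespace OverpartitionRank

open ModularForm Filter Topology Set

/-! ### Holomorphy -/

lemma differentiable_e : Differentiable ℂ e := by unfold e; fun_prop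

lemma differentiableOn_calO (x : ℝ) : DifferentiableOn ℂ (calO x) upperHalf := by
  refine (differentiableOn_rankGen (norm_e_ofReal x)).comp differentiable_e.differentiableOn fun z hz => ?_
  rw [mem_ball_zero_iff]
  exact norm_e_lt_one hz

lemma differentiableOn_rotSqrt {γ : ℤ} (hγ : 0 < γ) (δ : ℤ) :
    DifferentiableOn ℂ (fun z => rotSqrt (γ * z + δ)) upperHalf := by
  intro z hz
  unfold rotSqrt
  refine (DifferentiableAt.cpow (by fun_prop) (by fun_prop) (Or.inl ?_)).differentiableWithinAt
  rw [neg_I_mul_re]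
  exact im_mul_add_pos hγ δ hz

lemma calU_neg (x : ℝ) (z : ℂ) : calU (-x) z = -calU x z := by
  rw [calU, calU]
  simp only [mul_neg, Real.sin_neg, Real.cos_neg]
  push_cast
  ring

/-- The summand of `𝒰`. -/
noncomputable def calUTerm (x : ℝ) (n : ℤ) (z : ℂ) : ℂ :=
  (1 + e (n * z)) * e (((n : ℂ) ^ 2 + n / 2) * z) /
    (1 - 2 * e (n * z) * (Real.cos (2 * Real.pi * x) : ℂ) + e (2 * n * z))

lemma calUTerm_den_eq (x : ℝ) (n : ℤ) (z : ℂ) :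
    1 - 2 * e (n * z) * (Real.cos (2 * Real.pi * x) : ℂ) + e (2 * n * z) =
      (1 - e (x + n * z)) * (1 - e (-x + n * z)) := by
  have hcos : 2 * (Real.cos (2 * Real.pi * x) : ℂ) = e x + e (-x) := by
    push_cast
    rw [Complex.cos, e, e]
    ring_nf
  have h1 : e x * e (-x) = 1 := by rw [← e_add]; simp [e]
  have h2 : e (2 * n * z) = e (n * z) * e (n * z) := by rw [← e_add]; congr 1; ring
  rw [e_add, e_add, h2]
  linear_combination (-e (n * z)) * hcos - e (n * z) * e (n * z) * h1

lemma calUTerm_den_ne_zero {x : ℝ} (hx : ∀ m : ℤ, x ≠ m) (n : ℤ) {z : ℂ} (hz : 0 < z.im) :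
    1 - 2 * e (n * z) * (Real.cos (2 * Real.pi * x) : ℂ) + e (2 * n * z) ≠ 0 := by
  have key : ∀ x : ℝ, (∀ m : ℤ, x ≠ m) → 1 - e ((x : ℂ) + n * z) ≠ 0 := fun x hx => by
    rw [← neg_sub, e_sub_one_eq]
    exact neg_ne_zero.mpr (mul_ne_zero (mul_ne_zero (mul_ne_zero two_ne_zero Complex.I_ne_zero)
      (sin_pi_mul_ne_zero (add_mul_ne_int hx hz n))) (e_ne_zero _))
  rw [calUTerm_den_eq]
  refine mul_ne_zero (key x hx) ?_
  have := key (-x) fun m hm => hx (-m) (by push_cast; linarith)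
  push_cast at this
  exact this

lemma calUTerm_neg (x : ℝ) (n : ℤ) (z : ℂ) : calUTerm x (-n) z = calUTerm x n z := by
  have h0 := e_ne_zero (2 * n * z)
  rw [calUTerm, calUTerm, ← mul_div_mul_left _ _ h0]
  have h1 : e (2 * n * z) = e (n * z) * e (n * z) := by rw [← e_add]; congr 1; ring
  have h2 : e (n * z) * e (((-n : ℤ) : ℂ) * z) = 1 := by
    rw [← e_add]; push_cast; rw [show (n : ℂ) * z + -n * z = 0 by ring]; simp [e]
  have h3 : e (2 * n * z) * e (2 * ((-n : ℤ) : ℂ) * z) = 1 := by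
    rw [← e_add]; push_cast; rw [show (2 : ℂ) * n * z + 2 * -n * z = 0 by ring]; simp [e]
  have h4 : e (n * z) * e ((((-n : ℤ) : ℂ) ^ 2 + ((-n : ℤ) : ℂ) / 2) * z) =
      e (((n : ℂ) ^ 2 + n / 2) * z) := by
    rw [← e_add]; congr 1; push_cast; ring
  congr 1
  · rw [← h4, h1]
    linear_combination (e (n * z) * e ((((-n : ℤ) : ℂ) ^ 2 + ((-n : ℤ) : ℂ) / 2) * z)) * h2
  · rw [mul_add, mul_sub, h3, h1]
    linear_combination (-2 * e (n * z) * (Real.cos (2 * Real.pi * x) : ℂ)) * h2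

lemma norm_calUTerm_le (x : ℝ) {b : ℝ} (hb : 0 < b) {n : ℤ} (hn : n ≠ 0) {z : ℂ} (hz : b ≤ z.im) :
    ‖calUTerm x n z‖ ≤ 2 / (1 - Real.exp (-(2 * Real.pi * b))) ^ 2 *
      Real.exp (-(2 * Real.pi * b) * (0 + n) ^ 2) := by
  have hz0 : 0 < z.im := hb.trans_le hz
  -- The summand is even in `n`, and for `n > 0` both `e(n z)` and the factors of the denominator
  -- are controlled by `exp (-2 π b)`.
  wlog hpos : 0 < n generalizing n
  · have := this (n := -n) (neg_ne_zero.mpr hn) (by omega)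
    rw [calUTerm_neg] at this
    push_cast at this
    rwa [show (0 + -(n : ℝ)) ^ 2 = (0 + n) ^ 2 by ring] at this
  have h1n : (1 : ℝ) ≤ n := by exact_mod_cast hpos
  have hpi := Real.pi_pos
  have him : ∀ r : ℝ, ((r : ℂ) * z).im = r * z.im := fun r => Complex.im_ofReal_mul _ _
  have hr : Real.exp (-(2 * Real.pi * b)) < 1 := by
    rw [Real.exp_lt_one_iff]
    have : 0 < 2 * Real.pi * b := by positivity
    linarith
  have hden : ∀ x : ℝ, 1 - Real.exp (-(2 * Real.pi * b)) ≤ ‖1 - e ((x : ℂ) + n * z)‖ := fun x => by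
    have h1 : ‖e ((x : ℂ) + n * z)‖ ≤ Real.exp (-(2 * Real.pi * b)) := by
      rw [norm_e]
      apply Real.exp_le_exp.mpr
      have : ((x : ℂ) + n * z).im = n * z.im := by simp
      rw [this]
      have : b ≤ n * z.im := by nlinarith
      nlinarith
    have h2 := norm_sub_norm_le (1 : ℂ) (e ((x : ℂ) + n * z))
    rw [norm_one] at h2
    linarith
  have h1 : ‖1 + e (n * z)‖ ≤ 2 := by
    refine (norm_add_le _ _).trans ?_
    have h2 : ‖e (n * z)‖ ≤ 1 := by
      rw [norm_e, Real.exp_le_one_iff, ← Complex.ofReal_intCast, him]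
      have : 0 ≤ (n : ℝ) * z.im := by positivity
      nlinarith
    rw [norm_one]
    linarith
  have h2 : ‖e (((n : ℂ) ^ 2 + n / 2) * z)‖ ≤ Real.exp (-(2 * Real.pi * b) * (0 + n) ^ 2) := by
    rw [norm_e, show ((n : ℂ) ^ 2 + n / 2) = ((n ^ 2 + n / 2 : ℝ) : ℂ) by push_cast; rfl, him]
    apply Real.exp_le_exp.mpr
    have h3 : (n : ℝ) ^ 2 * b ≤ (n ^ 2 + n / 2) * z.im := by
      have h4 : (n : ℝ) ^ 2 ≤ n ^ 2 + n / 2 := by linarith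
      gcongr
    rw [zero_add]
    nlinarith
  have hd2 := hden (-x)
  push_cast at hd2
  rw [calUTerm, calUTerm_den_eq, norm_div, norm_mul, norm_mul, div_mul_eq_mul_div]
  refine div_le_div₀ (by positivity) (mul_le_mul h1 h2 (norm_nonneg _) (by norm_num))
    (pow_pos (by linarith) 2) ?_
  rw [sq]
  exact mul_le_mul (hden x) hd2 (by linarith) (norm_nonneg _)

lemma differentiableOn_calU {x : ℝ} (hx : ∀ m : ℤ, x ≠ m) :
    DifferentiableOn ℂ (calU x) upperHalf := by
  have heta : DifferentiableOn ℂ eta upperHalf := fun z hz =>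
    (differentiableAt_eta_of_mem_upperHalfPlaneSet hz).differentiableWithinAt
  have heta2 : DifferentiableOn ℂ (fun z => eta (z / 2)) upperHalf :=
    heta.comp (by fun_prop) fun z hz => by
      have : 0 < z.im := hz
      simpa [upperHalf] using this
  have hterm : ∀ n : ℤ, DifferentiableOn ℂ (calUTerm x n) upperHalf := fun n => by
    have := differentiable_e
    exact DifferentiableOn.div (by fun_prop) (by fun_prop) fun z hz => calUTerm_den_ne_zero hx n hz
  have hsum : DifferentiableOn ℂ (fun z => ∑' n : ℤ, calUTerm x n z) upperHalf := by
    intro z hz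
    have hz' : 0 < z.im := hz
    have hopen : IsOpen {w : ℂ | z.im / 2 < w.im} := isOpen_lt continuous_const Complex.continuous_im
    have hsub : {w : ℂ | z.im / 2 < w.im} ⊆ upperHalf := fun w hw => by
      have hw' : z.im / 2 < w.im := hw
      exact lt_trans (half_pos hz') hw'
    have hmem : z ∈ {w : ℂ | z.im / 2 < w.im} := half_lt_self hz'
    set u : ℤ → ℝ := fun n => 2 / (1 - Real.exp (-(2 * Real.pi * (z.im / 2)))) ^ 2 *
      Real.exp (-(2 * Real.pi * (z.im / 2)) * (0 + n) ^ 2)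
    have hu : Summable u := (summable_gaussian (by positivity) 0).mul_left _
    -- The term `n = 0` is set apart because the uniform bound needs `e(n w)` to be small; that term
    -- is holomorphic by itself.
    have h1 : DifferentiableOn ℂ (fun w => ∑' n : ℤ, if n = 0 then 0 else calUTerm x n w)
        {w : ℂ | z.im / 2 < w.im} := by
      refine Complex.differentiableOn_tsum_of_summable_norm hu (fun n => ?_) hopen fun n w hw => ?_
      · split_ifs
        · exact differentiableOn_const 0
        · exact (hterm n).mono hsub
      · split_ifs with h0
        · rw [norm_zero]; positivity
        · exact norm_calUTerm_le x (half_pos hz') h0 (le_of_lt hw)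
    have h2 : DifferentiableOn ℂ (fun w => ∑' n : ℤ, calUTerm x n w) {w : ℂ | z.im / 2 < w.im} := by
      refine (((hterm 0).mono hsub).add h1).congr fun w hw => ?_
      have hs : Summable fun n : ℤ => if n = 0 then 0 else calUTerm x n w := by
        refine Summable.of_norm_bounded hu fun n => ?_
        split_ifs with h0
        · rw [norm_zero]; positivity
        · exact norm_calUTerm_le x (half_pos hz') h0 (le_of_lt hw)
      have hs0 : HasSum (fun n : ℤ => if n = 0 then calUTerm x 0 w else 0) (calUTerm x 0 w) :=
        hasSum_ite_eq 0 _
      rw [Pi.add_apply, ← (hs0.add hs.hasSum).tsum_eq]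
      refine tsum_congr fun n => ?_
      split_ifs with h0
      · rw [h0, add_zero]
      · rw [zero_add]
    exact ((h2 z hmem).differentiableAt (hopen.mem_nhds hmem)).differentiableWithinAt
  refine (((differentiableOn_const (Real.sin (Real.pi * x) : ℂ)).mul
    (heta2.div (heta.pow 2) fun z hz => pow_ne_zero 2 (eta_ne_zero' hz))).mul hsum).congr fun z _ => ?_
  rfl

/-! ### Holomorphic parts -/

/-- The path starts at `-z̄`, so moving `z` by 1 moves `τ` by `-1` and leaves `τ + z` unchanged. -/
lemma periodIntegral_add_one (g : ℂ → ℂ) (z : ℂ) :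
    periodIntegral g (z + 1) = periodIntegral (fun τ => g (τ - 1)) z := by
  rw [periodIntegral, periodIntegral]
  congr 1
  ext t
  rw [map_add, map_one, show -((starRingEnd ℂ) z + 1) + Complex.I * t =
    -(starRingEnd ℂ) z + Complex.I * t - 1 by ring, show -(starRingEnd ℂ) z + Complex.I * t - 1 +
      (z + 1) = -(starRingEnd ℂ) z + Complex.I * t + z by ring]

/-- The non-holomorphic part may be given as the period integral of a translated unary theta
series. -/
lemma IsHolomorphicPart.of_thetaSeries {A : SL(2, ℤ)} {F H : ℂ → ℂ}
    (hH : DifferentiableOn ℂ H upperHalf) {s x : ℝ} (hs : ∃ k : ℤ, 2 * s = k) {c : ℤ → ℂ}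
    (hc : ∀ l, ‖c l‖ ≤ 1) (K : ℂ) (r : ℤ)
    (h : ∀ z ∈ upperHalf, F (mobius A z) = H z + autFactor A z *
      (K * periodIntegral (fun τ => thetaSeries s x c (τ - r)) z)) :
    IsHolomorphicPart A F H := by
  obtain ⟨B, ε, hε, hB⟩ := thetaSeries_decay (x := x) hs hc
  refine ⟨hH, fun τ => K * thetaSeries s x c (τ - r), ?_, ⟨‖K‖ * B, ε, hε, fun τ hτ => ?_⟩,
    fun z hz => ?_⟩
  · refine DifferentiableOn.const_mul ((differentiableOn_thetaSeries hc).comp (by fun_prop)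
      fun τ hτ => ?_) K
    have : 0 < τ.im := hτ
    simpa [upperHalf] using this
  · rw [norm_mul, mul_assoc]
    gcongr
    simpa using hB (τ - r) (by simpa using hτ)
  · rw [h z hz, periodIntegral_const_mul]

end OverpartitionRank

/-! ### The three parity cases. -/

open OverpartitionRank

theorem corollary2p3 (a c : ℕ) (ha : 0 < a) (hac : a < c) (hc : Odd c)
    (A : SL(2, ℤ)) (hA : A ∈ CongruenceSubgroup.Gamma0 c)
    (α γ δ γ₁ : ℤ) (hα : α = A 0 0) (hγ : γ = A 1 0) (hδ : δ = A 1 1)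
    (hγpos : 0 < γ) (hγ₁ : γ₁ = γ / (Int.gcd c γ : ℤ)) :
    (Even γ →
      OverpartitionRank.IsHolomorphicPart A (OverpartitionRank.calM a c) (fun z =>
        Complex.I * OverpartitionRank.e ((a : ℂ) ^ 2 * δ * γ₁ / c) *
          (Real.tan (Real.pi * a / c) : ℂ) * (Real.cot (Real.pi * a * δ / c) : ℂ) *
          (OverpartitionRank.omega α γ ^ 2 / OverpartitionRank.omega α (γ / 2)) *
          OverpartitionRank.autFactor A z *
          OverpartitionRank.calO ((a : ℝ) * δ / c) z)) ∧
    (Odd γ → Even δ →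
      OverpartitionRank.IsHolomorphicPart A (OverpartitionRank.calM a c) (fun z =>
        -(Real.sqrt 2 : ℂ) * Complex.I *
          Complex.exp (-(Real.pi * Complex.I * δ / (8 * γ)) +
            2 * Real.pi * Complex.I * (a : ℂ) ^ 2 * δ * γ₁ / c) *
          (Real.tan (Real.pi * a / c) : ℂ) *
          (OverpartitionRank.omega α γ ^ 2 / OverpartitionRank.omega (2 * α) γ) *
          OverpartitionRank.autFactor A z *
          OverpartitionRank.calU (-((a : ℝ) * δ / c)) z)) ∧
    (Odd γ → Odd δ →
      OverpartitionRank.IsHolomorphicPart A (OverpartitionRank.calM a c) (fun z =>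
        -(Real.sqrt 2 : ℂ) * Complex.I *
          Complex.exp (-(Real.pi * Complex.I * (δ - γ) / (8 * γ)) +
            2 * Real.pi * Complex.I * (a : ℂ) ^ 2 * (δ - γ) * γ₁ / c) *
          (Real.tan (Real.pi * a / c) : ℂ) *
          (OverpartitionRank.omega α γ ^ 2 / OverpartitionRank.omega (2 * α) γ) *
          OverpartitionRank.autFactor A z *
          OverpartitionRank.calU (-((a : ℝ) * (δ - γ) / c)) (z + 1))) := by
  have hdvd : (c : ℤ) ∣ γ := by
    rw [hγ]
    exact (ZMod.intCast_zmod_eq_zero_iff_dvd _ _).mp (CongruenceSubgroup.Gamma0_mem.mp hA)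
  have hγc : γ = c * γ₁ := by
    have hg : (Int.gcd c γ : ℤ) = c := by
      rw [Int.gcd, Int.natAbs_natCast, Nat.gcd_eq_left (Int.natCast_dvd.mp hdvd)]
    rw [hγ₁, hg, Int.mul_ediv_cancel' hdvd]
  have hdet : α * δ - A 0 1 * γ = 1 := by
    rw [hα, hγ, hδ, ← Matrix.det_fin_two]
    exact A.det_coe
  have hmob : ∀ z, mobius A z = (α * z + (A 0 1 : ℤ)) / (γ * z + δ) := fun z => by
    rw [mobius, hα, hγ, hδ]
  have haut : ∀ z, autFactor A z = rotSqrt (γ * z + δ) := fun z => by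
    rw [autFactor, rotSqrt, hγ, hδ]
  have hautd : DifferentiableOn ℂ (autFactor A) upperHalf :=
    (differentiableOn_rotSqrt hγpos δ).congr fun z _ => haut z
  refine ⟨fun hev => ?_, fun hodd hev => ?_, fun hodd hoddδ => ?_⟩
  · refine IsHolomorphicPart.of_thetaSeries ((hautd.const_mul _).mul (differentiableOn_calO _))
      isSignKernel_cot.two_mul norm_evenSign_le (Complex.I * e ((a : ℂ) ^ 2 * δ * γ₁ / c) *
        Real.tan (Real.pi * a / c) * (omega α γ ^ 2 / omega α (γ / 2)) * √2) 0
      (x := (a : ℝ) * δ / c) fun z hz => ?_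
    rw [hmob, haut, calM_transform_of_even ha hac hc hdet hγpos hγc hev hz]
    simp only [Int.cast_zero, sub_zero]
    ring
  · have hnd := not_dvd_mul ha hac hdet hγc
    -- The argument of `𝒰` is non-integral, so its denominators do not vanish. Its negative sign is
    -- absorbed later by the oddness of `𝒰` in `x`.
    have hx : ∀ m : ℤ, -((a : ℝ) * δ / c) ≠ m := fun m hm =>
      ne_int_of_not_dvd hc.pos hnd (-m) (by push_cast; linarith)
    refine IsHolomorphicPart.of_thetaSeries ((hautd.const_mul _).mul (differentiableOn_calU hx))
      isSignKernel_csc.two_mul (c := fun _ => 1) (by simp) (Complex.I *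
        Complex.exp (-(Real.pi * Complex.I * δ / (8 * γ)) +
            2 * Real.pi * Complex.I * (a : ℂ) ^ 2 * δ * γ₁ / c) *
        Real.tan (Real.pi * a / c) * (omega α γ ^ 2 / omega (2 * α) γ)) 0
      (x := (a : ℝ) * δ / c) fun z hz => ?_
    rw [hmob, haut, calM_transform_of_odd ha hac hc hdet hγpos hγc hev hz, calU_neg]
    simp only [Int.cast_zero, sub_zero]
    ring
  -- Right multiplication of `A` by the inverse translation gives lower right entry `δ - γ`, which
  -- is even, and sends `z + 1` to `A z`. The previous case applies at `z + 1`, and the period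
  -- integral is brought back to `z` by translating the theta series, whence the shift `r = 1`.
  · have hdet' : α * (δ - γ) - (A 0 1 - α) * γ = 1 := by linear_combination hdet
    have hev : Even (δ - γ) := hoddδ.sub_odd hodd
    have hnd := not_dvd_mul ha hac hdet' hγc
    have hx : ∀ m : ℤ, -((a : ℝ) * (δ - γ) / c) ≠ m := fun m hm =>
      ne_int_of_not_dvd hc.pos hnd (-m) (by push_cast; linarith)
    have hshift : DifferentiableOn ℂ (fun z => calU (-((a : ℝ) * (δ - γ) / c)) (z + 1)) upperHalf :=
      (differentiableOn_calU hx).comp (by fun_prop) fun z hz => by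
        have : 0 < z.im := hz
        simpa [upperHalf] using this
    refine IsHolomorphicPart.of_thetaSeries ((hautd.const_mul _).mul hshift)
      isSignKernel_csc.two_mul (c := fun _ => 1) (by simp) (Complex.I *
        Complex.exp (-(Real.pi * Complex.I * (δ - γ) / (8 * γ)) +
            2 * Real.pi * Complex.I * (a : ℂ) ^ 2 * (δ - γ) * γ₁ / c) *
        Real.tan (Real.pi * a / c) * (omega α γ ^ 2 / omega (2 * α) γ)) 1
      (x := (a : ℝ) * (δ - γ) / c) fun z hz => ?_
    have hz1 : 0 < (z + 1).im := by
      have : 0 < z.im := hz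
      simpa using this
    have h := calM_transform_of_odd ha hac hc hdet' hγpos hγc hev hz1
    have h1 : (γ : ℂ) * (z + 1) + ((δ - γ : ℤ) : ℂ) = γ * z + δ := by push_cast; ring
    have h2 : (α : ℂ) * (z + 1) + ((A 0 1 - α : ℤ) : ℂ) = α * z + (A 0 1 : ℤ) := by push_cast; ring
    rw [h1, h2, periodIntegral_add_one] at h
    simp only [Int.cast_sub] at h
    rw [hmob, haut, h, calU_neg]
    simp only [Int.cast_one]
    ring
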